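/- Let $n,d\ge 1$ and $\mathrm D=-\mathrm i\partial$. For $N>0$ put $\mathcal Z_{\rm hyp}(N)=\{(t,\xi)\in[0,\infty)\times\mathbb R^n:(1+t)|\xi|\ge N\}$ and $t_\xi=\max\{N/|\xi|-1,0\}$ for $\xi\ne0$ (so $t_\xi$ depends on $N$). Let $\mathcal S\{m_1,m_2\}$ be the set of (scalar or matrix valued) functions $a$ which, for some $N>0$, are $C^\infty$ on $\mathcal Z_{\rm hyp}(N)$ with $|\mathrm D_t^k\mathrm D_\xi^\alpha a(t,\xi)|\le C_{k,\alpha}|\xi|^{m_1-|\alpha|}(1+t)^{-m_2-k}$ there, for all $k$ and $\alpha$. Let $A(t,\xi)\in\mathbb C^{d\times d}$ satisfy the following, with all symbol estimates holding on one zone $\mathcal Z_{\rm hyp}(N_0)$, $N_0>0$. (A1) There is $A_{\rm hom}\in\mathcal S\{1,0\}$ with $A_{\rm hom}(t,\rho\xi)=\rho A_{\rm hom}(t,\xi)$ for $\rho>0$, $A-A_{\rm hom}\in\mathcal S\{0,1\}$, whose eigenvalues $\lambda_1,\dots,\lambda_d$ are real and satisfy $|\lambda_i(t,\xi)-\lambda_j(t,\xi)|\ge\delta|\xi|$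 for all $i\ne j$, $t\ge0$, $\xi\neq 0$, with some $\delta>0$. (A2) There is $M\in\mathcal S\{0,0\}$ with $M^{-1}\in\mathcal S\{0,0\}$ and $M^{-1}A_{\rm hom}M=\mathcal D:=\mathrm{diag}(\lambda_1,\dots,\lambda_d)$ on $\mathcal Z_{\rm hyp}(N_0)$; and, with $R_0=M^{-1}(A-A_{\rm hom})M+(\mathrm D_tM^{-1})M$, there are a diagonal $\mathring F$ with $\mathring F-\mathrm{diag}\,R_0\in\mathcal S\{-1,2\}$ and constants $\kappa_\pm,C_\pm\in\mathbb R$ such that, for every diagonal entry, $\kappa_+\log\frac{1+t}{1+s}+C_+\le\operatorname{Im}\int_s^t\mathring F(\tau,\xi)\,\mathrm d\tau\le\kappa_-\log\frac{1+t}{1+s}+C_-$ for all $\xi\ne0$ and all $t\ge s\ge t_\xi$ (with $N=N_0$). Then for every integer $k>\kappa_--\kappa_++1$ there is a zone constant $N\ge N_0$ such that the following hold on $\mathcal Z_{\rm hyp}(N)$, with constants independent of $t,s,\xi$. 1. There are matrices $N_0^{\sharp}=\mathrm I,N_1^\sharp,\dots,N_k^\sharp\in\mathcal S\{0,0\}$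 with inverses in $\mathcal S\{0,0\}$, diagonal matrices $F_0=\mathrm{diag}\,R_0,F_1,\dots,F_{k-1}\in\mathcal S\{0,1\}$ and matrices $R_j\in\mathcal S\{-j,j+1\}$, $1\le j\le k$, all with symbol estimates on $\mathcal Z_{\rm hyp}(N)$, such that $N_j^\sharp-N_{j-1}^\sharp\in\mathcal S\{-j,j\}$ for $1\le j\le k$, $F_j-F_{j-1}\in\mathcal S\{-j,j+1\}$ for $1\le j<k$, and $$(\mathrm D_t-\mathcal D-R_0)N_j^\sharp=N_j^\sharp(\mathrm D_t-\mathcal D-F_{j-1}-R_j),\qquad 1\le j\le k.$$ 2. The fundamental solution $\mathcal E(t,s,\xi)$ of $\mathrm D_t\mathcal E=A\mathcal E$, $\mathcal E(s,s,\xi)=\mathrm I$, exists for $t,s\ge t_\xi$, $\xi\neq0$, and there are matrices $\mathcal Q_k(t,s,\xi)$ such that for $t\ge s\ge t_\xi$ (in particular for $s=t_\xi$) $$\mathcal E(t,s,\xi)=M(t,\xi)N_k^\sharp(t,\xi)\,\widetilde{\mathcal E}_k(t,s,\xi)\,\mathcal Q_k(t,s,\xi)\,(N_k^\sharp)^{-1}(s,\xi)M^{-1}(s,\xi),$$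 where $\widetilde{\mathcal E}_k(t,s,\xi)=\exp\big(\mathrm i\int_s^t(\mathcal D+F_{k-1})(\tau,\xi)\,\mathrm d\tau\big)$. 3. $\|\widetilde{\mathcal E}_k(t,t_\xi,\xi)\|\le C\big(\frac{1+t}{1+t_\xi}\big)^{-\kappa_+}$ for $t\ge t_\xi$. 4. $\mathcal Q_k(t,s,\xi)$ is invertible with $\|\mathcal Q_k(t,s,\xi)\|\le C$ and $\|\mathcal Q_k(t,s,\xi)^{-1}\|\le C$ for $t\ge s\ge t_\xi$. 5. For all multi-indices $\alpha$ with $|\alpha|\le k-1+\kappa_+-\kappa_-$, all $\xi\ne0$ with $|\xi|\neq N$ and all $t\ge t_\xi$, the function $\xi\mapsto\mathcal Q_k(t,t_\xi,\xi)$ is $|\alpha|$ times continuously differentiable at $\xi$ (within $\{\xi:(t,\xi)\in\mathcal Z_{\rm hyp}(N)\}$) and $$\|\mathrm D_\xi^\alpha\big(\mathcal Q_k(t,t_\xi,\xi)\big)\|\le C|\xi|^{-|\alpha|}.$$ -/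

import Mathlib

open scoped ContDiff Matrix.Norms.Operator

noncomputable section

/-- Frequency space `ℝⁿ` with the Euclidean norm. -/
abbrev Freq (n : ℕ) : Type := EuclideanSpace ℝ (Fin n)

/-- Time- and frequency-dependent complex `d × d` matrices. They are total functions, but only
their values on a hyperbolic zone are ever used. -/
abbrev MatField (n d : ℕ) : Type := ℝ → Freq n → Matrix (Fin d) (Fin d) ℂ

/-- The hyperbolic zone `{(t, ξ) : t ≥ 0, (1 + t)|ξ| ≥ N}`. -/
def hypZone (n : ℕ) (N : ℝ) : Set (ℝ × Freq n) :=
  {p | 0 ≤ p.1 ∧ N ≤ (1 + p.1) * ‖p.2‖}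

/-- The boundary time `t_ξ = max {N / |ξ| - 1, 0}` (used for `ξ ≠ 0` only). -/
def tBdry {n : ℕ} (N : ℝ) (ξ : Freq n) : ℝ := max (N / ‖ξ‖ - 1) 0

/-- The mixed partial derivative `∂_t^k ∂_{ξ_{α 0}} ⋯ ∂_{ξ_{α (l-1)}} a` on the (closed) zone; the
multi-index of order `l` is given by a list `α` of `l` coordinate directions. It differs from
`D_t^k D_ξ^α a`, `D = -i ∂`, by a factor of modulus one. -/
def zoneDeriv {n : ℕ} {V : Type*} [NormedAddCommGroup V] [NormedSpace ℝ V] (N : ℝ)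
    (a : ℝ → Freq n → V) (k l : ℕ) (α : Fin l → Fin n) (t : ℝ) (ξ : Freq n) : V :=
  iteratedFDerivWithin ℝ (k + l) (fun p : ℝ × Freq n => a p.1 p.2) (hypZone n N) (t, ξ)
    (Fin.append (fun _ : Fin k => ((1 : ℝ), (0 : Freq n)))
      (fun i : Fin l => ((0 : ℝ), EuclideanSpace.single (α i) (1 : ℝ))))

/-- `a` is a symbol of class `S{m₁, m₂}` with smoothness and estimates on the hyperbolic zone with
constant `N`; the class `S{m₁, m₂}` is the union of these sets over all `N > 0`. For
`V = Matrix (Fin d) (Fin d) ℂ` this is `S{m₁, m₂} ⊗ ℂ^{d × d}`. -/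
def IsSymbolOn {n : ℕ} {V : Type*} [NormedAddCommGroup V] [NormedSpace ℝ V] (N m₁ m₂ : ℝ)
    (a : ℝ → Freq n → V) : Prop :=
  ContDiffOn ℝ ∞ (fun p : ℝ × Freq n => a p.1 p.2) (hypZone n N) ∧
  ∀ (k l : ℕ) (α : Fin l → Fin n), ∃ C : ℝ, ∀ (t : ℝ) (ξ : Freq n), (t, ξ) ∈ hypZone n N →
    ‖zoneDeriv N a k l α t ξ‖ ≤ C * ‖ξ‖ ^ (m₁ - l) * (1 / (1 + t)) ^ (m₂ + k)

/-- `D_t f = -i ∂_t f`, with the derivative taken within `[t_ξ, ∞)`. -/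
def Dt {n d : ℕ} (N : ℝ) (f : MatField n d) : MatField n d := fun t ξ =>
  (-Complex.I) • derivWithin (fun τ => f τ ξ) (Set.Ici (tBdry N ξ)) t

/-- `diag(λ₁, …, λ_d)`. -/
def lamDiag {n d : ℕ} (lam : Fin d → ℝ → Freq n → ℝ) : MatField n d := fun t ξ =>
  Matrix.diagonal fun j => (lam j t ξ : ℂ)

/-- `R₀ = M⁻¹ (A - A_hom) M + (D_t M⁻¹) M`. -/
def remainderZero {n d : ℕ} (N : ℝ) (A Ahom M : MatField n d) : MatField n d := fun t ξ =>
  (M t ξ)⁻¹ * (A t ξ - Ahom t ξ) * M t ξ + Dt N (fun τ η => (M τ η)⁻¹) t ξ * M t ξ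

/-- Uniform strict hyperbolicity, with symbol estimates on the zone with constant `N`: `Ahom` is
the positively homogeneous principal symbol, with eigenvalues `lam j`, real and uniformly
separated. -/
structure UniformlyStrictlyHyperbolic {n d : ℕ} (N : ℝ) (A Ahom : MatField n d)
    (lam : Fin d → ℝ → Freq n → ℝ) : Prop where
  hom : ∀ t : ℝ, 0 ≤ t → ∀ ξ : Freq n, ξ ≠ 0 → ∀ ρ : ℝ, 0 < ρ →
    Ahom t (ρ • ξ) = (ρ : ℂ) • Ahom t ξ
  symb : IsSymbolOn N 1 0 Ahom
  symb_sub : IsSymbolOn N 0 1 (fun t ξ => A t ξ - Ahom t ξ)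
  eig : ∀ t : ℝ, 0 ≤ t → ∀ ξ : Freq n, ξ ≠ 0 →
    (Ahom t ξ).charpoly = ∏ j, (Polynomial.X - Polynomial.C (lam j t ξ : ℂ))
  gap : ∃ δ : ℝ, 0 < δ ∧ ∀ t : ℝ, 0 ≤ t → ∀ ξ : Freq n, ξ ≠ 0 → ∀ i j : Fin d, i ≠ j →
    δ * ‖ξ‖ ≤ |lam i t ξ - lam j t ξ|

/-- `M` is a diagonaliser of `Ahom`, and `F₀` (the vector of its diagonal entries) is a
hyperbolic subprincipal symbol, i.e. `F₀ = diag R₀ mod S{-1, 2}`, subject to the two-sided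
integral bound with the constants `κp` (lower) and `κm` (upper). -/
structure SubprincipalBounds {n d : ℕ} (N : ℝ) (A Ahom : MatField n d)
    (lam : Fin d → ℝ → Freq n → ℝ) (M : MatField n d) (F₀ : ℝ → Freq n → Fin d → ℂ)
    (κp κm : ℝ) : Prop where
  symb : IsSymbolOn N 0 0 M
  unit : ∀ t ξ, (t, ξ) ∈ hypZone n N → IsUnit (M t ξ)
  symb_inv : IsSymbolOn N 0 0 (fun t ξ => (M t ξ)⁻¹)
  diagonalises : ∀ t ξ, (t, ξ) ∈ hypZone n N →
    (M t ξ)⁻¹ * Ahom t ξ * M t ξ = lamDiag lam t ξ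
  subprincipal : IsSymbolOn N (-1) 2 (fun t ξ => F₀ t ξ - (remainderZero N A Ahom M t ξ).diag)
  bounds : ∃ Cp Cm : ℝ, ∀ ξ : Freq n, ξ ≠ 0 → ∀ s t : ℝ, tBdry N ξ ≤ s → s ≤ t → ∀ j : Fin d,
    κp * Real.log ((1 + t) / (1 + s)) + Cp ≤ (∫ τ in s..t, F₀ τ ξ j).im ∧
    (∫ τ in s..t, F₀ τ ξ j).im ≤ κm * Real.log ((1 + t) / (1 + s)) + Cm

/-- The outcome of `k` steps of the diagonalisation scheme on the zone with constant `N`: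
transformations `N_0 = I, N_1, …, N_k`, diagonal terms `F_0 = diag R₀, F_1, …, F_{k-1}` (given by
their diagonal entries) and remainders `R_1, …, R_k`. The field `intertwine` is the operator
identity `(D_t - 𝒟 - R₀) N_{j+1} = N_{j+1} (D_t - 𝒟 - F_j - R_{j+1})`, written out by the Leibniz
rule `D_t N_{j+1} = N_{j+1} D_t + (D_t N_{j+1})`. -/
structure IsDiagonalisation {n d : ℕ} (N : ℝ) (D R₀ : MatField n d) (k : ℕ)
    (Nd : ℕ → MatField n d) (F : ℕ → ℝ → Freq n → Fin d → ℂ) (R : ℕ → MatField n d) : Prop where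
  Nd_zero : ∀ t ξ, (t, ξ) ∈ hypZone n N → Nd 0 t ξ = 1
  F_zero : ∀ t ξ, (t, ξ) ∈ hypZone n N → F 0 t ξ = (R₀ t ξ).diag
  Nd_unit : ∀ j ≤ k, ∀ t ξ, (t, ξ) ∈ hypZone n N → IsUnit (Nd j t ξ)
  Nd_symb : ∀ j ≤ k, IsSymbolOn N 0 0 (Nd j)
  Nd_inv_symb : ∀ j ≤ k, IsSymbolOn N 0 0 (fun t ξ => (Nd j t ξ)⁻¹)
  Nd_sub : ∀ j < k, IsSymbolOn N (-((j : ℝ) + 1)) ((j : ℝ) + 1)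
    (fun t ξ => Nd (j + 1) t ξ - Nd j t ξ)
  F_symb : ∀ j < k, IsSymbolOn N 0 1 (F j)
  F_sub : ∀ j, j + 1 < k → IsSymbolOn N (-((j : ℝ) + 1)) ((j : ℝ) + 2)
    (fun t ξ => F (j + 1) t ξ - F j t ξ)
  R_symb : ∀ j < k, IsSymbolOn N (-((j : ℝ) + 1)) ((j : ℝ) + 2) (R (j + 1))
  intertwine : ∀ j < k, ∀ t ξ, (t, ξ) ∈ hypZone n N →
    Dt N (Nd (j + 1)) t ξ - (D t ξ + R₀ t ξ) * Nd (j + 1) t ξ =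
      -(Nd (j + 1) t ξ * (D t ξ + Matrix.diagonal (F j t ξ) + R (j + 1) t ξ))

/-- `E(t, s, ξ)` is the fundamental solution of `D_t E = A E`, `E(s, s, ξ) = I`, on the hyperbolic
zone, i.e. for `t, s ≥ t_ξ` and `ξ ≠ 0`. -/
structure IsFundamentalSolution {n d : ℕ} (N : ℝ) (A : MatField n d)
    (E : ℝ → ℝ → Freq n → Matrix (Fin d) (Fin d) ℂ) : Prop where
  init : ∀ ξ : Freq n, ξ ≠ 0 → ∀ s : ℝ, tBdry N ξ ≤ s → E s s ξ = 1
  deriv : ∀ ξ : Freq n, ξ ≠ 0 → ∀ s t : ℝ, tBdry N ξ ≤ s → tBdry N ξ ≤ t →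
    HasDerivWithinAt (fun τ => E τ s ξ) (Complex.I • (A t ξ * E t s ξ))
      (Set.Ici (tBdry N ξ)) t

/-- The diagonal matrix `exp(i ∫_s^t (𝒟 + F)(τ, ξ) dτ)`, `𝒟 = diag(λ₁, …, λ_d)`. -/
def diagExp {n d : ℕ} (lam : Fin d → ℝ → Freq n → ℝ) (F : ℝ → Freq n → Fin d → ℂ)
    (t s : ℝ) (ξ : Freq n) : Matrix (Fin d) (Fin d) ℂ :=
  Matrix.diagonal fun j =>
    Complex.exp (Complex.I * ∫ τ in s..t, ((lam j τ ξ : ℂ) + F τ ξ j))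

end

noncomputable section

section SymbolOrders

open Set

variable {n : ℕ} {V W X : Type*} [NormedAddCommGroup V] [NormedSpace ℝ V]
  [NormedAddCommGroup W] [NormedSpace ℝ W] [NormedAddCommGroup X] [NormedSpace ℝ X]

/-- The coordinate directions of `ℝ × Freq n`: `none` is time, `some j` is the `j`-th frequency. -/
def coordDir : Option (Fin n) → ℝ × Freq n
  | none => (1, 0)
  | some j => (0, EuclideanSpace.single j 1)

/-- The weight gained by a derivative in a coordinate direction. -/
def coordScale : Option (Fin n) → ℝ × Freq n → ℝ
  | none => fun p => 1 + p.1
  | some _ => fun p => ‖p.2‖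

/-- The partial derivative within `S` in a coordinate direction. -/
def coordDeriv (S : Set (ℝ × Freq n)) (i : Option (Fin n)) (g : ℝ × Freq n → V) :
    ℝ × Freq n → V :=
  fun p => fderivWithin ℝ g S p (coordDir i)

/-- Smoothness and symbol estimates with weight `w` for all derivatives of order at most `r`. -/
def SymOrd (S : Set (ℝ × Freq n)) :
    ℕ → (ℝ × Freq n → ℝ) → (ℝ × Freq n → V) → Prop
  | 0, w, g => ContDiffOn ℝ ∞ g S ∧ ∃ C : ℝ, 0 ≤ C ∧ ∀ p ∈ S, ‖g p‖ ≤ C * w p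
  | r + 1, w, g => (ContDiffOn ℝ ∞ g S ∧ ∃ C : ℝ, 0 ≤ C ∧ ∀ p ∈ S, ‖g p‖ ≤ C * w p) ∧
      ∀ i, SymOrd S r (fun p => w p / coordScale i p) (coordDeriv S i g)

/-- Domains in `t ≥ 0`, `ξ ≠ 0` on which derivatives are well behaved. -/
structure SymDomain (S : Set (ℝ × Freq n)) : Prop where
  uniq : UniqueDiffOn ℝ S
  closure : S ⊆ closure (interior S)
  time : ∀ p ∈ S, 0 ≤ p.1
  freq : ∀ p ∈ S, p.2 ≠ 0

variable {S : Set (ℝ × Freq n)}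

theorem SymDomain.scale_pos (hS : SymDomain S) {p : ℝ × Freq n} (hp : p ∈ S)
    (i : Option (Fin n)) : 0 < coordScale i p := by
  cases i with
  | none => have := hS.time p hp; simp only [coordScale]; linarith
  | some j => simpa [coordScale] using hS.freq p hp

theorem ContDiffOn.coordDeriv (hS : SymDomain S) {g : ℝ × Freq n → V}
    (hg : ContDiffOn ℝ ∞ g S) (i : Option (Fin n)) : ContDiffOn ℝ ∞ (coordDeriv S i g) S := by
  have := hg.fderivWithin (m := ∞) hS.uniq (by simp)
  exact this.clm_apply contDiffOn_const

theorem coordDeriv_congr {g h : ℝ × Freq n → V} (H : EqOn g h S) (i : Option (Fin n)) :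
    EqOn (coordDeriv S i g) (coordDeriv S i h) S := fun p hp => by
  simp only [coordDeriv]; rw [fderivWithin_congr H (H hp)]

theorem ContDiffOn.hasFDerivWithinAt_infty {g : ℝ × Freq n → V} (hg : ContDiffOn ℝ ∞ g S)
    {p : ℝ × Freq n} (hp : p ∈ S) : HasFDerivWithinAt g (fderivWithin ℝ g S p) S p :=
  ((hg.differentiableOn (by simp)) p hp).hasFDerivWithinAt

theorem coordDeriv_eq (hS : SymDomain S) {g : ℝ × Freq n → V} {p : ℝ × Freq n} (hp : p ∈ S)
    {g' : ℝ × Freq n →L[ℝ] V} (h : HasFDerivWithinAt g g' S p) (i : Option (Fin n)) :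
    coordDeriv S i g p = g' (coordDir i) := by
  simp only [coordDeriv]; rw [h.fderivWithin (hS.uniq p hp)]

theorem coordDeriv_comm (hS : SymDomain S) {g : ℝ × Freq n → V} (hg : ContDiffOn ℝ ∞ g S)
    (i j : Option (Fin n)) :
    EqOn (coordDeriv S i (coordDeriv S j g)) (coordDeriv S j (coordDeriv S i g)) S := by
  intro p hp
  have h1 : IsSymmSndFDerivWithinAt ℝ g S p :=
    (hg p hp).isSymmSndFDerivWithinAt (n := ∞) (by
      rw [minSmoothness_of_isRCLikeNormedField]; exact WithTop.coe_le_coe.2 le_top) hS.uniq (hS.closure hp) hp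
  have h2 := (hg.fderivWithin (m := ∞) hS.uniq (by simp))
  have key : ∀ k, HasFDerivWithinAt (coordDeriv S k g)
      ((fderivWithin ℝ (fderivWithin ℝ g S) S p).flip (coordDir k)) S p := fun k => by
    have := ((h2.differentiableOn (by simp)) p hp).hasFDerivWithinAt.clm_apply
      (hasFDerivWithinAt_const (coordDir k) p S)
    convert! this using 1
    ext <;> simp
  rw [coordDeriv_eq hS hp (key j), coordDeriv_eq hS hp (key i)]
  exact h1 _ _

namespace SymOrd

variable {r : ℕ} {w w' w₁ w₂ : ℝ × Freq n → ℝ} {g h : ℝ × Freq n → V}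

theorem contDiffOn (hg : SymOrd S r w g) : ContDiffOn ℝ ∞ g S := by
  cases r with
  | zero => exact hg.1
  | succ r => exact hg.1.1

theorem bound (hg : SymOrd S r w g) : ∃ C : ℝ, 0 ≤ C ∧ ∀ p ∈ S, ‖g p‖ ≤ C * w p := by
  cases r with
  | zero => exact hg.2
  | succ r => exact hg.1.2

theorem deriv (hg : SymOrd S (r + 1) w g) (i : Option (Fin n)) :
    SymOrd S r (fun p => w p / coordScale i p) (coordDeriv S i g) := hg.2 i

theorem congr (hg : SymOrd S r w g) (H : EqOn h g S) : SymOrd S r w h := by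
  induction r generalizing w g h with
  | zero =>
    obtain ⟨h1, C, hC, h2⟩ := hg
    exact ⟨h1.congr H, C, hC, fun p hp => by rw [H hp]; exact h2 p hp⟩
  | succ r ih =>
    obtain ⟨⟨h1, C, hC, h2⟩, h3⟩ := hg
    exact ⟨⟨h1.congr H, C, hC, fun p hp => by rw [H hp]; exact h2 p hp⟩,
      fun i => ih (h3 i) (coordDeriv_congr H i)⟩

theorem mono_weight (hS : SymDomain S) (hg : SymOrd S r w g) {c : ℝ} (hc : 0 ≤ c)
    (H : ∀ p ∈ S, w p ≤ c * w' p) : SymOrd S r w' g := by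
  have base : ∀ {w w' : ℝ × Freq n → ℝ} {g : ℝ × Freq n → V}, (∀ p ∈ S, w p ≤ c * w' p) →
      (∃ C : ℝ, 0 ≤ C ∧ ∀ p ∈ S, ‖g p‖ ≤ C * w p) →
      (∃ C : ℝ, 0 ≤ C ∧ ∀ p ∈ S, ‖g p‖ ≤ C * w' p) := by
    rintro w w' g H ⟨C, hC, h⟩
    refine ⟨C * c, by positivity, fun p hp => (h p hp).trans ?_⟩
    rw [mul_assoc]
    exact mul_le_mul_of_nonneg_left (H p hp) hC
  induction r generalizing w w' g with
  | zero => exact ⟨hg.1, base H hg.2⟩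
  | succ r ih =>
    refine ⟨⟨hg.1.1, base H hg.1.2⟩, fun i => ih (hg.2 i) fun p hp => ?_⟩
    rw [← mul_div_assoc]
    have := hS.scale_pos hp i
    gcongr
    exact H p hp

theorem weight_congr (hS : SymDomain S) (hg : SymOrd S r w g) (H : ∀ p ∈ S, w p = w' p) :
    SymOrd S r w' g :=
  hg.mono_weight hS zero_le_one fun p hp => by rw [H p hp, one_mul]

theorem mono_order (hg : SymOrd S r w g) {r' : ℕ} (hr : r' ≤ r) : SymOrd S r' w g := by
  induction r generalizing w g r' with
  | zero => obtain rfl : r' = 0 := by omega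
            exact hg
  | succ r ih =>
    cases r' with
    | zero => exact hg.1
    | succ r' => exact ⟨hg.1, fun i => ih (hg.2 i) (by omega)⟩

theorem add (hS : SymDomain S) (hg : SymOrd S r w g) (hh : SymOrd S r w h) :
    SymOrd S r w (fun p => g p + h p) := by
  have base : ∀ {w : ℝ × Freq n → ℝ} {g h : ℝ × Freq n → V},
      (∃ C : ℝ, 0 ≤ C ∧ ∀ p ∈ S, ‖g p‖ ≤ C * w p) →
      (∃ C : ℝ, 0 ≤ C ∧ ∀ p ∈ S, ‖h p‖ ≤ C * w p) →
      (∃ C : ℝ, 0 ≤ C ∧ ∀ p ∈ S, ‖g p + h p‖ ≤ C * w p) := by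
    rintro w g h ⟨C, hC, h⟩ ⟨C', hC', h'⟩
    refine ⟨C + C', by positivity, fun p hp => (norm_add_le _ _).trans ?_⟩
    rw [add_mul]
    exact add_le_add (h p hp) (h' p hp)
  induction r generalizing w g h with
  | zero => exact ⟨hg.1.add hh.1, base hg.2 hh.2⟩
  | succ r ih =>
    refine ⟨⟨hg.1.1.add hh.1.1, base hg.1.2 hh.1.2⟩, fun i => (ih (hg.2 i) (hh.2 i)).congr ?_⟩
    intro p hp
    exact coordDeriv_eq hS hp ((hg.1.1.hasFDerivWithinAt_infty hp).add
      (hh.1.1.hasFDerivWithinAt_infty hp)) i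

theorem clm (hS : SymDomain S) (hg : SymOrd S r w g) (L : V →L[ℝ] W) :
    SymOrd S r w (fun p => L (g p)) := by
  have base : ∀ {w : ℝ × Freq n → ℝ} {g : ℝ × Freq n → V},
      (∃ C : ℝ, 0 ≤ C ∧ ∀ p ∈ S, ‖g p‖ ≤ C * w p) →
      (∃ C : ℝ, 0 ≤ C ∧ ∀ p ∈ S, ‖L (g p)‖ ≤ C * w p) := by
    rintro w g ⟨C, hC, h⟩
    refine ⟨‖L‖ * C, by positivity, fun p hp => (L.le_opNorm _).trans ?_⟩
    rw [mul_assoc]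
    exact mul_le_mul_of_nonneg_left (h p hp) (norm_nonneg _)
  induction r generalizing w g with
  | zero => exact ⟨L.contDiff.comp_contDiffOn hg.1, base hg.2⟩
  | succ r ih =>
    refine ⟨⟨L.contDiff.comp_contDiffOn hg.1.1, base hg.1.2⟩, fun i => (ih (hg.2 i)).congr ?_⟩
    intro p hp
    exact coordDeriv_eq hS hp
      (L.hasFDerivAt.comp_hasFDerivWithinAt p (hg.1.1.hasFDerivWithinAt_infty hp)) i

theorem bilin (hS : SymDomain S) (B : V →L[ℝ] W →L[ℝ] X) {k : ℝ × Freq n → W}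
    (hg : SymOrd S r w₁ g) (hk : SymOrd S r w₂ k) :
    SymOrd S r (fun p => w₁ p * w₂ p) (fun p => B (g p) (k p)) := by
  have base : ∀ {w₁ w₂ : ℝ × Freq n → ℝ} {g : ℝ × Freq n → V} {k : ℝ × Freq n → W},
      (∃ C : ℝ, 0 ≤ C ∧ ∀ p ∈ S, ‖g p‖ ≤ C * w₁ p) →
      (∃ C : ℝ, 0 ≤ C ∧ ∀ p ∈ S, ‖k p‖ ≤ C * w₂ p) →
      (∃ C : ℝ, 0 ≤ C ∧ ∀ p ∈ S, ‖B (g p) (k p)‖ ≤ C * (w₁ p * w₂ p)) := by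
    rintro w₁ w₂ g k ⟨C, hC, h⟩ ⟨C', hC', h'⟩
    refine ⟨‖B‖ * (C * C'), by positivity, fun p hp => (B.le_opNorm₂ _ _).trans ?_⟩
    calc ‖B‖ * ‖g p‖ * ‖k p‖ = ‖B‖ * (‖g p‖ * ‖k p‖) := by ring
      _ ≤ ‖B‖ * ((C * w₁ p) * (C' * w₂ p)) := by
        have := mul_le_mul (h p hp) (h' p hp) (norm_nonneg _) ((norm_nonneg _).trans (h p hp))
        exact mul_le_mul_of_nonneg_left this (norm_nonneg B)
      _ = _ := by ring
  have smooth : ∀ {g : ℝ × Freq n → V} {k : ℝ × Freq n → W}, ContDiffOn ℝ ∞ g S →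
      ContDiffOn ℝ ∞ k S → ContDiffOn ℝ ∞ (fun p => B (g p) (k p)) S := fun h1 h2 =>
    (B.contDiff.comp_contDiffOn h1).clm_apply h2
  induction r generalizing w₁ w₂ g k with
  | zero => exact ⟨smooth hg.1 hk.1, base hg.2 hk.2⟩
  | succ r ih =>
    refine ⟨⟨smooth hg.1.1 hk.1.1, base hg.1.2 hk.1.2⟩, fun i => ?_⟩
    have e1 := (ih (hg.mono_order (Nat.le_succ r)) (hk.2 i)).weight_congr hS
      (w' := fun p => w₁ p * w₂ p / coordScale i p) fun p hp => by ring
    have e2 := (ih (hg.2 i) (hk.mono_order (Nat.le_succ r))).weight_congr hS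
      (w' := fun p => w₁ p * w₂ p / coordScale i p) fun p hp => by ring
    refine (e1.add hS e2).congr fun p hp => ?_
    exact coordDeriv_eq hS hp (B.hasFDerivWithinAt_of_bilinear
      (hg.1.1.hasFDerivWithinAt_infty hp) (hk.1.1.hasFDerivWithinAt_infty hp)) i

theorem neg (hS : SymDomain S) (hg : SymOrd S r w g) : SymOrd S r w (fun p => -g p) :=
  hg.clm hS (-(ContinuousLinearMap.id ℝ V))

theorem sub (hS : SymDomain S) (hg : SymOrd S r w g) (hh : SymOrd S r w h) :
    SymOrd S r w (fun p => g p - h p) := by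
  simpa only [sub_eq_add_neg] using hg.add hS (hh.neg hS)

theorem const_zero : SymOrd S r w (fun _ => (0 : V)) := by
  have hd : ∀ i, coordDeriv S i (fun _ => (0 : V)) = fun _ => 0 := fun i => by
    funext p; simp [coordDeriv]
  have base : ∀ w : ℝ × Freq n → ℝ, ContDiffOn ℝ ∞ (fun _ : ℝ × Freq n => (0 : V)) S ∧
      ∃ C : ℝ, 0 ≤ C ∧ ∀ p ∈ S, ‖(0 : V)‖ ≤ C * w p :=
    fun w => ⟨contDiffOn_const, 0, le_rfl, fun p hp => by simp⟩
  induction r generalizing w with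
  | zero => exact base _
  | succ r ih => exact ⟨base _, fun i => by rw [hd]; exact ih⟩

theorem const (c : V) : SymOrd S r (fun _ => 1) (fun _ => c) := by
  have hd : ∀ i, coordDeriv S i (fun _ => c) = fun _ => 0 := fun i => by
    funext p; simp [coordDeriv]
  have base : ContDiffOn ℝ ∞ (fun _ : ℝ × Freq n => c) S ∧
      ∃ C : ℝ, 0 ≤ C ∧ ∀ p ∈ S, ‖c‖ ≤ C * (fun _ : ℝ × Freq n => (1 : ℝ)) p :=
    ⟨contDiffOn_const, ‖c‖, norm_nonneg _, fun p hp => by simp⟩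
  cases r with
  | zero => exact base
  | succ r => exact ⟨base, fun i => by rw [hd]; exact const_zero⟩

theorem subset {T : Set (ℝ × Freq n)} (hT : SymDomain T) (h : T ⊆ S)
    (hg : SymOrd S r w g) : SymOrd T r w g := by
  induction r generalizing w g with
  | zero =>
    obtain ⟨h1, C, hC, h2⟩ := hg
    exact ⟨h1.mono h, C, hC, fun p hp => h2 p (h hp)⟩
  | succ r ih =>
    obtain ⟨⟨h1, C, hC, h2⟩, h3⟩ := hg
    refine ⟨⟨h1.mono h, C, hC, fun p hp => h2 p (h hp)⟩, fun i => (ih (h3 i)).congr ?_⟩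
    intro p hp
    exact coordDeriv_eq hT hp ((h1.hasFDerivWithinAt_infty (h hp)).mono h) i

theorem sum (hS : SymDomain S) {ι : Type*} (s : Finset ι) {G : ι → ℝ × Freq n → V}
    (hG : ∀ a ∈ s, SymOrd S r w (G a)) : SymOrd S r w (fun p => ∑ a ∈ s, G a p) := by
  classical
  induction s using Finset.induction_on with
  | empty => simpa using const_zero
  | insert a s ha ih =>
    simp only [Finset.sum_insert ha]
    exact (hG a (by simp)).add hS (ih fun b hb => hG b (by simp [hb]))

variable {𝔸 : Type*} [NormedRing 𝔸] [NormedAlgebra ℝ 𝔸] 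

theorem mul (hS : SymDomain S) {a b : ℝ × Freq n → 𝔸} (ha : SymOrd S r w₁ a)
    (hb : SymOrd S r w₂ b) : SymOrd S r (fun p => w₁ p * w₂ p) (fun p => a p * b p) :=
  bilin hS (ContinuousLinearMap.mul ℝ 𝔸) ha hb

theorem ringInverse [CompleteSpace 𝔸] (hS : SymDomain S) {a : ℝ × Freq n → 𝔸} (ha : SymOrd S r w a)
    (hw : ∀ p ∈ S, 0 < w p) (hu : ∀ p ∈ S, IsUnit (a p)) {C : ℝ} (hC : 0 ≤ C)
    (hb : ∀ p ∈ S, ‖Ring.inverse (a p)‖ ≤ C / w p) :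
    SymOrd S r (fun p => 1 / w p) (fun p => Ring.inverse (a p)) := by
  have hb' : ∀ p ∈ S, ‖Ring.inverse (a p)‖ ≤ C * (1 / w p) := fun p hp => by
    rw [mul_one_div]; exact hb p hp
  have smooth : ContDiffOn ℝ ∞ (fun p => Ring.inverse (a p)) S := fun p hp => by
    obtain ⟨u, hu⟩ := hu p hp
    have h1 := contDiffAt_ringInverse ℝ (n := ∞) u
    rw [hu] at h1
    exact h1.comp_contDiffWithinAt p (ha.contDiffOn p hp)
  induction r with
  | zero => exact ⟨smooth, C, hC, hb'⟩
  | succ r ih =>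
    refine ⟨⟨smooth, C, hC, hb'⟩, fun i => ?_⟩
    have h0 := ih (ha.mono_order (Nat.le_succ r))
    have h1 := ((h0.mul hS (ha.2 i)).mul hS h0).neg hS
    refine (h1.weight_congr hS (w' := fun p => 1 / w p / coordScale i p) fun p hp => ?_).congr ?_
    · have := hw p hp
      have := hS.scale_pos hp i
      field_simp
    · intro p hp
      obtain ⟨u, hu⟩ := hu p hp
      have h1 := hasFDerivAt_ringInverse (𝕜 := ℝ) u
      rw [hu] at h1
      refine (coordDeriv_eq hS hp
        (h1.comp_hasFDerivWithinAt p (ha.contDiffOn.hasFDerivWithinAt_infty hp)) i).trans ?_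
      simp [coordDeriv, ← hu]

end SymOrd
end SymbolOrders
end

noncomputable section

section Zone

open Set

variable {n : ℕ}

theorem uniqueDiffOn_of_convex_pieces {E : Type*} [NormedAddCommGroup E] [NormedSpace ℝ E]
    {S : Set E} (h : ∀ p ∈ S, ∃ K ⊆ S, Convex ℝ K ∧ p ∈ K ∧ (interior K).Nonempty) :
    UniqueDiffOn ℝ S ∧ S ⊆ closure (interior S) := by
  constructor <;> intro p hp <;> obtain ⟨K, hKS, hK, hpK, hne⟩ := h p hp
  · exact (uniqueDiffWithinAt_convex hK hne (subset_closure hpK)).mono hKS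
  · apply closure_mono (interior_mono hKS)
    rw [hK.closure_interior_eq_closure_of_nonempty_interior hne]
    exact subset_closure hpK

theorem convex_le_inner (ξ : Freq n) (c : ℝ) : Convex ℝ {η : Freq n | c ≤ inner ℝ ξ η} :=
  convex_halfSpace_ge (innerSL ℝ ξ).toLinearMap.isLinear c

theorem le_norm_of_le_inner {ξ η : Freq n} (h : ‖ξ‖ ^ 2 ≤ inner ℝ ξ η) : ‖ξ‖ ≤ ‖η‖ := by
  by_cases hξ : ‖ξ‖ = 0
  · rw [hξ]; exact norm_nonneg _
  have h0 : 0 < ‖ξ‖ := lt_of_le_of_ne (norm_nonneg _) (Ne.symm hξ)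
  have := h.trans (real_inner_le_norm ξ η)
  nlinarith

theorem hypZone_freq_ne {N : ℝ} (hN : 0 < N) {p : ℝ × Freq n} (hp : p ∈ hypZone n N) :
    p.2 ≠ 0 := by
  intro h
  have := hp.2
  rw [h, norm_zero, mul_zero] at this
  linarith

theorem hypZone_symDomain {N : ℝ} (hN : 0 < N) : SymDomain (hypZone n N) := by
  have key := uniqueDiffOn_of_convex_pieces (S := hypZone n N) (fun p hp => by
    have hp1 := hp.1
    have hξ : 0 < ‖p.2‖ := norm_pos_iff.2 (hypZone_freq_ne hN hp)
    refine ⟨Ici p.1 ×ˢ {η | ‖p.2‖ ^ 2 ≤ inner ℝ p.2 η}, ?_, (convex_Ici _).prod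
      (convex_le_inner _ _), ⟨mem_Ici.2 le_rfl, by simp⟩, ?_⟩
    · rintro q ⟨h1, h2⟩
      have h3 := le_norm_of_le_inner h2
      simp only [mem_Ici] at h1
      refine ⟨hp1.trans h1, hp.2.trans ?_⟩
      gcongr
      linarith
    · refine ⟨(p.1 + 1, (2 : ℝ) • p.2), ?_⟩
      have ho : IsOpen (Ioi p.1 ×ˢ {η : Freq n | ‖p.2‖ ^ 2 < inner ℝ p.2 η}) :=
        isOpen_Ioi.prod (isOpen_lt continuous_const (by fun_prop))
      have hsub : {η : Freq n | ‖p.2‖ ^ 2 < inner ℝ p.2 η} ⊆ {η | ‖p.2‖ ^ 2 ≤ inner ℝ p.2 η} := by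
        intro η h
        simp only [mem_ofPred_eq] at h ⊢
        exact h.le
      refine interior_maximal (prod_mono Ioi_subset_Ici_self hsub) ho ⟨?_, ?_⟩
      · simp
      · simp only [mem_ofPred_eq, inner_smul_right, real_inner_self_eq_norm_sq]
        nlinarith)
  exact ⟨key.1, key.2, fun p hp => hp.1, fun p hp => hypZone_freq_ne hN hp⟩

theorem hypZone_subset {N N' : ℝ} (h : N ≤ N') : hypZone n N' ⊆ hypZone n N :=
  fun _ hp => ⟨hp.1, h.trans hp.2⟩

theorem mem_hypZone_iff {N t : ℝ} {ξ : Freq n} (hξ : ξ ≠ 0) :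
    (t, ξ) ∈ hypZone n N ↔ tBdry N ξ ≤ t := by
  have h0 : 0 < ‖ξ‖ := norm_pos_iff.2 hξ
  simp only [hypZone, tBdry, mem_ofPred_eq, max_le_iff, sub_le_iff_le_add, div_le_iff₀ h0]
  rw [and_comm, add_comm]

theorem tBdry_nonneg {N : ℝ} {ξ : Freq n} : 0 ≤ tBdry N ξ := le_max_right _ _

theorem tBdry_mono {N N' : ℝ} (h : N ≤ N') (ξ : Freq n) : tBdry N ξ ≤ tBdry N' ξ := by
  unfold tBdry; gcongr

/-- The weight `|ξ|^m₁ (1 + t)^(-m₂)`. -/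
def symWeight (n : ℕ) (m₁ m₂ : ℝ) : ℝ × Freq n → ℝ :=
  fun p => ‖p.2‖ ^ m₁ * (1 / (1 + p.1)) ^ m₂

theorem symWeight_pos {S : Set (ℝ × Freq n)} (hS : SymDomain S) {p : ℝ × Freq n} (hp : p ∈ S)
    (m₁ m₂ : ℝ) : 0 < symWeight n m₁ m₂ p := by
  have h1 := hS.time p hp
  have h2 : 0 < ‖p.2‖ := norm_pos_iff.2 (hS.freq p hp)
  unfold symWeight
  positivity

theorem symWeight_mul {S : Set (ℝ × Freq n)} (hS : SymDomain S) {p : ℝ × Freq n} (hp : p ∈ S)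
    (m₁ m₂ k₁ k₂ : ℝ) :
    symWeight n m₁ m₂ p * symWeight n k₁ k₂ p = symWeight n (m₁ + k₁) (m₂ + k₂) p := by
  have h1 := hS.time p hp
  have h2 : 0 < ‖p.2‖ := norm_pos_iff.2 (hS.freq p hp)
  have h3 : 0 < 1 / (1 + p.1) := by positivity
  simp only [symWeight, Real.rpow_add h2, Real.rpow_add h3]
  ring

theorem symWeight_time {S : Set (ℝ × Freq n)} (hS : SymDomain S) {p : ℝ × Freq n} (hp : p ∈ S)
    (m₁ m₂ : ℝ) : symWeight n m₁ m₂ p / coordScale none p = symWeight n m₁ (m₂ + 1) p := by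
  have h1 := hS.time p hp
  have h3 : 0 < 1 / (1 + p.1) := by positivity
  simp only [symWeight, coordScale, Real.rpow_add h3, Real.rpow_one]
  ring

theorem symWeight_freq {S : Set (ℝ × Freq n)} (hS : SymDomain S) {p : ℝ × Freq n} (hp : p ∈ S)
    (m₁ m₂ : ℝ) (j : Fin n) :
    symWeight n m₁ m₂ p / coordScale (some j) p = symWeight n (m₁ - 1) m₂ p := by
  have h2 : 0 < ‖p.2‖ := norm_pos_iff.2 (hS.freq p hp)
  simp only [symWeight, coordScale, Real.rpow_sub h2, Real.rpow_one]
  ring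

variable {V : Type*} [NormedAddCommGroup V] [NormedSpace ℝ V]

theorem iteratedFDerivWithin_fderivWithin_apply {E : Type*} [NormedAddCommGroup E]
    [NormedSpace ℝ E] {S : Set E} (hS : UniqueDiffOn ℝ S) {g : E → V} {r : ℕ}
    (hg : ContDiffOn ℝ (r + 1 : ℕ) g S) {p : E} (hp : p ∈ S) (v : E) (m : Fin r → E) :
    iteratedFDerivWithin ℝ r (fun q => fderivWithin ℝ g S q v) S p m =
      iteratedFDerivWithin ℝ (r + 1) g S p (Fin.snoc m v : Fin (r + 1) → E) := by
  rw [iteratedFDerivWithin_succ_apply_right hS hp, Fin.init_snoc, Fin.snoc_last]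
  have h1 : ContDiffWithinAt ℝ r (fderivWithin ℝ g S) S p :=
    hg.fderivWithin (m := r) hS (by norm_cast) p hp
  exact congrArg (fun M => M m) ((ContinuousLinearMap.apply ℝ V v).iteratedFDerivWithin_comp_left
    h1 hS hp le_rfl)

theorem zoneDeriv_freq {N : ℝ} (hN : 0 < N) {g : ℝ × Freq n → V}
    (hg : ContDiffOn ℝ ∞ g (hypZone n N)) (k l : ℕ) (α : Fin l → Fin n) (j : Fin n)
    {p : ℝ × Freq n} (hp : p ∈ hypZone n N) :
    zoneDeriv N (fun t ξ => coordDeriv (hypZone n N) (some j) g (t, ξ)) k l α p.1 p.2 =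
      zoneDeriv N (fun t ξ => g (t, ξ)) k (l + 1) (Fin.snoc α j : Fin (l + 1) → Fin n) p.1 p.2 := by
  have := iteratedFDerivWithin_fderivWithin_apply (r := k + l) (hypZone_symDomain hN).uniq
    (hg.of_le (by exact_mod_cast le_top)) hp (coordDir (some j))
    (Fin.append (fun _ : Fin k => ((1 : ℝ), (0 : Freq n)))
      (fun i : Fin l => ((0 : ℝ), EuclideanSpace.single (α i) (1 : ℝ))))
  refine this.trans ?_
  rw [← Fin.append_snoc]
  have e : (Fin.snoc (fun i : Fin l => ((0 : ℝ), EuclideanSpace.single (α i) (1 : ℝ)))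
      (coordDir (some j)) : Fin (l + 1) → ℝ × Freq n) =
      fun i => (0, EuclideanSpace.single ((Fin.snoc α j : Fin (l + 1) → Fin n) i) 1) := by
    funext i
    refine Fin.lastCases ?_ (fun i => ?_) i <;> simp [coordDir]
  rw [e]
  rfl

theorem zoneDeriv_congr {N : ℝ} {g h : ℝ → Freq n → V}
    (H : ∀ p ∈ hypZone n N, g p.1 p.2 = h p.1 p.2) (k l : ℕ) (α : Fin l → Fin n)
    {p : ℝ × Freq n} (hp : p ∈ hypZone n N) :
    zoneDeriv N g k l α p.1 p.2 = zoneDeriv N h k l α p.1 p.2 := by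
  unfold zoneDeriv
  rw [iteratedFDerivWithin_congr (f := fun p : ℝ × Freq n => h p.1 p.2) H hp]

theorem zoneDeriv_time {N : ℝ} (hN : 0 < N) {g : ℝ × Freq n → V}
    (hg : ContDiffOn ℝ ∞ g (hypZone n N)) (k l : ℕ) (α : Fin l → Fin n)
    {p : ℝ × Freq n} (hp : p ∈ hypZone n N) :
    zoneDeriv N (fun t ξ => coordDeriv (hypZone n N) none g (t, ξ)) k l α p.1 p.2 =
      zoneDeriv N (fun t ξ => g (t, ξ)) (k + 1) l α p.1 p.2 := by
  have hS := hypZone_symDomain (n := n) hN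
  induction l generalizing g with
  | zero =>
    have := iteratedFDerivWithin_fderivWithin_apply (r := k) hS.uniq
      (hg.of_le (by exact_mod_cast le_top)) hp (coordDir none) fun _ => ((1 : ℝ), (0 : Freq n))
    unfold zoneDeriv
    have e : ∀ k : ℕ, Fin.append (fun _ : Fin k => ((1 : ℝ), (0 : Freq n)))
        (fun i : Fin 0 => ((0 : ℝ), EuclideanSpace.single (α i) (1 : ℝ))) =
        fun _ : Fin k => ((1 : ℝ), (0 : Freq n)) := fun k => by
      funext i
      refine Fin.addCases (fun i => ?_) (fun i => i.elim0) i
      exact Fin.append_left (m := k) (n := 0) _ _ i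
    rw [e, e]
    refine this.trans ?_
    congr 1
    funext i
    refine Fin.lastCases ?_ (fun i => ?_) i <;> simp [coordDir]
  | succ l ih =>
    obtain ⟨β, j, rfl⟩ : ∃ (β : Fin l → Fin n) (j : Fin n), (Fin.snoc β j : Fin (l + 1) → Fin n) = α :=
      ⟨Fin.init α, α (Fin.last l), Fin.snoc_init_self α⟩
    rw [← zoneDeriv_freq hN (hg.coordDeriv hS none) k l β j hp,
      ← zoneDeriv_freq hN hg (k + 1) l β j hp, ← ih (hg.coordDeriv hS (some j))]
    exact zoneDeriv_congr (fun q hq => coordDeriv_comm hS hg _ _ hq) k l β hp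

theorem IsSymbolOn.coordDeriv_none {N : ℝ} (hN : 0 < N) {m₁ m₂ : ℝ} {g : ℝ × Freq n → V}
    (hg : IsSymbolOn N m₁ m₂ fun t ξ => g (t, ξ)) :
    IsSymbolOn N m₁ (m₂ + 1) fun t ξ => coordDeriv (hypZone n N) none g (t, ξ) := by
  have hS := hypZone_symDomain (n := n) hN
  have hg1 : ContDiffOn ℝ ∞ g (hypZone n N) := hg.1
  refine ⟨hg1.coordDeriv hS none, fun k l α => ?_⟩
  obtain ⟨C, hC⟩ := hg.2 (k + 1) l α
  refine ⟨C, fun t ξ h => ?_⟩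
  rw [zoneDeriv_time hN hg1 k l α h]
  convert! hC t ξ h using 3
  push_cast; ring

theorem IsSymbolOn.coordDeriv_some {N : ℝ} (hN : 0 < N) {m₁ m₂ : ℝ} {g : ℝ × Freq n → V}
    (hg : IsSymbolOn N m₁ m₂ fun t ξ => g (t, ξ)) (j : Fin n) :
    IsSymbolOn N (m₁ - 1) m₂ fun t ξ => coordDeriv (hypZone n N) (some j) g (t, ξ) := by
  have hS := hypZone_symDomain (n := n) hN
  have hg1 : ContDiffOn ℝ ∞ g (hypZone n N) := hg.1
  refine ⟨hg1.coordDeriv hS _, fun k l α => ?_⟩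
  obtain ⟨C, hC⟩ := hg.2 k (l + 1) (Fin.snoc α j : Fin (l + 1) → Fin n)
  refine ⟨C, fun t ξ h => ?_⟩
  rw [zoneDeriv_freq hN hg1 k l α j h]
  convert! hC t ξ h using 4
  push_cast; ring

theorem IsSymbolOn.symOrd {N : ℝ} (hN : 0 < N) {m₁ m₂ : ℝ} {g : ℝ × Freq n → V}
    (hg : IsSymbolOn N m₁ m₂ fun t ξ => g (t, ξ)) (r : ℕ) :
    SymOrd (hypZone n N) r (symWeight n m₁ m₂) g := by
  have hS := hypZone_symDomain (n := n) hN
  have base : ∀ {m₁ m₂ : ℝ} {g : ℝ × Freq n → V}, (IsSymbolOn N m₁ m₂ fun t ξ => g (t, ξ)) →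
      ContDiffOn ℝ ∞ g (hypZone n N) ∧
      ∃ C : ℝ, 0 ≤ C ∧ ∀ p ∈ hypZone n N, ‖g p‖ ≤ C * symWeight n m₁ m₂ p := by
    intro m₁ m₂ g hg
    obtain ⟨C, hC⟩ := hg.2 0 0 Fin.elim0
    refine ⟨hg.1, max C 0, le_max_right _ _, fun p hp => ?_⟩
    have h1 := hC p.1 p.2 hp
    simp only [zoneDeriv, Nat.add_zero, iteratedFDerivWithin_zero_apply, Nat.cast_zero, sub_zero,
      add_zero] at h1
    rw [mul_assoc] at h1
    exact h1.trans (mul_le_mul_of_nonneg_right (le_max_left _ _) (symWeight_pos hS hp _ _).le)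
  induction r generalizing m₁ m₂ g with
  | zero => exact base hg
  | succ r ih =>
    refine ⟨base hg, fun i => ?_⟩
    cases i with
    | none =>
      exact (ih (hg.coordDeriv_none hN)).weight_congr hS
        (fun p hp => (symWeight_time hS hp _ _).symm)
    | some j =>
      exact (ih (hg.coordDeriv_some hN j)).weight_congr hS
        (fun p hp => (symWeight_freq hS hp _ _ j).symm)

theorem isSymbolOn_of_symOrd {N : ℝ} (hN : 0 < N) {m₁ m₂ : ℝ} {g : ℝ × Freq n → V}
    (hg : ∀ r, SymOrd (hypZone n N) r (symWeight n m₁ m₂) g) :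
    IsSymbolOn N m₁ m₂ fun t ξ => g (t, ξ) := by
  have hS := hypZone_symDomain (n := n) hN
  refine ⟨(hg 0).contDiffOn, fun k l => ?_⟩
  induction l generalizing m₁ m₂ g with
  | zero =>
    induction k generalizing m₁ m₂ g with
    | zero =>
      intro α
      obtain ⟨C, -, hC⟩ := (hg 0).bound
      refine ⟨C, fun t ξ h => ?_⟩
      simpa [zoneDeriv, symWeight, mul_assoc] using hC (t, ξ) h
    | succ k ih =>
      intro α
      obtain ⟨C, hC⟩ := ih (g := coordDeriv (hypZone n N) none g) (m₁ := m₁) (m₂ := m₂ + 1)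
        (fun r => ((hg (r + 1)).deriv none).weight_congr hS
          fun p hp => symWeight_time hS hp _ _) α
      refine ⟨C, fun t ξ h => ?_⟩
      rw [← zoneDeriv_time hN (hg 0).contDiffOn k 0 α h]
      convert! hC t ξ h using 3
      push_cast; ring
  | succ l ih =>
    intro α
    obtain ⟨β, j, rfl⟩ : ∃ (β : Fin l → Fin n) (j : Fin n), (Fin.snoc β j : Fin (l + 1) → Fin n) = α :=
      ⟨Fin.init α, α (Fin.last l), Fin.snoc_init_self α⟩
    obtain ⟨C, hC⟩ := ih (g := coordDeriv (hypZone n N) (some j) g) (m₁ := m₁ - 1) (m₂ := m₂)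
      (fun r => ((hg (r + 1)).deriv (some j)).weight_congr hS
        fun p hp => symWeight_freq hS hp _ _ j) β
    refine ⟨C, fun t ξ h => ?_⟩
    rw [← zoneDeriv_freq hN (hg 0).contDiffOn k l β j h]
    convert! hC t ξ h using 4
    push_cast; ring

end Zone
end

noncomputable section

section LinearODE

open Set Filter Topology MeasureTheory

variable {F : Type*} [NormedAddCommGroup F] [NormedSpace ℝ F]

/-- Grönwall's inequality with variable coefficients given by their primitives `G` and `Φ`. -/
theorem norm_le_of_norm_deriv_le_mul_add {y y' : ℝ → F} {a T : ℝ} (haT : a ≤ T)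
    {β φ G Φ : ℝ → ℝ} (hy : ∀ t ∈ Icc a T, HasDerivWithinAt y (y' t) (Ici a) t)
    (hb : ∀ t ∈ Icc a T, ‖y' t‖ ≤ β t * ‖y t‖ + φ t)
    (hG : ∀ t ∈ Icc a T, HasDerivWithinAt G (β t) (Ici a) t)
    (hΦ : ∀ t ∈ Icc a T, HasDerivWithinAt Φ (φ t) (Ici a) t)
    (hGa : G a = 0) (hΦa : Φ a = 0) (hG0 : ∀ t ∈ Icc a T, 0 ≤ G t)
    (hφ : ∀ t ∈ Icc a T, 0 ≤ φ t) :
    ‖y T‖ ≤ (‖y a‖ + Φ T) * Real.exp (G T) := by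
  have hsub : Icc a T ⊆ Ici a := Icc_subset_Ici_self
  have key : ∀ ε : ℝ, 0 < ε →
      ‖y T‖ ≤ (‖y a‖ + ε + Φ T + ε * (T - a)) * Real.exp (G T) := by
    intro ε hε
    have hB : ∀ t ∈ Icc a T, HasDerivWithinAt
        (fun t => (‖y a‖ + ε + Φ t + ε * (t - a)) * Real.exp (G t))
        ((φ t + ε) * Real.exp (G t) +
          (‖y a‖ + ε + Φ t + ε * (t - a)) * (Real.exp (G t) * β t)) (Ici a) t := by
      intro t ht
      have h1 : HasDerivWithinAt (fun t => ‖y a‖ + ε + Φ t + ε * (t - a)) (φ t + ε) (Ici a) t := by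
        have := ((hΦ t ht).const_add (‖y a‖ + ε)).add
          (((hasDerivWithinAt_id t (Ici a)).sub_const a).const_mul ε)
        simpa using! this
      exact h1.mul (hG t ht).exp
    refine image_norm_le_of_norm_deriv_right_lt_deriv_boundary' (f := y) (f' := y')
      (a := a) (b := T) (fun t ht => (hy t ht).continuousWithinAt.mono hsub)
      (fun t ht => (hy t (Ico_subset_Icc_self ht)).mono (Ici_subset_Ici.2 ht.1)) ?_
      (fun t ht => (hB t ht).continuousWithinAt.mono hsub)
      (fun t ht => (hB t (Ico_subset_Icc_self ht)).mono (Ici_subset_Ici.2 ht.1)) ?_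
      (right_mem_Icc.2 haT)
    · simp [hGa, hΦa, hε.le]
    · intro t ht heq
      have ht' := Ico_subset_Icc_self ht
      refine (hb t ht').trans_lt ?_
      rw [heq]
      have h1 : 1 ≤ Real.exp (G t) := Real.one_le_exp (hG0 t ht')
      have h2 := hφ t ht'
      nlinarith
  have hE : 0 < Real.exp (G T) := Real.exp_pos _
  refine le_of_forall_pos_le_add fun δ hδ => ?_
  have hc : 0 < (1 + (T - a)) * Real.exp (G T) := by
    have : 0 ≤ T - a := sub_nonneg.2 haT
    positivity
  have := key (δ / ((1 + (T - a)) * Real.exp (G T))) (by positivity)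
  refine this.trans (le_of_eq ?_)
  linear_combination div_mul_cancel₀ δ hc.ne'

variable [CompleteSpace F]

open scoped Nat in
theorem exists_linearODE_of_continuous {L : ℝ → F →L[ℝ] F} {f : ℝ → F} (hL : Continuous L)
    (hf : Continuous f) (a : ℝ) (c : F) :
    ∃ y : ℝ → F, y a = c ∧ ∀ t, HasDerivAt y (L t (y t) + f t) t := by
  let Y : ℕ → ℝ → F := fun k => Nat.rec (fun t => c + ∫ s in a..t, f s)
    (fun _ g t => ∫ s in a..t, L s (g s)) k
  have Y0 : ∀ t, Y 0 t = c + ∫ s in a..t, f s := fun t => rfl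
  have Ys : ∀ k t, Y (k + 1) t = ∫ s in a..t, L s (Y k s) := fun k t => rfl
  have dY0 : ∀ t, HasDerivAt (Y 0) (f t) t := fun t =>
    (intervalIntegral.integral_hasDerivAt_right (hf.intervalIntegrable _ _)
      hf.aestronglyMeasurable.stronglyMeasurableAtFilter hf.continuousAt).const_add c
  have cY : ∀ k, Continuous (Y k) := by
    intro k
    induction k with
    | zero => exact continuous_iff_continuousAt.2 fun t => (dY0 t).continuousAt
    | succ k ih =>
      have hc : Continuous fun s => L s (Y k s) := hL.clm_apply ih
      exact continuous_iff_continuousAt.2 fun t =>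
        (intervalIntegral.integral_hasDerivAt_right (hc.intervalIntegrable _ _)
          hc.aestronglyMeasurable.stronglyMeasurableAtFilter hc.continuousAt).continuousAt
  have dYs : ∀ k t, HasDerivAt (Y (k + 1)) (L t (Y k t)) t := fun k t => by
    have hc : Continuous fun s => L s (Y k s) := hL.clm_apply (cY k)
    exact intervalIntegral.integral_hasDerivAt_right (hc.intervalIntegrable _ _)
      hc.aestronglyMeasurable.stronglyMeasurableAtFilter hc.continuousAt
  let dY : ℕ → ℝ → F := fun k t => Nat.casesOn k (f t) fun k => L t (Y k t)
  refine ⟨fun t => ∑' k, Y k t, ?_, fun t => ?_⟩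
  · beta_reduce
    rw [tsum_eq_single 0]
    · simp [Y0]
    · intro k hk
      obtain ⟨k, rfl⟩ := Nat.exists_eq_succ_of_ne_zero hk
      simp [Ys]
  · set T : ℝ := |t - a| + 1
    have hT : 0 ≤ T := by positivity
    obtain ⟨B, hB⟩ := (isCompact_Icc (a := a - T) (b := a + T)).exists_bound_of_continuousOn
      hL.continuousOn
    obtain ⟨C, hC⟩ := (isCompact_Icc (a := a - T) (b := a + T)).exists_bound_of_continuousOn
      (cY 0).continuousOn
    obtain ⟨D, hD⟩ := (isCompact_Icc (a := a - T) (b := a + T)).exists_bound_of_continuousOn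
      hf.continuousOn
    have ha : a ∈ Icc (a - T) (a + T) := ⟨by linarith, by linarith⟩
    have hB0 : 0 ≤ B := (norm_nonneg _).trans (hB a ha)
    have hC0 : 0 ≤ C := (norm_nonneg _).trans (hC a ha)
    have bY : ∀ k, ∀ s ∈ Icc (a - T) (a + T), ‖Y k s‖ ≤ C * ((B * |s - a|) ^ k / k !) := by
      intro k
      induction k with
      | zero => intro s hs; simpa using hC s hs
      | succ k ih =>
        intro s hs
        rw [Ys, intervalIntegral.norm_intervalIntegral_eq]
        have hle : ∀ᵐ τ ∂(volume.restrict (uIoc a s)), ‖L τ (Y k τ)‖ ≤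
            C * B ^ (k + 1) / k ! * |τ - a| ^ k := by
          apply (ae_restrict_mem measurableSet_uIoc).mono
          intro τ hτ
          have hτ' : τ ∈ Icc (a - T) (a + T) :=
            (uIoc_subset_uIcc.trans (uIcc_subset_Icc ha hs)) hτ
          refine (ContinuousLinearMap.le_opNorm _ _).trans ?_
          calc ‖L τ‖ * ‖Y k τ‖ ≤ B * (C * ((B * |τ - a|) ^ k / k !)) :=
                mul_le_mul (hB τ hτ') (ih τ hτ') (norm_nonneg _) hB0
            _ = _ := by rw [mul_pow]; ring
        refine (norm_integral_le_of_norm_le (Continuous.integrableOn_uIoc (by fun_prop))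
          hle).trans (le_of_eq ?_)
        rw [integral_const_mul, integral_pow_abs_sub_uIoc, Nat.factorial_succ, mul_pow]
        push_cast
        field_simp
    let u : ℕ → ℝ := fun k => Nat.casesOn k D fun k => B * (C * ((B * T) ^ k / k !))
    have hu : Summable u := by
      rw [← summable_nat_add_iff 1]
      exact ((Real.summable_pow_div_factorial (B * T)).mul_left C).mul_left B
    have hball : ∀ s ∈ Ioo (a - T) (a + T), s ∈ Icc (a - T) (a + T) ∧ |s - a| ≤ T :=
      fun s hs => ⟨Ioo_subset_Icc_self hs, abs_le.2 ⟨by linarith [hs.1], by linarith [hs.2]⟩⟩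
    have ht : t ∈ Ioo (a - T) (a + T) := by
      have h1 := le_abs_self (t - a)
      have h2 := neg_abs_le (t - a)
      constructor <;> simp only [T] <;> linarith
    have sY : ∀ s ∈ Ioo (a - T) (a + T), Summable fun k => Y k s := fun s hs =>
      Summable.of_norm_bounded ((Real.summable_pow_div_factorial (B * |s - a|)).mul_left C)
        fun k => bY k s (hball s hs).1
    have key := hasDerivAt_tsum_of_isPreconnected (g := Y) (g' := dY) hu isOpen_Ioo
      isPreconnected_Ioo (fun k s _ => by cases k with
        | zero => exact dY0 s
        | succ k => exact dYs k s)
      (fun k s hs => by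
        cases k with
        | zero => exact hD s (hball s hs).1
        | succ k =>
          refine (ContinuousLinearMap.le_opNorm _ _).trans ?_
          refine mul_le_mul (hB s (hball s hs).1) ((bY k s (hball s hs).1).trans ?_)
            (norm_nonneg _) hB0
          have := (hball s hs).2
          gcongr) ht (sY t ht) ht
    convert! key using 1
    have sdY : Summable fun k => dY k t := by
      rw [← summable_nat_add_iff 1]
      exact (L t).summable (sY t ht)
    rw [sdY.tsum_eq_zero_add, (L t).map_tsum (sY t ht), add_comm]
    rfl

theorem exists_linearODE {a : ℝ} {L : ℝ → F →L[ℝ] F} {f : ℝ → F} (hL : ContinuousOn L (Ici a))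
    (hf : ContinuousOn f (Ici a)) (c : F) :
    ∃ y : ℝ → F, y a = c ∧ ∀ t ∈ Ici a, HasDerivWithinAt y (L t (y t) + f t) (Ici a) t := by
  have hm : Continuous fun t : ℝ => max a t := by fun_prop
  obtain ⟨y, hy, hd⟩ := exists_linearODE_of_continuous
    (hL.comp_continuous hm fun t => mem_Ici.2 (le_max_left _ _))
    (hf.comp_continuous hm fun t => mem_Ici.2 (le_max_left _ _)) a c
  refine ⟨y, hy, fun t ht => ?_⟩
  have := (hd t).hasDerivWithinAt (s := Ici a)
  simp only [Function.comp, max_eq_right (mem_Ici.1 ht)] at this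
  exact this

end LinearODE
end

noncomputable section

section ParameterDependence

set_option linter.unusedSectionVars false

open Set Filter Topology Metric

variable {E V F : Type*} [NormedAddCommGroup E] [NormedSpace ℝ E] [ProperSpace E]
  [NormedAddCommGroup V] [NormedSpace ℝ V] [NormedAddCommGroup F] [NormedSpace ℝ F]

theorem ContinuousOn.exists_ball_norm_sub_le {U : Set E} (hU : IsOpen U) {g : ℝ × E → V}
    (hg : ContinuousOn g (Ici 0 ×ˢ U)) {ξ₀ : E} (hξ : ξ₀ ∈ U) (T : ℝ) {ε : ℝ} (hε : 0 < ε) :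
    ∃ ρ > 0, ball ξ₀ ρ ⊆ U ∧
      ∀ t ∈ Icc 0 T, ∀ ξ ∈ ball ξ₀ ρ, ‖g (t, ξ) - g (t, ξ₀)‖ ≤ ε := by
  obtain ⟨ρ₀, hρ₀, hsub⟩ := nhds_basis_closedBall.mem_iff.1 (hU.mem_nhds hξ)
  have hK : IsCompact (Icc 0 T ×ˢ closedBall ξ₀ ρ₀) :=
    isCompact_Icc.prod (isCompact_closedBall _ _)
  have hu := hK.uniformContinuousOn_of_continuous
    (hg.mono (prod_mono Icc_subset_Ici_self hsub))
  obtain ⟨δ, hδ, h⟩ := uniformContinuousOn_iff.1 hu ε hε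
  refine ⟨min ρ₀ δ, lt_min hρ₀ hδ,
    (ball_subset_ball (min_le_left _ _)).trans (ball_subset_closedBall.trans hsub), ?_⟩
  intro t ht ξ hξ'
  have h1 : dist ξ ξ₀ < min ρ₀ δ := hξ'
  rw [← dist_eq_norm]
  refine (h (t, ξ) ⟨ht, (h1.trans_le (min_le_left _ _)).le⟩ (t, ξ₀)
    ⟨ht, mem_closedBall_self hρ₀.le⟩ ?_).le
  simpa [Prod.dist_eq, hδ] using h1.trans_le (min_le_right _ _)

theorem exists_ball_norm_sub_sub_le {U : Set E} (hU : IsOpen U) {g : ℝ × E → V}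
    {g' : ℝ × E → E →L[ℝ] V} (hg' : ContinuousOn g' (Ici 0 ×ˢ U))
    (hd : ∀ t ∈ Ici (0 : ℝ), ∀ ξ ∈ U, HasFDerivAt (fun η => g (t, η)) (g' (t, ξ)) ξ)
    {ξ₀ : E} (hξ : ξ₀ ∈ U) (T : ℝ) {ε : ℝ} (hε : 0 < ε) :
    ∃ ρ > 0, ball ξ₀ ρ ⊆ U ∧ ∀ t ∈ Icc 0 T, ∀ ξ ∈ ball ξ₀ ρ,
      ‖g (t, ξ) - g (t, ξ₀) - g' (t, ξ₀) (ξ - ξ₀)‖ ≤ ε * ‖ξ - ξ₀‖ := by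
  obtain ⟨ρ, hρ, hsub, h⟩ := hg'.exists_ball_norm_sub_le hU hξ T hε
  refine ⟨ρ, hρ, hsub, fun t ht ξ hξ' => ?_⟩
  exact (convex_ball ξ₀ ρ).norm_image_sub_le_of_norm_hasFDerivWithin_le'
    (f := fun η => g (t, η)) (f' := fun η => g' (t, η))
    (fun x hx => (hd t ht.1 x (hsub hx)).hasFDerivWithinAt)
    (fun x hx => h t ht x hx) (mem_ball_self hρ) hξ'

/-- `y` solves `∂ₜ y = L y + f`, `y(0) = c`, on `[0, ∞)` for every parameter in `U`. -/
structure IsLinearFlow (U : Set E) (L : ℝ × E → F →L[ℝ] F) (f : ℝ × E → F) (c : F)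
    (y : ℝ × E → F) : Prop where
  init : ∀ ξ ∈ U, y (0, ξ) = c
  deriv : ∀ ξ ∈ U, ∀ t ∈ Ici (0 : ℝ), HasDerivWithinAt (fun τ => y (τ, ξ))
    (L (t, ξ) (y (t, ξ)) + f (t, ξ)) (Ici 0) t

variable {U : Set E} {L : ℝ × E → F →L[ℝ] F} {f : ℝ × E → F} {c : F} {y : ℝ × E → F}

theorem continuousOn_time_slice {g : ℝ × E → V} (hg : ContinuousOn g (Ici 0 ×ˢ U)) {ξ : E}
    (hξ : ξ ∈ U) : ContinuousOn (fun t : ℝ => g (t, ξ)) (Ici 0) :=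
  hg.comp (by fun_prop) fun t ht => ⟨ht, hξ⟩

theorem IsLinearFlow.continuousOn_time (hy : IsLinearFlow U L f c y) {ξ : E} (hξ : ξ ∈ U) :
    ContinuousOn (fun t : ℝ => y (t, ξ)) (Ici 0) :=
  fun t ht => (hy.deriv ξ hξ t ht).continuousWithinAt

/-- The frozen right-hand side `L(t, ξ) y(t, ξ₀) + f(t, ξ)`. -/
def frozenRHS (L : ℝ × E → F →L[ℝ] F) (f y : ℝ × E → F) (ξ₀ : E) : ℝ × E → F :=
  fun p => L p (y (p.1, ξ₀)) + f p

/-- Grönwall with constant coefficients on `[0, T]`. -/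
theorem norm_le_of_deriv_bound {w w' : ℝ → F} {T B δ : ℝ} (hB : 0 ≤ B) (hδ : 0 ≤ δ)
    (hw : ∀ t ∈ Icc 0 T, HasDerivWithinAt w (w' t) (Ici 0) t)
    (hb : ∀ t ∈ Icc 0 T, ‖w' t‖ ≤ B * ‖w t‖ + δ) (h0 : w 0 = 0) :
    ∀ t ∈ Icc 0 T, ‖w t‖ ≤ δ * (T * Real.exp (B * T)) := by
  intro t ht
  have hsub : Icc 0 t ⊆ Icc 0 T := Icc_subset_Icc_right ht.2
  have hlin : ∀ (k s : ℝ), HasDerivWithinAt (fun t : ℝ => k * t) k (Ici 0) s := fun k s => by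
    simpa using! ((hasDerivWithinAt_id s (Ici 0)).const_mul k)
  have := norm_le_of_norm_deriv_le_mul_add ht.1 (y := w) (y' := w') (β := fun _ => B)
    (φ := fun _ => δ) (G := fun t => B * t) (Φ := fun t => δ * t)
    (fun s hs => hw s (hsub hs)) (fun s hs => hb s (hsub hs)) (fun s _ => hlin B s)
    (fun s _ => hlin δ s) (by simp) (by simp) (fun s hs => mul_nonneg hB hs.1) (fun _ _ => hδ)
  rw [h0, norm_zero, zero_add, mul_assoc] at this
  refine this.trans ?_
  have h1 := ht.1
  have h2 := ht.2
  have h3 : 0 ≤ T := h1.trans h2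
  gcongr

theorem IsLinearFlow.exists_bound (hU : IsOpen U) (hy : IsLinearFlow U L f c y)
    (hL : ContinuousOn L (Ici 0 ×ˢ U)) {ξ₀ : E} (hξ : ξ₀ ∈ U) (T : ℝ) :
    ∃ B, 0 ≤ B ∧ ∃ ρ > 0, ball ξ₀ ρ ⊆ U ∧ ∀ ξ ∈ ball ξ₀ ρ, ∀ δ : ℝ, 0 ≤ δ →
      (∀ t ∈ Icc 0 T, ‖frozenRHS L f y ξ₀ (t, ξ) - frozenRHS L f y ξ₀ (t, ξ₀)‖ ≤ δ) →
      ∀ t ∈ Icc 0 T, ‖y (t, ξ) - y (t, ξ₀)‖ ≤ δ * (T * Real.exp (B * T)) := by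
  obtain ⟨B, hB⟩ := (isCompact_Icc (a := (0 : ℝ)) (b := T)).exists_bound_of_continuousOn
    ((continuousOn_time_slice hL hξ).mono Icc_subset_Ici_self)
  obtain ⟨ρ, hρ, hsub, hclose⟩ := hL.exists_ball_norm_sub_le hU hξ T one_pos
  refine ⟨|B| + 1, by positivity, ρ, hρ, hsub, fun ξ hξ' δ hδ h => ?_⟩
  refine norm_le_of_deriv_bound (w := fun t => y (t, ξ) - y (t, ξ₀)) (by positivity) hδ
    (fun t ht => (hy.deriv ξ (hsub hξ') t ht.1).sub (hy.deriv ξ₀ hξ t ht.1)) (fun t ht => ?_)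
    (by simp [hy.init ξ (hsub hξ'), hy.init ξ₀ hξ])
  have e : L (t, ξ) (y (t, ξ)) + f (t, ξ) - (L (t, ξ₀) (y (t, ξ₀)) + f (t, ξ₀)) =
      L (t, ξ) (y (t, ξ) - y (t, ξ₀)) +
        (frozenRHS L f y ξ₀ (t, ξ) - frozenRHS L f y ξ₀ (t, ξ₀)) := by
    simp only [frozenRHS, map_sub]; abel
  rw [e]
  refine (norm_add_le _ _).trans (add_le_add ?_ (h t ht))
  refine ((L (t, ξ)).le_opNorm _).trans (mul_le_mul_of_nonneg_right ?_ (norm_nonneg _))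
  have h1 := hclose t ht ξ hξ'
  have h2 := (hB t ht).trans (le_abs_self B)
  have h3 := norm_le_norm_add_norm_sub' (L (t, ξ)) (L (t, ξ₀))
  linarith

theorem IsLinearFlow.continuousOn_frozenRHS (hy : IsLinearFlow U L f c y)
    (hL : ContinuousOn L (Ici 0 ×ˢ U)) (hf : ContinuousOn f (Ici 0 ×ˢ U)) {ξ₀ : E} (hξ : ξ₀ ∈ U) :
    ContinuousOn (frozenRHS L f y ξ₀) (Ici 0 ×ˢ U) := by
  have h1 : ContinuousOn (fun p : ℝ × E => y (p.1, ξ₀)) (Ici 0 ×ˢ U) :=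
    (hy.continuousOn_time hξ).comp continuousOn_fst fun p hp => hp.1
  exact (hL.clm_apply h1).add hf

theorem IsLinearFlow.continuousOn (hU : IsOpen U) (hy : IsLinearFlow U L f c y)
    (hL : ContinuousOn L (Ici 0 ×ˢ U)) (hf : ContinuousOn f (Ici 0 ×ˢ U)) :
    ContinuousOn y (Ici 0 ×ˢ U) := by
  rintro ⟨t₀, ξ₀⟩ ⟨ht₀, hξ⟩
  have ht₀ : 0 ≤ t₀ := ht₀
  have hξ : ξ₀ ∈ U := hξ
  obtain ⟨B, hB, ρ, hρ, hsub, key⟩ := hy.exists_bound hU hL hξ (t₀ + 1)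
  set K := (t₀ + 1) * Real.exp (B * (t₀ + 1))
  have hK : 0 < K := by positivity
  rw [Metric.continuousWithinAt_iff]
  intro ε hε
  obtain ⟨ρ', hρ', -, h'⟩ := (hy.continuousOn_frozenRHS hL hf hξ).exists_ball_norm_sub_le hU hξ
    (t₀ + 1) (ε := ε / 3 / K) (by positivity)
  obtain ⟨δ, hδ, h''⟩ := Metric.continuousWithinAt_iff.1 (hy.continuousOn_time hξ t₀ ht₀) (ε / 3)
    (by positivity)
  refine ⟨min (min ρ ρ') (min δ 1), by positivity, ?_⟩
  rintro ⟨t, ξ⟩ ⟨ht, -⟩ hd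
  rw [Prod.dist_eq] at hd
  simp only [max_lt_iff, lt_min_iff] at hd
  obtain ⟨⟨⟨-, hd3⟩, -, hd4⟩, ⟨hd1, -⟩, hd2, -⟩ := hd
  have ht : 0 ≤ t := ht
  have htT : t ∈ Icc 0 (t₀ + 1) := ⟨ht, by
    rw [Real.dist_eq] at hd2; linarith [(abs_lt.1 hd2).2]⟩
  have h1 := key ξ hd3 (ε / 3 / K) (by positivity) (fun s hs => h' s hs ξ hd4) t htT
  rw [div_mul_cancel₀ _ hK.ne', ← dist_eq_norm] at h1
  have h2 := h'' (mem_Ici.2 ht) hd1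
  calc dist (y (t, ξ)) (y (t₀, ξ₀)) ≤ _ := dist_triangle _ (y (t, ξ₀)) _
    _ < ε := by linarith

theorem hasFDerivAt_freq_slice {g : ℝ × E → V} (hU : IsOpen U) {p : ℝ × E}
    (hp : p ∈ Ici (0 : ℝ) ×ˢ U) {g' : ℝ × E →L[ℝ] V}
    (hg : HasFDerivWithinAt g g' (Ici 0 ×ˢ U) p) :
    HasFDerivAt (fun η => g (p.1, η)) (g'.comp (ContinuousLinearMap.inr ℝ ℝ E)) p.2 := by
  have h1 : HasFDerivWithinAt (fun η : E => (p.1, η)) (ContinuousLinearMap.inr ℝ ℝ E) U p.2 :=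
    (hasFDerivAt_prodMk_right p.1 p.2).hasFDerivWithinAt
  have h2 : MapsTo (fun η : E => (p.1, η)) U (Ici (0 : ℝ) ×ˢ U) := fun η hη => ⟨hp.1, hη⟩
  exact (HasFDerivWithinAt.comp p.2 (g := g) (f := fun η : E => (p.1, η)) hg h1 h2).hasFDerivAt
    (hU.mem_nhds hp.2)

/-- The right-hand side of the equation satisfied by the parameter derivative. -/
def variationRHS (U : Set E) (L : ℝ × E → F →L[ℝ] F) (f y : ℝ × E → F) : ℝ × E → E →L[ℝ] F :=
  fun p => ((fderivWithin ℝ L (Ici 0 ×ˢ U) p).comp (ContinuousLinearMap.inr ℝ ℝ E)).flip (y p) +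
    (fderivWithin ℝ f (Ici 0 ×ˢ U) p).comp (ContinuousLinearMap.inr ℝ ℝ E)

theorem uniqueDiffOn_Ici_prod (hU : IsOpen U) : UniqueDiffOn ℝ (Ici (0 : ℝ) ×ˢ U) :=
  (uniqueDiffOn_Ici 0).prod hU.uniqueDiffOn

theorem ContDiffOn.variationRHS (hU : IsOpen U) {m : ℕ}
    (hL : ContDiffOn ℝ (m + 1 : ℕ) L (Ici 0 ×ˢ U)) (hf : ContDiffOn ℝ (m + 1 : ℕ) f (Ici 0 ×ˢ U))
    (hy : ContDiffOn ℝ m y (Ici 0 ×ˢ U)) :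
    ContDiffOn ℝ m (variationRHS U L f y) (Ici 0 ×ˢ U) := by
  have h1 := hL.fderivWithin (m := m) (uniqueDiffOn_Ici_prod hU) (by norm_cast)
  have h2 := hf.fderivWithin (m := m) (uniqueDiffOn_Ici_prod hU) (by norm_cast)
  have h3 : ContDiffOn ℝ m (fun p => ((fderivWithin ℝ L (Ici 0 ×ˢ U) p).comp
      (ContinuousLinearMap.inr ℝ ℝ E)).flip) (Ici 0 ×ˢ U) :=
    ContDiff.comp_contDiffOn (g := fun T : E →L[ℝ] F →L[ℝ] F => T.flip)
      (ContinuousLinearMap.contDiff (𝕜 := ℝ) (E := E →L[ℝ] F →L[ℝ] F) (F := F →L[ℝ] E →L[ℝ] F)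
        (ContinuousLinearMap.flipₗᵢ ℝ E F F).toContinuousLinearEquiv.toContinuousLinearMap)
      (h1.clm_comp contDiffOn_const)
  exact (h3.clm_apply hy).add (h2.clm_comp contDiffOn_const)

theorem IsLinearFlow.hasFDerivWithinAt (hU : IsOpen U) (hy : IsLinearFlow U L f c y)
    (hL : ContDiffOn ℝ 1 L (Ici 0 ×ˢ U)) (hf : ContDiffOn ℝ 1 f (Ici 0 ×ˢ U))
    {z : ℝ × E → E →L[ℝ] F}
    (hz : IsLinearFlow U (fun p => ContinuousLinearMap.compL ℝ E F F (L p))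
      (variationRHS U L f y) 0 z) {p : ℝ × E} (hp : p ∈ Ici (0 : ℝ) ×ˢ U) :
    HasFDerivWithinAt y ((ContinuousLinearMap.toSpanSingleton ℝ (L p (y p) + f p)).comp
      (ContinuousLinearMap.fst ℝ ℝ E) + (z p).comp (ContinuousLinearMap.snd ℝ ℝ E))
      (Ici 0 ×ˢ U) p := by
  obtain ⟨t₀, ξ₀⟩ := p
  obtain ⟨ht₀, hξ⟩ := hp
  have ht₀ : 0 ≤ t₀ := ht₀
  set Ω := Ici (0 : ℝ) ×ˢ U with hΩ
  set T := t₀ + 1 with hT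
  have hT0 : 0 < T := by positivity
  have hLc := hL.continuousOn
  have hfc := hf.continuousOn
  -- derivative of the frozen right-hand side
  set g := frozenRHS L f y ξ₀ with hg
  let g' : ℝ × E → E →L[ℝ] F := fun p =>
    ((fderivWithin ℝ L Ω p).comp (ContinuousLinearMap.inr ℝ ℝ E)).flip (y (p.1, ξ₀)) +
    (fderivWithin ℝ f Ω p).comp (ContinuousLinearMap.inr ℝ ℝ E)
  have hg'0 : ∀ t, g' (t, ξ₀) = variationRHS U L f y (t, ξ₀) := fun t => rfl
  have hyt : ContinuousOn (fun p : ℝ × E => y (p.1, ξ₀)) Ω :=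
    (hy.continuousOn_time hξ).comp continuousOn_fst fun p hp => hp.1
  have hL' := hL.continuousOn_fderivWithin (uniqueDiffOn_Ici_prod hU) le_rfl
  have hf' := hf.continuousOn_fderivWithin (uniqueDiffOn_Ici_prod hU) le_rfl
  have hg'c : ContinuousOn g' Ω := by
    have h3 : ContinuousOn (fun p => ((fderivWithin ℝ L Ω p).comp
        (ContinuousLinearMap.inr ℝ ℝ E)).flip) Ω :=
      (ContinuousLinearMap.flipₗᵢ ℝ E F F).continuous.comp_continuousOn
        (hL'.clm_comp continuousOn_const)
    exact (h3.clm_apply hyt).add (hf'.clm_comp continuousOn_const)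
  have hgd : ∀ t ∈ Ici (0 : ℝ), ∀ ξ ∈ U, HasFDerivAt (fun η => g (t, η)) (g' (t, ξ)) ξ := by
    intro t ht ξ hξ
    have e1 := hasFDerivAt_freq_slice hU (p := (t, ξ)) ⟨ht, hξ⟩
      ((hL.differentiableOn one_ne_zero _ ⟨ht, hξ⟩).hasFDerivWithinAt)
    have e2 := hasFDerivAt_freq_slice hU (p := (t, ξ)) ⟨ht, hξ⟩
      ((hf.differentiableOn one_ne_zero _ ⟨ht, hξ⟩).hasFDerivWithinAt)
    have e3 := (e1.clm_apply (hasFDerivAt_const (y (t, ξ₀)) ξ)).add e2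
    convert! e3 using 1
    ext; simp [g']
  obtain ⟨B, hB, ρ, hρ, hsub, key⟩ := hy.exists_bound hU hLc hξ T
  set K := T * Real.exp (B * T)
  have hK : 0 < K := by positivity
  obtain ⟨B₁, hB₁⟩ := (isCompact_Icc (a := (0 : ℝ)) (b := T)).exists_bound_of_continuousOn
    ((continuousOn_time_slice hLc hξ).mono Icc_subset_Ici_self)
  obtain ⟨B₂, hB₂⟩ := (isCompact_Icc (a := (0 : ℝ)) (b := T)).exists_bound_of_continuousOn
    ((continuousOn_time_slice hg'c hξ).mono Icc_subset_Ici_self)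
  set K₁ := T * Real.exp (|B₁| * T)
  have hK₁ : 0 < K₁ := by positivity
  obtain ⟨ρ₁, hρ₁, -, hlip⟩ := exists_ball_norm_sub_sub_le hU hg'c hgd hξ T one_pos
  set K₂ := (1 + |B₂|) * K
  have hK₂ : 0 < K₂ := by positivity
  have lip : ∀ ξ ∈ ball ξ₀ (min ρ ρ₁), ∀ t ∈ Icc 0 T,
      ‖y (t, ξ) - y (t, ξ₀)‖ ≤ K₂ * ‖ξ - ξ₀‖ := by
    intro ξ hξ' t ht
    have := key ξ (ball_subset_ball (min_le_left _ _) hξ') ((1 + |B₂|) * ‖ξ - ξ₀‖)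
      (by positivity) (fun s hs => ?_) t ht
    · refine this.trans (le_of_eq ?_)
      simp only [K₂]; ring
    · have h1 := hlip s hs ξ (ball_subset_ball (min_le_right _ _) hξ')
      have h2 : ‖g' (s, ξ₀) (ξ - ξ₀)‖ ≤ |B₂| * ‖ξ - ξ₀‖ :=
        ((g' (s, ξ₀)).le_opNorm _).trans (mul_le_mul_of_nonneg_right
          ((hB₂ s hs).trans (le_abs_self _)) (norm_nonneg _))
      have h3 := norm_le_norm_add_norm_sub' (g (s, ξ) - g (s, ξ₀)) (g' (s, ξ₀) (ξ - ξ₀))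
      linarith
  have first : ∀ ε > 0, ∃ ρ' > 0, ∀ ξ ∈ ball ξ₀ ρ', ∀ t ∈ Icc 0 T,
      ‖y (t, ξ) - y (t, ξ₀) - z (t, ξ₀) (ξ - ξ₀)‖ ≤ ε * ‖ξ - ξ₀‖ := by
    intro ε hε
    obtain ⟨ρ₂, hρ₂, -, h2⟩ := hLc.exists_ball_norm_sub_le hU hξ T
      (ε := ε / (2 * K₁) / K₂) (by positivity)
    obtain ⟨ρ₃, hρ₃, -, h3⟩ := exists_ball_norm_sub_sub_le hU hg'c hgd hξ T
      (ε := ε / (2 * K₁)) (by positivity)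
    refine ⟨min (min ρ ρ₁) (min ρ₂ ρ₃), by positivity, fun ξ hξ' => ?_⟩
    simp only [mem_ball, lt_min_iff] at hξ'
    obtain ⟨⟨hρa, hρb⟩, hρc, hρd⟩ := hξ'
    intro t ht
    have := norm_le_of_deriv_bound (w := fun t => y (t, ξ) - y (t, ξ₀) - z (t, ξ₀) (ξ - ξ₀))
      (B := |B₁|) (δ := ε / K₁ * ‖ξ - ξ₀‖) (by positivity) (by positivity)
      (fun t ht => ((hy.deriv ξ (hsub hρa) t ht.1).sub (hy.deriv ξ₀ hξ t ht.1)).sub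
        ((hz.deriv ξ₀ hξ t ht.1).clm_apply (hasDerivWithinAt_const t _ (ξ - ξ₀))))
      (fun t ht => ?_) (by simp [hy.init ξ (hsub hρa), hy.init ξ₀ hξ, hz.init ξ₀ hξ]) t ht
    · refine this.trans (le_of_eq ?_)
      rw [show T * Real.exp (|B₁| * T) = K₁ from rfl]
      field_simp
    · have e : L (t, ξ) (y (t, ξ)) + f (t, ξ) - (L (t, ξ₀) (y (t, ξ₀)) + f (t, ξ₀)) -
          (((ContinuousLinearMap.compL ℝ E F F (L (t, ξ₀))) (z (t, ξ₀)) +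
            variationRHS U L f y (t, ξ₀)) (ξ - ξ₀) + z (t, ξ₀) 0) =
          L (t, ξ₀) (y (t, ξ) - y (t, ξ₀) - z (t, ξ₀) (ξ - ξ₀)) +
          (L (t, ξ) - L (t, ξ₀)) (y (t, ξ) - y (t, ξ₀)) +
          (g (t, ξ) - g (t, ξ₀) - g' (t, ξ₀) (ξ - ξ₀)) := by
        rw [hg'0]
        simp only [hg, frozenRHS, map_sub, ContinuousLinearMap.compL_apply,
          add_apply, sub_apply,
          ContinuousLinearMap.comp_apply, map_zero]
        abel
      rw [e]
      have a1 : ‖L (t, ξ₀) (y (t, ξ) - y (t, ξ₀) - z (t, ξ₀) (ξ - ξ₀))‖ ≤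
          |B₁| * ‖y (t, ξ) - y (t, ξ₀) - z (t, ξ₀) (ξ - ξ₀)‖ :=
        ((L (t, ξ₀)).le_opNorm _).trans (mul_le_mul_of_nonneg_right
          ((hB₁ t ht).trans (le_abs_self _)) (norm_nonneg _))
      have a2 : ‖(L (t, ξ) - L (t, ξ₀)) (y (t, ξ) - y (t, ξ₀))‖ ≤
          ε / (2 * K₁) / K₂ * (K₂ * ‖ξ - ξ₀‖) :=
        ((L (t, ξ) - L (t, ξ₀)).le_opNorm _).trans (mul_le_mul (h2 t ht ξ hρc)
          (lip ξ (by simp only [mem_ball, lt_min_iff]; exact ⟨hρa, hρb⟩) t ht) (norm_nonneg _)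
          (by positivity))
      have a3 := h3 t ht ξ hρd
      have a4 : ε / (2 * K₁) / K₂ * (K₂ * ‖ξ - ξ₀‖) + ε / (2 * K₁) * ‖ξ - ξ₀‖ =
          ε / K₁ * ‖ξ - ξ₀‖ := by field_simp; ring
      refine (norm_add₃_le).trans ?_
      linarith
  rw [hasFDerivWithinAt_iff_isLittleO, Asymptotics.isLittleO_iff]
  intro ε hε
  obtain ⟨ρ', hρ', h1⟩ := first (ε / 3) (by positivity)
  have h2 := (hasDerivWithinAt_iff_isLittleO.1 (hy.deriv ξ₀ hξ t₀ ht₀)).def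
    (show 0 < ε / 3 by positivity)
  have h3 : ∀ᶠ t in 𝓝[Ici 0] t₀, ‖z (t, ξ₀) - z (t₀, ξ₀)‖ ≤ ε / 3 := by
    have h := Metric.tendsto_nhds.1 (hz.continuousOn_time hξ t₀ ht₀) (ε / 3) (by positivity)
    filter_upwards [h] with t ht
    rw [← dist_eq_norm]; exact ht.le
  have h4 : ∀ᶠ t in 𝓝[Ici 0] t₀, t < T :=
    mem_nhdsWithin_of_mem_nhds (Iio_mem_nhds (by linarith))
  have h5 : Tendsto Prod.fst (𝓝[Ω] (t₀, ξ₀)) (𝓝[Ici 0] t₀) :=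
    (continuous_fst.continuousWithinAt (s := Ω) (x := (t₀, ξ₀))).tendsto_nhdsWithin fun p hp => hp.1
  have h6 : ∀ᶠ p in 𝓝[Ω] (t₀, ξ₀), p.2 ∈ ball ξ₀ ρ' :=
    mem_nhdsWithin_of_mem_nhds ((continuous_snd.tendsto (t₀, ξ₀)) (ball_mem_nhds ξ₀ hρ'))
  filter_upwards [h5.eventually h2, h5.eventually h3, h5.eventually h4, h6, self_mem_nhdsWithin]
    with p e2 e3 e4 e6 hpΩ
  obtain ⟨t, ξ⟩ := p
  simp only at e2 e3 e4 e6
  have e1 := h1 ξ e6 t ⟨hpΩ.1, e4.le⟩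
  have n1 : ‖ξ - ξ₀‖ ≤ ‖(t, ξ) - (t₀, ξ₀)‖ := norm_snd_le ((t, ξ) - (t₀, ξ₀))
  have n2 : ‖t - t₀‖ ≤ ‖(t, ξ) - (t₀, ξ₀)‖ := norm_fst_le ((t, ξ) - (t₀, ξ₀))
  have e : y (t, ξ) - y (t₀, ξ₀) - ((ContinuousLinearMap.toSpanSingleton ℝ
      (L (t₀, ξ₀) (y (t₀, ξ₀)) + f (t₀, ξ₀))).comp (ContinuousLinearMap.fst ℝ ℝ E) +
      (z (t₀, ξ₀)).comp (ContinuousLinearMap.snd ℝ ℝ E)) ((t, ξ) - (t₀, ξ₀)) =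
      (y (t, ξ) - y (t, ξ₀) - z (t, ξ₀) (ξ - ξ₀)) + (z (t, ξ₀) - z (t₀, ξ₀)) (ξ - ξ₀) +
      (y (t, ξ₀) - y (t₀, ξ₀) - (t - t₀) • (L (t₀, ξ₀) (y (t₀, ξ₀)) + f (t₀, ξ₀))) := by
    simp
    abel
  rw [e]
  have e5 : ‖(z (t, ξ₀) - z (t₀, ξ₀)) (ξ - ξ₀)‖ ≤ ε / 3 * ‖ξ - ξ₀‖ :=
    ((z (t, ξ₀) - z (t₀, ξ₀)).le_opNorm _).trans
      (mul_le_mul_of_nonneg_right e3 (norm_nonneg _))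
  refine (norm_add₃_le).trans ?_
  have : 0 < ε / 3 := by positivity
  nlinarith

end ParameterDependence

section SmoothDependence

open Set

variable {E : Type} [NormedAddCommGroup E] [NormedSpace ℝ E] [ProperSpace E]

theorem IsLinearFlow.contDiffOn_nat {U : Set E} (hU : IsOpen U) (m : ℕ) :
    ∀ {F : Type} [NormedAddCommGroup F] [NormedSpace ℝ F] [CompleteSpace F]
    {L : ℝ × E → F →L[ℝ] F} {f : ℝ × E → F} {c : F} {y : ℝ × E → F},
    IsLinearFlow U L f c y → ContDiffOn ℝ m L (Ici 0 ×ˢ U) → ContDiffOn ℝ m f (Ici 0 ×ˢ U) →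
    ContDiffOn ℝ m y (Ici 0 ×ˢ U) := by
  induction m with
  | zero =>
    intro F _ _ _ L f c y hy hL hf
    simp only [Nat.cast_zero, contDiffOn_zero] at hL hf ⊢
    exact hy.continuousOn hU hL hf
  | succ m ih =>
    intro F _ _ _ L f c y hy hL hf
    have hm : (m : WithTop ℕ∞) ≤ (m + 1 : ℕ) := by norm_cast; omega
    have h1 : (1 : WithTop ℕ∞) ≤ (m + 1 : ℕ) := by norm_cast; omega
    have hym := ih hy (hL.of_le hm) (hf.of_le hm)
    have hv := ContDiffOn.variationRHS hU hL hf hym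
    have hL' : ContDiffOn ℝ m (fun p => ContinuousLinearMap.compL ℝ E F F (L p)) (Ici 0 ×ˢ U) :=
      ContDiff.comp_contDiffOn (g := fun T : F →L[ℝ] F => ContinuousLinearMap.compL ℝ E F F T)
        (by fun_prop) (hL.of_le hm)
    have hex : ∀ ξ : E, ∃ w : ℝ → E →L[ℝ] F, ξ ∈ U → w 0 = 0 ∧ ∀ t ∈ Ici (0 : ℝ),
        HasDerivWithinAt w (ContinuousLinearMap.compL ℝ E F F (L (t, ξ)) (w t) +
          variationRHS U L f y (t, ξ)) (Ici 0) t := by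
      intro ξ
      by_cases hξ : ξ ∈ U
      · obtain ⟨w, hw⟩ := exists_linearODE (continuousOn_time_slice hL'.continuousOn hξ)
          (continuousOn_time_slice hv.continuousOn hξ) 0
        exact ⟨w, fun _ => hw⟩
      · exact ⟨0, fun h => absurd h hξ⟩
    choose w hw using hex
    have hz : IsLinearFlow U (fun p => ContinuousLinearMap.compL ℝ E F F (L p))
        (variationRHS U L f y) 0 (fun p => w p.2 p.1) :=
      ⟨fun ξ hξ => (hw ξ hξ).1, fun ξ hξ => (hw ξ hξ).2⟩
    have hzm := ih hz hL' hv
    have key : ContDiffOn ℝ ((m : WithTop ℕ∞) + 1) y (Ici 0 ×ˢ U) := by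
      rw [contDiffOn_succ_iff_hasFDerivWithinAt_of_uniqueDiffOn (uniqueDiffOn_Ici_prod hU)]
      refine ⟨fun h => absurd h (by simp), _, ?_, fun p hp =>
        hy.hasFDerivWithinAt hU (hL.of_le h1) (hf.of_le h1) hz hp⟩
      have e1 : ContDiffOn ℝ m (fun p => L p (y p) + f p) (Ici 0 ×ˢ U) :=
        ((hL.of_le hm).clm_apply hym).add (hf.of_le hm)
      have e2 : ContDiffOn ℝ m (fun p => ContinuousLinearMap.toSpanSingleton ℝ
          (L p (y p) + f p)) (Ici 0 ×ˢ U) :=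
        (ContinuousLinearMap.toSpanSingletonCLE (𝕜 := ℝ) (E := F)).contDiff.comp_contDiffOn e1
      exact (e2.clm_comp contDiffOn_const).add (hzm.clm_comp contDiffOn_const)
    exact_mod_cast key

/-- Solutions of linear equations depend smoothly on time and parameters. -/
theorem IsLinearFlow.contDiffOn {U : Set E} (hU : IsOpen U)
    {F : Type} [NormedAddCommGroup F] [NormedSpace ℝ F] [CompleteSpace F]
    {L : ℝ × E → F →L[ℝ] F} {f : ℝ × E → F} {c : F} {y : ℝ × E → F}
    (hy : IsLinearFlow U L f c y) (hL : ContDiffOn ℝ ∞ L (Ici 0 ×ˢ U))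
    (hf : ContDiffOn ℝ ∞ f (Ici 0 ×ˢ U)) : ContDiffOn ℝ ∞ y (Ici 0 ×ˢ U) :=
  contDiffOn_infty.2 fun m => hy.contDiffOn_nat hU m (contDiffOn_infty.1 hL m)
    (contDiffOn_infty.1 hf m)

end SmoothDependence
end

noncomputable section

section BasicSymbols

open Set

variable {n : ℕ} {S : Set (ℝ × Freq n)} {V : Type*} [NormedAddCommGroup V] [NormedSpace ℝ V]

theorem symOrd_one_add_time (hS : SymDomain S) (r : ℕ) :
    SymOrd S r (fun p => 1 + p.1) (fun p => 1 + p.1) := by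
  have base : ContDiffOn ℝ ∞ (fun p : ℝ × Freq n => 1 + p.1) S ∧
      ∃ C : ℝ, 0 ≤ C ∧ ∀ p ∈ S, ‖1 + p.1‖ ≤ C * (fun p : ℝ × Freq n => 1 + p.1) p := by
    refine ⟨by fun_prop, 1, zero_le_one, fun p hp => ?_⟩
    have := hS.time p hp
    rw [Real.norm_of_nonneg (by linarith), one_mul]
  have hd : ∀ p : ℝ × Freq n, HasFDerivAt (fun p : ℝ × Freq n => 1 + p.1)
      (ContinuousLinearMap.fst ℝ ℝ (Freq n)) p := fun p => hasFDerivAt_fst.const_add 1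
  cases r with
  | zero => exact base
  | succ r =>
    refine ⟨base, fun i => ?_⟩
    cases i with
    | none =>
      refine ((SymOrd.const (r := r) (S := S) (1 : ℝ)).weight_congr hS fun p hp => ?_).congr
        fun p hp => ?_
      · exact (div_self (hS.scale_pos hp none).ne').symm
      · rw [coordDeriv_eq hS hp (hd p).hasFDerivWithinAt]; simp [coordDir]
    | some j =>
      refine SymOrd.const_zero.congr fun p hp => ?_
      rw [coordDeriv_eq hS hp (hd p).hasFDerivWithinAt]; simp [coordDir]

theorem symOrd_freq_coord (hS : SymDomain S) (r : ℕ) (i : Fin n) :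
    SymOrd S r (fun p => ‖p.2‖) (fun p => p.2 i) := by
  have base : ContDiffOn ℝ ∞ (fun p : ℝ × Freq n => p.2 i) S ∧
      ∃ C : ℝ, 0 ≤ C ∧ ∀ p ∈ S, ‖p.2 i‖ ≤ C * (fun p : ℝ × Freq n => ‖p.2‖) p := by
    refine ⟨((EuclideanSpace.proj (𝕜 := ℝ) i).contDiff.comp contDiff_snd).contDiffOn, 1,
      zero_le_one, fun p hp => ?_⟩
    rw [one_mul]
    exact PiLp.norm_apply_le p.2 i
  have hd : ∀ p : ℝ × Freq n, HasFDerivAt (fun p : ℝ × Freq n => p.2 i)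
      ((EuclideanSpace.proj (𝕜 := ℝ) i).comp (ContinuousLinearMap.snd ℝ ℝ (Freq n))) p := fun p =>
    ((EuclideanSpace.proj (𝕜 := ℝ) i).comp (ContinuousLinearMap.snd ℝ ℝ (Freq n))).hasFDerivAt
  cases r with
  | zero => exact base
  | succ r =>
    refine ⟨base, fun j => ?_⟩
    cases j with
    | none =>
      refine SymOrd.const_zero.congr fun p hp => ?_
      rw [coordDeriv_eq hS hp (hd p).hasFDerivWithinAt]; simp [coordDir]
    | some j =>
      refine ((SymOrd.const (r := r) (S := S)
        ((EuclideanSpace.single j (1 : ℝ) : Freq n) i)).weight_congr hS fun p hp => ?_).congr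
        fun p hp => ?_
      · exact (div_self (hS.scale_pos hp (some j)).ne').symm
      · rw [coordDeriv_eq hS hp (hd p).hasFDerivWithinAt]; simp [coordDir]

theorem hasFDerivAt_norm_of_ne {x : Freq n} (hx : x ≠ 0) :
    HasFDerivAt (fun y : Freq n => ‖y‖) (‖x‖⁻¹ • innerSL ℝ x) x := by
  have h0 : ‖x‖ ≠ 0 := norm_ne_zero_iff.2 hx
  have h1 : HasFDerivAt (fun y : Freq n => ‖y‖ ^ 2) (2 • innerSL ℝ x) x :=
    (hasStrictFDerivAt_norm_sq x).hasFDerivAt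
  have h2 := h1.sqrt (by positivity)
  simp only [Real.sqrt_sq (norm_nonneg _)] at h2
  convert! h2 using 1
  ext v
  simp
  field_simp

theorem symOrd_norm_freq (hS : SymDomain S) (r : ℕ) :
    SymOrd S r (fun p => ‖p.2‖) (fun p => ‖p.2‖) ∧
      SymOrd S r (fun p => 1 / ‖p.2‖) (fun p => 1 / ‖p.2‖) := by
  have base : ContDiffOn ℝ ∞ (fun p : ℝ × Freq n => ‖p.2‖) S ∧
      ∃ C : ℝ, 0 ≤ C ∧ ∀ p ∈ S, ‖‖p.2‖‖ ≤ C * (fun p : ℝ × Freq n => ‖p.2‖) p :=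
    ⟨contDiffOn_snd.norm ℝ hS.freq, 1, zero_le_one, fun p hp => by simp⟩
  have inv : ∀ r, SymOrd S r (fun p => ‖p.2‖) (fun p => ‖p.2‖) →
      SymOrd S r (fun p => 1 / ‖p.2‖) (fun p => 1 / ‖p.2‖) := fun r h => by
    have h0 : ∀ p ∈ S, 0 < ‖p.2‖ := fun p hp => norm_pos_iff.2 (hS.freq p hp)
    have := h.ringInverse hS h0 (fun p hp => (h0 p hp).ne'.isUnit) zero_le_one
      (fun p hp => by simp)
    simpa using this
  refine ⟨?_, inv r ?_⟩ <;>
  · induction r with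
    | zero => exact base
    | succ r ih =>
      refine ⟨base, fun i => ?_⟩
      have hd : ∀ p ∈ S, HasFDerivWithinAt (fun p : ℝ × Freq n => ‖p.2‖)
          ((‖p.2‖⁻¹ • innerSL ℝ p.2).comp (ContinuousLinearMap.snd ℝ ℝ (Freq n))) S p :=
        fun p hp => ((hasFDerivAt_norm_of_ne (hS.freq p hp)).comp p
          hasFDerivAt_snd).hasFDerivWithinAt
      cases i with
      | none =>
        refine SymOrd.const_zero.congr fun p hp => ?_
        rw [coordDeriv_eq hS hp (hd p hp)]; simp [coordDir]
      | some j =>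
        refine (((symOrd_freq_coord hS r j).mul hS (inv r ih)).weight_congr hS
          fun p hp => ?_).congr fun p hp => ?_
        · simp only [coordScale]; ring
        · rw [coordDeriv_eq hS hp (hd p hp)]
          simp [coordDir, mul_comm, EuclideanSpace.inner_single_right]

end BasicSymbols

section Composition

open Set

variable {n : ℕ} {S T : Set (ℝ × Freq n)} {V : Type*} [NormedAddCommGroup V] [NormedSpace ℝ V]

/-- Change of the time variable `1 + t = g₀(p)`. -/
def timeChange (g₀ : ℝ × Freq n → ℝ) (p : ℝ × Freq n) : ℝ × Freq n := (g₀ p - 1, p.2)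

theorem SymOrd.comp_timeChange (hS : SymDomain S) (hT : SymDomain T) {g₀ : ℝ × Freq n → ℝ}
    {r : ℕ} (hg : SymOrd T r g₀ g₀) (hmap : MapsTo (timeChange g₀) T S)
    {w : ℝ × Freq n → ℝ} {a : ℝ × Freq n → V} (ha : SymOrd S r w a) :
    SymOrd T r (fun p => w (timeChange g₀ p)) (fun p => a (timeChange g₀ p)) := by
  have base : ∀ {w : ℝ × Freq n → ℝ} {a : ℝ × Freq n → V}, (ContDiffOn ℝ ∞ a S ∧
      ∃ C : ℝ, 0 ≤ C ∧ ∀ p ∈ S, ‖a p‖ ≤ C * w p) →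
      ContDiffOn ℝ ∞ (fun p => a (timeChange g₀ p)) T ∧ ∃ C : ℝ, 0 ≤ C ∧ ∀ p ∈ T,
        ‖a (timeChange g₀ p)‖ ≤ C * w (timeChange g₀ p) := by
    rintro w a ⟨h1, C, hC, h2⟩
    exact ⟨h1.comp ((hg.contDiffOn.sub contDiffOn_const).prodMk contDiffOn_snd) hmap, C, hC,
      fun p hp => h2 _ (hmap hp)⟩
  induction r generalizing w a with
  | zero => exact base ha
  | succ r ih =>
    refine ⟨base ha.1, fun i => ?_⟩
    have hg' := hg.mono_order (Nat.le_succ r)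
    have e1 : SymOrd T r (fun p => w (timeChange g₀ p) / coordScale i p)
        (fun p => coordDeriv T i g₀ p • coordDeriv S none a (timeChange g₀ p)) := by
      refine (SymOrd.bilin hT (ContinuousLinearMap.lsmul ℝ ℝ) (hg.2 i)
        (ih hg' (ha.2 none))).weight_congr hT fun p hp => ?_
      have h1 : 0 < g₀ p := by
        have := hS.time _ (hmap hp)
        simp only [timeChange] at this; linarith
      have h2 := hT.scale_pos hp i
      have h3 : coordScale none (timeChange g₀ p) = g₀ p := by simp [coordScale, timeChange]
      rw [h3]
      field_simp
    have hd : ∀ p ∈ T, HasFDerivWithinAt (fun p => a (timeChange g₀ p))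
        ((fderivWithin ℝ a S (timeChange g₀ p)).comp
          ((fderivWithin ℝ g₀ T p).prod (ContinuousLinearMap.snd ℝ ℝ (Freq n)))) T p := by
      intro p hp
      exact HasFDerivWithinAt.comp p (g := a) (f := timeChange g₀)
        (ha.contDiffOn.hasFDerivWithinAt_infty (hmap hp))
        (((hg.contDiffOn.hasFDerivWithinAt_infty hp).sub_const 1).prodMk
          hasFDerivAt_snd.hasFDerivWithinAt) hmap
    have hsplit : ∀ (A : ℝ × Freq n →L[ℝ] V) (c : ℝ) (v : Freq n),
        A (c, v) = c • A (1, 0) + A (0, v) := fun A c v => by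
      rw [← map_smul, ← map_add]; simp
    cases i with
    | none =>
      refine e1.congr fun p hp => ?_
      rw [coordDeriv_eq hT hp (hd p hp)]
      simp only [ContinuousLinearMap.comp_apply, ContinuousLinearMap.prod_apply]
      rw [hsplit]
      simp only [coordDeriv, coordDir, ContinuousLinearMap.coe_snd', add_eq_left]
      exact map_zero _
    | some j =>
      have e2 : SymOrd T r (fun p => w (timeChange g₀ p) / coordScale (some j) p)
          (fun p => coordDeriv S (some j) a (timeChange g₀ p)) := by
        exact (ih hg' (ha.2 (some j)))
      refine (e1.add hT e2).congr fun p hp => ?_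
      rw [coordDeriv_eq hT hp (hd p hp)]
      simp only [ContinuousLinearMap.comp_apply, ContinuousLinearMap.prod_apply]
      rw [hsplit]
      simp [coordDeriv, coordDir]

/-- Multiplication by an oscillating exponential costs one factor `η` per derivative. -/
theorem SymOrd.mul_cexp (hS : SymDomain S) {Φ : ℝ × Freq n → ℂ} {η ψ : ℝ × Freq n → ℝ}
    {r : ℕ} (hΦ : SymOrd S r η Φ) {η₀ : ℝ} (hη₀ : 0 < η₀) (hη : ∀ p ∈ S, η₀ ≤ η p)
    {C : ℝ} (hC : 0 ≤ C) (hψ : ∀ p ∈ S, ‖Complex.exp (Complex.I * Φ p)‖ ≤ C * ψ p)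
    {w : ℝ × Freq n → ℝ} (hw : ∀ p ∈ S, 0 ≤ w p) {g : ℝ × Freq n → ℂ} (hg : SymOrd S r w g) :
    SymOrd S r (fun p => w p * ψ p * η p ^ r) (fun p => g p * Complex.exp (Complex.I * Φ p)) := by
  have smooth : ∀ {g : ℝ × Freq n → ℂ}, ContDiffOn ℝ ∞ g S →
      ContDiffOn ℝ ∞ (fun p => g p * Complex.exp (Complex.I * Φ p)) S := fun hg =>
    hg.mul ((contDiffOn_const.mul hΦ.contDiffOn).cexp)
  have base : ∀ {w : ℝ × Freq n → ℝ} {g : ℝ × Freq n → ℂ}, (∀ p ∈ S, 0 ≤ w p) → ∀ r : ℕ,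
      (∃ C : ℝ, 0 ≤ C ∧ ∀ p ∈ S, ‖g p‖ ≤ C * w p) → ∃ C : ℝ, 0 ≤ C ∧ ∀ p ∈ S,
        ‖g p * Complex.exp (Complex.I * Φ p)‖ ≤ C * (w p * ψ p * η p ^ r) := by
    rintro w g hw r ⟨D, hD, h⟩
    refine ⟨D * C * (1 / η₀ ^ r), by positivity, fun p hp => ?_⟩
    rw [norm_mul]
    have h1 : 0 ≤ C * ψ p := (norm_nonneg _).trans (hψ p hp)
    have h2 : 1 ≤ 1 / η₀ ^ r * η p ^ r := by
      rw [one_div, ← inv_pow, ← mul_pow]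
      apply one_le_pow₀
      rw [inv_mul_eq_div, one_le_div hη₀]
      exact hη p hp
    calc ‖g p‖ * ‖Complex.exp (Complex.I * Φ p)‖ ≤ (D * w p) * (C * ψ p) :=
          mul_le_mul (h p hp) (hψ p hp) (norm_nonneg _) (mul_nonneg hD (hw p hp))
      _ ≤ (D * w p) * (C * ψ p) * (1 / η₀ ^ r * η p ^ r) :=
          le_mul_of_one_le_right (mul_nonneg (mul_nonneg hD (hw p hp)) h1) h2
      _ = _ := by ring
  induction r generalizing w g with
  | zero => exact ⟨smooth hg.1, base hw 0 hg.2⟩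
  | succ r ih =>
    refine ⟨⟨smooth hg.1.1, base hw _ hg.1.2⟩, fun i => ?_⟩
    have hΦ' := hΦ.mono_order (Nat.le_succ r)
    have hg' := hg.mono_order (Nat.le_succ r)
    have e1 : SymOrd S r (fun p => w p * η p / coordScale i p) (coordDeriv S i g) :=
      (hg.2 i).mono_weight hS (c := 1 / η₀) (by positivity) fun p hp => by
        have h1 := hS.scale_pos hp i
        have h2 := hη p hp
        have h3 := hw p hp
        rw [div_mul_div_comm, one_mul, div_le_div_iff₀ h1 (by positivity)]
        have := mul_le_mul_of_nonneg_left h2 h3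
        nlinarith
    have e2 : SymOrd S r (fun p => w p * η p / coordScale i p)
        (fun p => g p * (Complex.I * coordDeriv S i Φ p)) := by
      have := (hΦ.2 i).clm hS (ContinuousLinearMap.mul ℝ ℂ Complex.I)
      exact (hg'.mul hS this).weight_congr hS fun p hp => by ring
    have e3 := ih hΦ' (w := fun p => w p * η p / coordScale i p) (fun p hp => by
      have h1 := hS.scale_pos hp i
      have h2 := hη₀.le.trans (hη p hp)
      have h3 := hw p hp
      positivity) (e1.add hS e2)
    refine (e3.weight_congr hS fun p hp => by ring).congr fun p hp => ?_
    have h1 := hg.contDiffOn.hasFDerivWithinAt_infty hp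
    have h2 := ((hΦ.contDiffOn.hasFDerivWithinAt_infty hp).const_mul Complex.I).cexp
    refine (coordDeriv_eq hS hp (h1.mul h2) i).trans ?_
    simp [coordDeriv]
    ring

end Composition
end

noncomputable section

section FlowEstimates

open Set Filter Topology

variable {n : ℕ} {U : Set (Freq n)}

theorem cylinder_symDomain (hU : IsOpen U) (hU0 : ∀ ξ ∈ U, ξ ≠ 0) :
    SymDomain (Ici (0 : ℝ) ×ˢ U) where
  uniq := uniqueDiffOn_Ici_prod hU
  closure := by
    rw [interior_prod_eq, closure_prod_eq, hU.interior_eq, interior_Ici]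
    exact prod_mono (by rw [closure_Ioi]) subset_closure
  time := fun p hp => hp.1
  freq := fun p hp => hU0 _ hp.2

theorem restrict_symDomain {S : Set (ℝ × Freq n)} (hS : SymDomain S) (hU : IsOpen U) :
    SymDomain (S ∩ univ ×ˢ U) where
  uniq := hS.uniq.inter (isOpen_univ.prod hU)
  closure := by
    rw [interior_inter, (isOpen_univ.prod hU).interior_eq]
    rintro p ⟨hp, hpU⟩
    exact (isOpen_univ.prod hU).closure_inter ⟨hS.closure hp, hpU⟩
  time := fun p hp => hS.time p hp.1
  freq := fun p hp => hS.freq p hp.1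

theorem hasDerivWithinAt_time_slice {V : Type*} [NormedAddCommGroup V] [NormedSpace ℝ V]
    {g : ℝ × Freq n → V} (hg : ContDiffOn ℝ ∞ g (Ici 0 ×ˢ U)) {t : ℝ} (ht : t ∈ Ici (0 : ℝ))
    {ξ : Freq n} (hξ : ξ ∈ U) : HasDerivWithinAt (fun τ => g (τ, ξ))
      (coordDeriv (Ici 0 ×ˢ U) none g (t, ξ)) (Ici 0) t := by
  have h1 : HasFDerivWithinAt (fun τ : ℝ => (τ, ξ)) (ContinuousLinearMap.inl ℝ ℝ (Freq n))
      (Ici 0) t := (hasFDerivAt_prodMk_left t ξ).hasFDerivWithinAt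
  have h2 : MapsTo (fun τ : ℝ => (τ, ξ)) (Ici (0 : ℝ)) (Ici (0 : ℝ) ×ˢ U) := fun τ hτ => ⟨hτ, hξ⟩
  have h3 := (HasFDerivWithinAt.comp t (g := g) (f := fun τ : ℝ => (τ, ξ))
    (hg.hasFDerivWithinAt_infty ⟨ht, hξ⟩) h1 h2).hasDerivWithinAt
  simpa [coordDeriv, coordDir] using! h3

variable {𝔸 : Type} [NormedRing 𝔸] [NormedAlgebra ℝ 𝔸] [CompleteSpace 𝔸]
  {b f y : ℝ × Freq n → 𝔸} {c : 𝔸}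

/-- `y` solves `∂ₜ y = b y + f`, `y(0) = c` in a Banach algebra. -/
def IsAlgebraFlow (U : Set (Freq n)) (b f : ℝ × Freq n → 𝔸) (c : 𝔸) (y : ℝ × Freq n → 𝔸) : Prop :=
  IsLinearFlow U (fun p => ContinuousLinearMap.mul ℝ 𝔸 (b p)) f c y

theorem IsAlgebraFlow.contDiffOn (hU : IsOpen U) (hy : IsAlgebraFlow U b f c y)
    (hb : ContDiffOn ℝ ∞ b (Ici 0 ×ˢ U)) (hf : ContDiffOn ℝ ∞ f (Ici 0 ×ˢ U)) :
    ContDiffOn ℝ ∞ y (Ici 0 ×ˢ U) :=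
  IsLinearFlow.contDiffOn hU hy
    ((ContinuousLinearMap.mul ℝ 𝔸).contDiff.comp_contDiffOn hb) hf

theorem IsAlgebraFlow.coordDeriv_none (hU : IsOpen U)
    (hy : IsAlgebraFlow U b f c y) (hb : ContDiffOn ℝ ∞ b (Ici 0 ×ˢ U))
    (hf : ContDiffOn ℝ ∞ f (Ici 0 ×ˢ U)) :
    EqOn (coordDeriv (Ici 0 ×ˢ U) none y) (fun p => b p * y p + f p) (Ici 0 ×ˢ U) := by
  rintro ⟨t, ξ⟩ ⟨ht, hξ⟩
  exact (uniqueDiffOn_Ici (0 : ℝ) t ht).eq_deriv _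
    (hasDerivWithinAt_time_slice (hy.contDiffOn hU hb hf) ht hξ) (hy.deriv ξ hξ t ht)

theorem IsAlgebraFlow.coordDeriv_some (hU : IsOpen U) (hU0 : ∀ ξ ∈ U, ξ ≠ 0)
    (hy : IsAlgebraFlow U b f c y) (hb : ContDiffOn ℝ ∞ b (Ici 0 ×ˢ U))
    (hf : ContDiffOn ℝ ∞ f (Ici 0 ×ˢ U)) (j : Fin n) :
    IsAlgebraFlow U b (fun p => coordDeriv (Ici 0 ×ˢ U) (some j) b p * y p +
        coordDeriv (Ici 0 ×ˢ U) (some j) f p) 0 (coordDeriv (Ici 0 ×ˢ U) (some j) y) := by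
  have hS := cylinder_symDomain hU hU0
  have hys := hy.contDiffOn hU hb hf
  constructor
  · intro ξ hξ
    have h1 := hasFDerivAt_freq_slice hU (p := ((0 : ℝ), ξ)) ⟨mem_Ici.2 le_rfl, hξ⟩
      (hys.hasFDerivWithinAt_infty ⟨mem_Ici.2 le_rfl, hξ⟩)
    have h2 : HasFDerivAt (fun η => y (0, η)) (0 : Freq n →L[ℝ] 𝔸) ξ := by
      refine (hasFDerivAt_const c ξ).congr_of_eventuallyEq ?_
      filter_upwards [hU.mem_nhds hξ] with η hη using hy.init η hη
    have h3 := congrArg (fun A => A (EuclideanSpace.single j (1 : ℝ))) (h1.unique h2)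
    simpa [coordDeriv, coordDir] using h3
  · intro ξ hξ t ht
    have hp : (t, ξ) ∈ Ici (0 : ℝ) ×ˢ U := ⟨ht, hξ⟩
    have h1 := hasDerivWithinAt_time_slice (hys.coordDeriv hS (some j)) ht hξ
    rw [coordDeriv_comm hS hys none (some j) hp,
      coordDeriv_congr (hy.coordDeriv_none hU hb hf) (some j) hp] at h1
    have h2 : HasFDerivWithinAt (fun p => b p * y p + f p) _ (Ici 0 ×ˢ U) (t, ξ) :=
      ((hb.hasFDerivWithinAt_infty hp).mul' (hys.hasFDerivWithinAt_infty hp)).add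
      (hf.hasFDerivWithinAt_infty hp)
    rw [coordDeriv_eq hS hp h2] at h1
    convert! h1 using 1
    simp [coordDeriv, add_assoc]

theorem hasDerivAt_one_sub_inv {t : ℝ} (ht : 0 ≤ t) (C : ℝ) :
    HasDerivAt (fun t : ℝ => C * (1 - (1 + t)⁻¹)) (C * (1 / (1 + t) ^ 2)) t := by
  have h : 1 + t ≠ 0 := by positivity
  have := (((hasDerivAt_id t).const_add 1).inv h).const_sub 1
  convert! this.const_mul C using 1
  simp
  ring

theorem IsAlgebraFlow.symOrd (hU : IsOpen U) (hU0 : ∀ ξ ∈ U, ξ ≠ 0) {r : ℕ}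
    {v : ℝ × Freq n → ℝ} (hv : ∀ t, ∀ ξ ∈ U, v (t, ξ) = v (0, ξ)) (hv0 : ∀ ξ ∈ U, 0 ≤ v (0, ξ))
    (hb : SymOrd (Ici 0 ×ˢ U) r (fun p => 1 / (1 + p.1) ^ 2) b)
    (hf : SymOrd (Ici 0 ×ˢ U) r (fun p => v p / (1 + p.1) ^ 2) f)
    {C : ℝ} (hC : 0 ≤ C) (hc : ∀ ξ ∈ U, ‖c‖ ≤ C * v (0, ξ))
    (hy : IsAlgebraFlow U b f c y) : SymOrd (Ici 0 ×ˢ U) r v y := by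
  have hS := cylinder_symDomain hU hU0
  have base : ∀ {v : ℝ × Freq n → ℝ} (_ : ∀ t, ∀ ξ ∈ U, v (t, ξ) = v (0, ξ))
      (_ : ∀ ξ ∈ U, 0 ≤ v (0, ξ)) {f y : ℝ × Freq n → 𝔸} {c : 𝔸} {C : ℝ} (_ : 0 ≤ C)
      (_ : ∀ ξ ∈ U, ‖c‖ ≤ C * v (0, ξ)) {r : ℕ}
      (_ : SymOrd (Ici 0 ×ˢ U) r (fun p => 1 / (1 + p.1) ^ 2) b)
      (_ : SymOrd (Ici 0 ×ˢ U) r (fun p => v p / (1 + p.1) ^ 2) f)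
      (_ : IsAlgebraFlow U b f c y), ContDiffOn ℝ ∞ y (Ici 0 ×ˢ U) ∧
        ∃ C : ℝ, 0 ≤ C ∧ ∀ p ∈ Ici (0 : ℝ) ×ˢ U, ‖y p‖ ≤ C * v p := by
    intro v hv hv0 f y c C hC hc r hb hf hy
    refine ⟨hy.contDiffOn hU hb.contDiffOn hf.contDiffOn, ?_⟩
    obtain ⟨B, hB, hb⟩ := hb.bound
    obtain ⟨D, hD, hf⟩ := hf.bound
    refine ⟨(C + D) * Real.exp B, by positivity, ?_⟩
    rintro ⟨T, ξ⟩ ⟨hT, hξ⟩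
    have hT : 0 ≤ T := hT
    have hvξ := hv0 ξ hξ
    have hle : ∀ t : ℝ, 0 ≤ t → 0 ≤ 1 - (1 + t)⁻¹ ∧ 1 - (1 + t)⁻¹ ≤ 1 := fun t ht => by
      have h1 : (1 + t)⁻¹ ≤ 1 := inv_le_one_of_one_le₀ (by linarith)
      have h2 : 0 < (1 + t)⁻¹ := by positivity
      constructor <;> linarith
    have key := norm_le_of_norm_deriv_le_mul_add hT (y := fun t => y (t, ξ))
      (y' := fun t => b (t, ξ) * y (t, ξ) + f (t, ξ))
      (β := fun t => B * (1 / (1 + t) ^ 2)) (φ := fun t => (D * v (0, ξ)) * (1 / (1 + t) ^ 2))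
      (G := fun t => B * (1 - (1 + t)⁻¹)) (Φ := fun t => (D * v (0, ξ)) * (1 - (1 + t)⁻¹))
      (fun t ht => hy.deriv ξ hξ t ht.1) (fun t ht => ?_)
      (fun t ht => (hasDerivAt_one_sub_inv ht.1 _).hasDerivWithinAt)
      (fun t ht => (hasDerivAt_one_sub_inv ht.1 _).hasDerivWithinAt) (by simp) (by simp)
      (fun t ht => mul_nonneg hB (hle t ht.1).1) (fun t ht => by positivity)
    · simp only [hy.init ξ hξ] at key
      refine key.trans ?_
      rw [hv T ξ hξ]
      · have h1 := (hle T hT).2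
        have h2 := (hle T hT).1
        calc (‖c‖ + D * v (0, ξ) * (1 - (1 + T)⁻¹)) * Real.exp (B * (1 - (1 + T)⁻¹))
            ≤ (C * v (0, ξ) + D * v (0, ξ) * 1) * Real.exp (B * 1) := by
              have := hc ξ hξ
              gcongr
          _ = _ := by rw [mul_one, mul_one]; ring
    · refine (norm_add_le _ _).trans (add_le_add ?_ ?_)
      · exact (norm_mul_le _ _).trans (mul_le_mul_of_nonneg_right (hb (t, ξ) ⟨ht.1, hξ⟩)
          (norm_nonneg _))
      · refine (hf (t, ξ) ⟨ht.1, hξ⟩).trans (le_of_eq ?_)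
        simp only [hv t ξ hξ]; ring
  induction r generalizing v f y c C with
  | zero => exact base hv hv0 hC hc hb hf hy
  | succ r ih =>
    refine ⟨base hv hv0 hC hc hb hf hy, fun i => ?_⟩
    have hb' := hb.mono_order (Nat.le_succ r)
    have hf' := hf.mono_order (Nat.le_succ r)
    have hyr := ih hv hv0 hb' hf' hC hc hy
    cases i with
    | none =>
      have e1 := ((hb'.mul hS hyr).weight_congr hS (w' := fun p => v p / (1 + p.1) ^ 2)
        fun p hp => by ring).add hS hf'
      refine (e1.mono_weight hS zero_le_one fun p hp => ?_).congr
        (hy.coordDeriv_none hU hb.contDiffOn hf.contDiffOn)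
      have h1 := hS.time p hp
      have h2 : 0 ≤ v p := by
        have := hv p.1 p.2 hp.2
        rw [Prod.mk.eta] at this
        rw [this]; exact hv0 _ hp.2
      rw [one_mul]
      simp only [coordScale]
      have h3 : 1 + p.1 ≤ (1 + p.1) ^ 2 := by nlinarith
      gcongr
    | some j =>
      refine ih (v := fun p => v p / coordScale (some j) p) (C := 0) (c := 0)
        (fun t ξ hξ => ?_) (fun ξ hξ => ?_) hb' ?_ le_rfl (fun ξ hξ => by simp)
        (hy.coordDeriv_some hU hU0 hb.contDiffOn hf.contDiffOn j)
      · simp only [coordScale, hv t ξ hξ]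
      · have := hv0 ξ hξ
        simp only [coordScale]; positivity
      · have e1 := ((hb.2 (some j)).mul hS hyr).weight_congr hS
          (w' := fun p => v p / coordScale (some j) p / (1 + p.1) ^ 2) fun p hp => by ring
        have e2 := (hf.2 (some j)).weight_congr hS
          (w' := fun p => v p / coordScale (some j) p / (1 + p.1) ^ 2) fun p hp => by ring
        exact e1.add hS e2

/-- Time primitives gain the weight `1 + t`. -/
theorem IsAlgebraFlow.symOrd_primitive (hU : IsOpen U) (hU0 : ∀ ξ ∈ U, ξ ≠ 0) {r : ℕ}
    {v : ℝ × Freq n → ℝ} (hv : ∀ t, ∀ ξ ∈ U, v (t, ξ) = v (0, ξ)) (hv0 : ∀ ξ ∈ U, 0 ≤ v (0, ξ))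
    (hf : SymOrd (Ici 0 ×ˢ U) r v f)
    (hy : IsAlgebraFlow U (fun _ => 0) f 0 y) :
    SymOrd (Ici 0 ×ˢ U) r (fun p => v p * (1 + p.1)) y := by
  have hS := cylinder_symDomain hU hU0
  have base : ∀ {v : ℝ × Freq n → ℝ} (_ : ∀ t, ∀ ξ ∈ U, v (t, ξ) = v (0, ξ))
      (_ : ∀ ξ ∈ U, 0 ≤ v (0, ξ)) {f y : ℝ × Freq n → 𝔸} {r : ℕ}
      (_ : SymOrd (Ici 0 ×ˢ U) r v f) (_ : IsAlgebraFlow U (fun _ => 0) f 0 y),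
      ContDiffOn ℝ ∞ y (Ici 0 ×ˢ U) ∧
        ∃ C : ℝ, 0 ≤ C ∧ ∀ p ∈ Ici (0 : ℝ) ×ˢ U, ‖y p‖ ≤ C * (v p * (1 + p.1)) := by
    intro v hv hv0 f y r hf hy
    refine ⟨hy.contDiffOn hU contDiffOn_const hf.contDiffOn, ?_⟩
    obtain ⟨D, hD, hf⟩ := hf.bound
    refine ⟨D, hD, ?_⟩
    rintro ⟨T, ξ⟩ ⟨hT, hξ⟩
    have hT : 0 ≤ T := hT
    have hvξ := hv0 ξ hξ
    have key := norm_le_of_deriv_bound (B := 0) (δ := D * v (0, ξ)) (T := T) le_rfl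
      (by positivity) (w := fun t => y (t, ξ)) (fun t ht => hy.deriv ξ hξ t ht.1)
      (fun t ht => by
        simp only [map_zero, zero_apply, zero_add, zero_mul]
        rw [← hv t ξ hξ]
        exact hf (t, ξ) ⟨ht.1, hξ⟩) (hy.init ξ hξ) T ⟨hT, le_rfl⟩
    simp only [zero_mul, Real.exp_zero, mul_one] at key
    refine key.trans ?_
    rw [hv T ξ hξ, mul_assoc]
    gcongr
    simp
  induction r generalizing v f y with
  | zero => exact base hv hv0 hf hy
  | succ r ih =>
    refine ⟨base hv hv0 hf hy, fun i => ?_⟩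
    cases i with
    | none =>
      refine ((hf.mono_order (Nat.le_succ r)).weight_congr hS fun p hp => ?_).congr
        ((hy.coordDeriv_none hU contDiffOn_const hf.contDiffOn).trans fun p hp => by simp)
      have := hS.time p hp
      simp only [coordScale]
      field_simp
    | some j =>
      have e := ih (v := fun p => v p / coordScale (some j) p)
        (fun t ξ hξ => ?_) (fun ξ hξ => ?_) (hf.2 (some j)) (y := coordDeriv (Ici 0 ×ˢ U) (some j) y) ?_
      · exact e.weight_congr hS fun p hp => by ring
      · simp only [coordScale, hv t ξ hξ]
      · have := hv0 ξ hξ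
        simp only [coordScale]; positivity
      · have := hy.coordDeriv_some hU hU0 contDiffOn_const hf.contDiffOn j
        have e0 : (fun p => coordDeriv (Ici 0 ×ˢ U) (some j) (fun _ => (0 : 𝔸)) p * y p +
            coordDeriv (Ici 0 ×ˢ U) (some j) f p) = coordDeriv (Ici 0 ×ˢ U) (some j) f := by
          funext p; simp [coordDeriv]
        rwa [e0] at this

end FlowEstimates

section Slices

open Set

variable {n : ℕ} {V : Type*} [NormedAddCommGroup V] [NormedSpace ℝ V]

/-- Symbol estimates bound the frequency derivatives at fixed time. -/
theorem SymOrd.norm_iteratedFDerivWithin_slice {S : Set (ℝ × Freq n)}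
    (hs : ∀ t, UniqueDiffOn ℝ {η : Freq n | (t, η) ∈ S}) {r : ℕ} {w : ℝ × Freq n → ℝ}
    {g : ℝ × Freq n → V} (hg : SymOrd S r w g) (α : Fin r → Fin n) :
    ∃ C : ℝ, 0 ≤ C ∧ ∀ t ξ, (t, ξ) ∈ S →
      ‖iteratedFDerivWithin ℝ r (fun η => g (t, η)) {η | (t, η) ∈ S} ξ
        (fun i => EuclideanSpace.single (α i) (1 : ℝ))‖ ≤ C * (w (t, ξ) / ‖ξ‖ ^ r) := by
  induction r generalizing w g with
  | zero =>
    obtain ⟨C, hC, h⟩ := hg.2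
    exact ⟨C, hC, fun t ξ hp => by simpa using h (t, ξ) hp⟩
  | succ r ih =>
    obtain ⟨C, hC, h⟩ := ih (hg.2 (some (α (Fin.last r)))) (Fin.init α)
    refine ⟨C, hC, fun t ξ hp => ?_⟩
    have smooth : ContDiffOn ℝ ∞ (fun η => g (t, η)) {η | (t, η) ∈ S} :=
      hg.contDiffOn.comp (contDiffOn_const.prodMk contDiffOn_id) fun η hη => hη
    have e1 := iteratedFDerivWithin_fderivWithin_apply (hs t) (r := r)
      (smooth.of_le (by exact_mod_cast le_top)) (show ξ ∈ {η | (t, η) ∈ S} from hp)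
      (EuclideanSpace.single (α (Fin.last r)) (1 : ℝ))
      (fun i => EuclideanSpace.single (Fin.init α i) (1 : ℝ))
    have e2 : (Fin.snoc (fun i => EuclideanSpace.single (Fin.init α i) (1 : ℝ))
        (EuclideanSpace.single (α (Fin.last r)) (1 : ℝ)) : Fin (r + 1) → Freq n) =
        fun i => EuclideanSpace.single (α i) 1 := by
      funext i
      refine Fin.lastCases ?_ (fun i => ?_) i <;> simp [Fin.init]
    rw [e2] at e1
    have e3 : EqOn (fun η => fderivWithin ℝ (fun η => g (t, η)) {η | (t, η) ∈ S} η
        (EuclideanSpace.single (α (Fin.last r)) (1 : ℝ)))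
        (fun η => coordDeriv S (some (α (Fin.last r))) g (t, η)) {η | (t, η) ∈ S} := by
      intro η hη
      have h1 : HasFDerivWithinAt (fun η : Freq n => (t, η)) (ContinuousLinearMap.inr ℝ ℝ (Freq n))
        {η | (t, η) ∈ S} η := (hasFDerivAt_prodMk_right t η).hasFDerivWithinAt
      have h2 := HasFDerivWithinAt.comp η (g := g) (f := fun η : Freq n => (t, η))
        (hg.contDiffOn.hasFDerivWithinAt_infty (show (t, η) ∈ S from hη)) h1 fun _ h => h
      have h3 : fderivWithin ℝ (fun η => g (t, η)) {η | (t, η) ∈ S} η = _ :=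
        h2.fderivWithin (hs t η hη)
      simp [h3, coordDeriv, coordDir]
    rw [← e1, iteratedFDerivWithin_congr e3 hp]
    refine (h t ξ hp).trans (le_of_eq ?_)
    simp only [coordScale]
    rw [div_div, pow_succ']

end Slices
end

noncomputable section

section ZoneSymbols

open Set

variable {n d : ℕ} {V W : Type*} [NormedAddCommGroup V] [NormedSpace ℝ V]
  [NormedAddCommGroup W] [NormedSpace ℝ W]

/-- The class `S{m₁, m₂}` on the zone, for functions of the pair `(t, ξ)`. -/
def ZSymb (N m₁ m₂ : ℝ) (g : ℝ × Freq n → V) : Prop :=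
  ∀ r, SymOrd (hypZone n N) r (symWeight n m₁ m₂) g

theorem isSymbolOn_iff_zSymb {N : ℝ} (hN : 0 < N) {m₁ m₂ : ℝ} {a : ℝ → Freq n → V} :
    IsSymbolOn N m₁ m₂ a ↔ ZSymb N m₁ m₂ (fun p => a p.1 p.2) :=
  ⟨fun h r => IsSymbolOn.symOrd hN (g := fun p => a p.1 p.2) h r,
    fun h => isSymbolOn_of_symOrd hN h⟩

theorem symWeight_le {N : ℝ} (hN : 0 < N) {p : ℝ × Freq n} (hp : p ∈ hypZone n N) (m₁ m₂ l : ℝ)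
    (hl : 0 ≤ l) : symWeight n (m₁ - l) (m₂ + l) p ≤ N ^ (-l) * symWeight n m₁ m₂ p := by
  have hS := hypZone_symDomain (n := n) hN
  have h1 : 0 < 1 + p.1 := hS.scale_pos hp none
  have h2 : 0 < ‖p.2‖ := norm_pos_iff.2 (hS.freq p hp)
  rw [sub_eq_add_neg, ← symWeight_mul hS hp, mul_comm]
  refine mul_le_mul_of_nonneg_right ?_ (symWeight_pos hS hp _ _).le
  have e : symWeight n (-l) l p = ((1 + p.1) * ‖p.2‖) ^ (-l) := by
    rw [symWeight, Real.mul_rpow h1.le h2.le, one_div, Real.inv_rpow h1.le, ← Real.rpow_neg h1.le,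
      mul_comm]
  rw [e]
  exact Real.rpow_le_rpow_of_nonpos hN hp.2 (by linarith)

namespace ZSymb

variable {N m₁ m₂ k₁ k₂ : ℝ} {g h : ℝ × Freq n → V}

theorem contDiffOn (hg : ZSymb N m₁ m₂ g) : ContDiffOn ℝ ∞ g (hypZone n N) := (hg 0).contDiffOn

theorem congr (hg : ZSymb N m₁ m₂ g) (H : ∀ p ∈ hypZone n N, h p = g p) : ZSymb N m₁ m₂ h :=
  fun r => (hg r).congr H

theorem cast (hg : ZSymb N m₁ m₂ g) (h1 : m₁ = k₁) (h2 : m₂ = k₂) : ZSymb N k₁ k₂ g := by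
  subst h1 h2; exact hg

theorem mono (hN : 0 < N) {N' : ℝ} (h : N ≤ N') (hg : ZSymb N m₁ m₂ g) : ZSymb N' m₁ m₂ g :=
  fun r => (hg r).subset (hypZone_symDomain (hN.trans_le h)) (hypZone_subset h)

theorem lower (hN : 0 < N) {l : ℝ} (hl : 0 ≤ l) (hg : ZSymb N m₁ m₂ g) (h1 : m₁ = k₁ - l)
    (h2 : m₂ = k₂ + l) : ZSymb N k₁ k₂ g := by
  subst h1 h2
  exact fun r => (hg r).mono_weight (hypZone_symDomain hN) (by positivity)
    fun p hp => symWeight_le hN hp _ _ _ hl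

theorem add (hN : 0 < N) (hg : ZSymb N m₁ m₂ g) (hh : ZSymb N m₁ m₂ h) :
    ZSymb N m₁ m₂ (fun p => g p + h p) := fun r => (hg r).add (hypZone_symDomain hN) (hh r)

theorem neg (hN : 0 < N) (hg : ZSymb N m₁ m₂ g) : ZSymb N m₁ m₂ (fun p => -g p) :=
  fun r => (hg r).neg (hypZone_symDomain hN)

theorem sub (hN : 0 < N) (hg : ZSymb N m₁ m₂ g) (hh : ZSymb N m₁ m₂ h) :
    ZSymb N m₁ m₂ (fun p => g p - h p) := fun r => (hg r).sub (hypZone_symDomain hN) (hh r)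

theorem clm (hN : 0 < N) (hg : ZSymb N m₁ m₂ g) (L : V →L[ℝ] W) :
    ZSymb N m₁ m₂ (fun p => L (g p)) := fun r => (hg r).clm (hypZone_symDomain hN) L

theorem const_zero : ZSymb N m₁ m₂ (fun _ : ℝ × Freq n => (0 : V)) := fun _ => SymOrd.const_zero

theorem const (hN : 0 < N) (c : V) : ZSymb N 0 0 (fun _ : ℝ × Freq n => c) :=
  fun _ => (SymOrd.const c).weight_congr (hypZone_symDomain hN) fun p _ => by simp [symWeight]

theorem sum (hN : 0 < N) {ι : Type*} (s : Finset ι) {G : ι → ℝ × Freq n → V}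
    (hG : ∀ a ∈ s, ZSymb N m₁ m₂ (G a)) : ZSymb N m₁ m₂ (fun p => ∑ a ∈ s, G a p) :=
  fun r => SymOrd.sum (hypZone_symDomain hN) s fun a ha => hG a ha r

theorem mul {𝔸 : Type*} [NormedRing 𝔸] [NormedAlgebra ℝ 𝔸] (hN : 0 < N) {a b : ℝ × Freq n → 𝔸}
    (ha : ZSymb N m₁ m₂ a) (hb : ZSymb N k₁ k₂ b) :
    ZSymb N (m₁ + k₁) (m₂ + k₂) (fun p => a p * b p) :=
  fun r => ((ha r).mul (hypZone_symDomain hN) (hb r)).weight_congr (hypZone_symDomain hN)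
    fun _ hp => symWeight_mul (hypZone_symDomain hN) hp _ _ _ _

theorem ringInverse {𝔸 : Type*} [NormedRing 𝔸] [NormedAlgebra ℝ 𝔸] [CompleteSpace 𝔸]
    (hN : 0 < N) {a : ℝ × Freq n → 𝔸} (ha : ZSymb N m₁ m₂ a)
    (hu : ∀ p ∈ hypZone n N, IsUnit (a p)) {C : ℝ} (hC : 0 ≤ C)
    (hb : ∀ p ∈ hypZone n N, ‖Ring.inverse (a p)‖ ≤ C * symWeight n (-m₁) (-m₂) p) :
    ZSymb N (-m₁) (-m₂) (fun p => Ring.inverse (a p)) := by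
  have hS := hypZone_symDomain (n := n) hN
  have e : ∀ p ∈ hypZone n N, 1 / symWeight n m₁ m₂ p = symWeight n (-m₁) (-m₂) p := by
    intro p hp
    have h1 := symWeight_mul hS hp m₁ m₂ (-m₁) (-m₂)
    rw [add_neg_cancel, add_neg_cancel] at h1
    have h2 : symWeight n 0 0 p = 1 := by simp [symWeight]
    rw [div_eq_iff (symWeight_pos hS hp _ _).ne', mul_comm, h1, h2]
  intro r
  refine ((ha r).ringInverse hS (fun p hp => symWeight_pos hS hp _ _) hu hC
    fun p hp => ?_).weight_congr hS e
  rw [← mul_one_div, e p hp]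
  exact hb p hp

/-- The entry functional of matrices. -/
def entryCLM (d : ℕ) (a b : Fin d) : Matrix (Fin d) (Fin d) ℂ →L[ℝ] ℂ :=
  (Matrix.entryLinearMap ℝ ℂ a b).toContinuousLinearMap

/-- The elementary matrix with a given entry. -/
def singleCLM (d : ℕ) (a b : Fin d) : ℂ →L[ℝ] Matrix (Fin d) (Fin d) ℂ :=
  (Matrix.singleLinearMap ℝ a b).toContinuousLinearMap

/-- The diagonal matrix with given entries. -/
def diagonalCLM (d : ℕ) : (Fin d → ℂ) →L[ℝ] Matrix (Fin d) (Fin d) ℂ :=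
  (Matrix.diagonalLinearMap (Fin d) ℝ ℂ).toContinuousLinearMap

/-- The diagonal of a matrix. -/
def diagCLM (d : ℕ) : Matrix (Fin d) (Fin d) ℂ →L[ℝ] (Fin d → ℂ) :=
  (Matrix.diagLinearMap (Fin d) ℝ ℂ).toContinuousLinearMap

variable {A B : ℝ × Freq n → Matrix (Fin d) (Fin d) ℂ}

theorem entry (hN : 0 < N) (hA : ZSymb N m₁ m₂ A) (a b : Fin d) :
    ZSymb N m₁ m₂ (fun p => A p a b) := hA.clm hN (entryCLM d a b)

theorem diagonal (hN : 0 < N) {G : ℝ × Freq n → Fin d → ℂ} (hG : ZSymb N m₁ m₂ G) :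
    ZSymb N m₁ m₂ (fun p => Matrix.diagonal (G p)) := hG.clm hN (diagonalCLM d)

theorem diag (hN : 0 < N) (hA : ZSymb N m₁ m₂ A) :
    ZSymb N m₁ m₂ (fun p => (A p).diag) := hA.clm hN (diagCLM d)

theorem of_entries (hN : 0 < N) (hA : ∀ a b, ZSymb N m₁ m₂ (fun p => A p a b)) :
    ZSymb N m₁ m₂ A := by
  refine (sum hN Finset.univ fun a _ => sum hN Finset.univ fun b _ =>
    (hA a b).clm hN (singleCLM d a b)).congr fun p _ => ?_
  exact Matrix.matrix_eq_sum_single (A p)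

theorem hasDerivWithinAt_of_contDiffOn (hg : ContDiffOn ℝ ∞ g (hypZone n N)) {t : ℝ} {ξ : Freq n}
    (hξ : ξ ≠ 0) (ht : tBdry N ξ ≤ t) : HasDerivWithinAt (fun τ => g (τ, ξ))
      (coordDeriv (hypZone n N) none g (t, ξ)) (Ici (tBdry N ξ)) t := by
  have h1 : HasFDerivWithinAt (fun τ : ℝ => (τ, ξ)) (ContinuousLinearMap.inl ℝ ℝ (Freq n))
      (Ici (tBdry N ξ)) t := (hasFDerivAt_prodMk_left t ξ).hasFDerivWithinAt
  have h2 : MapsTo (fun τ : ℝ => (τ, ξ)) (Ici (tBdry N ξ)) (hypZone n N) :=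
    fun τ hτ => (mem_hypZone_iff hξ).2 hτ
  have h3 := (HasFDerivWithinAt.comp t (g := g) (f := fun τ : ℝ => (τ, ξ))
    (hg.hasFDerivWithinAt_infty (h2 ht)) h1 h2).hasDerivWithinAt
  simpa [coordDeriv, coordDir] using! h3

theorem Dt_eq {T : MatField n d} (hT : ContDiffOn ℝ ∞ (fun p : ℝ × Freq n => T p.1 p.2)
    (hypZone n N)) (hN : 0 < N) {p : ℝ × Freq n} (hp : p ∈ hypZone n N) :
    Dt N T p.1 p.2 = (-Complex.I) •
      coordDeriv (hypZone n N) none (fun p : ℝ × Freq n => T p.1 p.2) p := by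
  have hξ := hypZone_freq_ne hN hp
  have ht := (mem_hypZone_iff hξ).1 hp
  have h : HasDerivWithinAt (fun τ => T τ p.2) _ (Ici (tBdry N p.2)) p.1 :=
    hasDerivWithinAt_of_contDiffOn hT hξ ht
  exact congrArg (fun x => (-Complex.I) • x) (h.derivWithin (uniqueDiffOn_Ici _ _ ht))

theorem Dt_mono (hN : 0 < N) {N' : ℝ} (h : N ≤ N') {T : MatField n d}
    (hT : ContDiffOn ℝ ∞ (fun p : ℝ × Freq n => T p.1 p.2) (hypZone n N)) {p : ℝ × Freq n}
    (hp : p ∈ hypZone n N') : Dt N' T p.1 p.2 = Dt N T p.1 p.2 := by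
  have hp' := hypZone_subset h hp
  rw [Dt_eq hT hN hp', Dt_eq (hT.mono (hypZone_subset h)) (hN.trans_le h) hp]
  congr 1
  exact coordDeriv_eq (hypZone_symDomain (hN.trans_le h)) hp
    ((hT.hasFDerivWithinAt_infty hp').mono (hypZone_subset h)) none

theorem Dt (hN : 0 < N) {T : MatField n d} (hT : ZSymb N m₁ m₂ (fun p => T p.1 p.2)) :
    ZSymb N m₁ (m₂ + 1) (fun p => Dt N T p.1 p.2) := by
  have hS := hypZone_symDomain (n := n) hN
  have h1 : ZSymb N m₁ (m₂ + 1) (coordDeriv (hypZone n N) none (fun p => T p.1 p.2)) :=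
    fun r => ((hT (r + 1)).deriv none).weight_congr hS fun p hp => symWeight_time hS hp _ _
  have h2 := ((const hN ((-Complex.I) • (1 : Matrix (Fin d) (Fin d) ℂ))).mul hN h1).cast
    (zero_add _) (zero_add _)
  refine h2.congr fun p hp => ?_
  rw [Dt_eq hT.contDiffOn hN hp]
  simp

theorem Dt_mul (hN : 0 < N) {T T' : MatField n d}
    (hT : ContDiffOn ℝ ∞ (fun p : ℝ × Freq n => T p.1 p.2) (hypZone n N))
    (hT' : ContDiffOn ℝ ∞ (fun p : ℝ × Freq n => T' p.1 p.2) (hypZone n N)) {p : ℝ × Freq n}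
    (hp : p ∈ hypZone n N) : _root_.Dt N (fun t ξ => T t ξ * T' t ξ) p.1 p.2 =
      _root_.Dt N T p.1 p.2 * T' p.1 p.2 + T p.1 p.2 * _root_.Dt N T' p.1 p.2 := by
  have e : coordDeriv (hypZone n N) none (fun p => T p.1 p.2 * T' p.1 p.2) p = _ :=
    coordDeriv_eq (hypZone_symDomain hN) hp
      ((hT.hasFDerivWithinAt_infty hp).mul' (hT'.hasFDerivWithinAt_infty hp)) none
  rw [Dt_eq hT hN hp, Dt_eq hT' hN hp, Dt_eq (hT.mul hT') hN hp, e]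
  simp [coordDeriv]
  abel

theorem Dt_const (c : Matrix (Fin d) (Fin d) ℂ) (t : ℝ) (ξ : Freq n) :
    _root_.Dt N (fun _ _ => c) t ξ = 0 := by
  have h : derivWithin (fun _ : ℝ => c) (Ici (tBdry N ξ)) t = 0 :=
    congrFun (derivWithin_const _ c) t
  simp [_root_.Dt, h]

end ZSymb

end ZoneSymbols
end

noncomputable section

section Diagonalisation

open Set

variable {n d : ℕ}

theorem exists_chain {α : Type*} {P : ℝ → ℕ → α → Prop} {Q : ℝ → ℕ → α → α → Prop} {N₀ : ℝ}
    (hP : ∀ N N' j a, N₀ ≤ N → N ≤ N' → P N j a → P N' j a)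
    (hQ : ∀ N N' j a b, N₀ ≤ N → N ≤ N' → Q N j a b → Q N' j a b)
    (step : ∀ N j a, N₀ ≤ N → P N j a → ∃ N' b, N ≤ N' ∧ P N' (j + 1) b ∧ Q N' j a b)
    {a₀ : α} (h₀ : P N₀ 0 a₀) (k : ℕ) :
    ∃ N, N₀ ≤ N ∧ ∃ σ : ℕ → α, σ 0 = a₀ ∧ (∀ j ≤ k, P N j (σ j)) ∧
      ∀ j < k, Q N j (σ j) (σ (j + 1)) := by
  induction k with
  | zero => exact ⟨N₀, le_rfl, fun _ => a₀, rfl, fun j hj => by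
      obtain rfl : j = 0 := by omega
      exact h₀, fun j hj => by omega⟩
  | succ k ih =>
    obtain ⟨N, hN, σ, h0, h1, h2⟩ := ih
    obtain ⟨N', b, hN', hb1, hb2⟩ := step N k (σ k) hN (h1 k le_rfl)
    have hne : ∀ j, j ≤ k → j ≠ k + 1 := fun j hj => by omega
    refine ⟨N', hN.trans hN', Function.update σ (k + 1) b, ?_, fun j hj => ?_, fun j hj => ?_⟩
    · rw [Function.update_of_ne (by omega), h0]
    · rcases Nat.le_succ_iff.1 hj with hj | rfl
      · rw [Function.update_of_ne (hne j hj)]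
        exact hP _ _ _ _ hN hN' (h1 j hj)
      · rwa [Function.update_self]
    · rcases Nat.lt_succ_iff_lt_or_eq.1 hj with hj | rfl
      · rw [Function.update_of_ne (hne j hj.le), Function.update_of_ne (hne (j + 1) hj)]
        exact hQ _ _ _ _ _ hN hN' (h2 j hj)
      · rwa [Function.update_self, Function.update_of_ne (hne j le_rfl)]

/-- A transformation, a diagonal part and a remainder. -/
structure DiagState (n d : ℕ) where
  T : MatField n d
  G : ℝ → Freq n → Fin d → ℂ
  R : MatField n d

/-- `(D_t - D - R₀) T = T (D_t - D - diag G - R)` with the expected symbol classes. -/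
structure DiagState.IsStage (N : ℝ) (D R₀ : MatField n d) (j : ℕ) (σ : DiagState n d) : Prop where
  unit : ∀ p ∈ hypZone n N, IsUnit (σ.T p.1 p.2)
  symb : ZSymb N 0 0 (fun p => σ.T p.1 p.2)
  symb_inv : ZSymb N 0 0 (fun p => (σ.T p.1 p.2)⁻¹)
  symb_G : ZSymb N 0 1 (fun p => σ.G p.1 p.2)
  symb_R : ZSymb N (-(j : ℝ)) ((j : ℝ) + 1) (fun p => σ.R p.1 p.2)
  intertwine : ∀ p ∈ hypZone n N, Dt N σ.T p.1 p.2 - (D p.1 p.2 + R₀ p.1 p.2) * σ.T p.1 p.2 =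
    -(σ.T p.1 p.2 * (D p.1 p.2 + Matrix.diagonal (σ.G p.1 p.2) + σ.R p.1 p.2))

/-- The relation between consecutive states. -/
structure DiagState.IsStep (N : ℝ) (j : ℕ) (σ σ' : DiagState n d) : Prop where
  symb_sub : ZSymb N (-((j : ℝ) + 1)) ((j : ℝ) + 1) (fun p => σ'.T p.1 p.2 - σ.T p.1 p.2)
  diag : ∀ p ∈ hypZone n N, σ'.G p.1 p.2 = σ.G p.1 p.2 + (σ.R p.1 p.2).diag

theorem DiagState.IsStage.mono {N N' : ℝ} (hN : 0 < N) (h : N ≤ N') {D R₀ : MatField n d} {j : ℕ}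
    {σ : DiagState n d} (hσ : σ.IsStage N D R₀ j) : σ.IsStage N' D R₀ j where
  unit := fun p hp => hσ.unit p (hypZone_subset h hp)
  symb := hσ.symb.mono hN h
  symb_inv := hσ.symb_inv.mono hN h
  symb_G := hσ.symb_G.mono hN h
  symb_R := hσ.symb_R.mono hN h
  intertwine := fun p hp => by
    rw [ZSymb.Dt_mono hN h hσ.symb.contDiffOn hp]
    exact hσ.intertwine p (hypZone_subset h hp)

theorem DiagState.IsStep.mono {N N' : ℝ} (hN : 0 < N) (h : N ≤ N') {j : ℕ}
    {σ σ' : DiagState n d} (hσ : σ.IsStep N j σ') : σ.IsStep N' j σ' where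
  symb_sub := hσ.symb_sub.mono hN h
  diag := fun p hp => hσ.diag p (hypZone_subset h hp)

/-- Solves `[D, n] = -(R - diag R)`. -/
def offDiagSolution (lam : Fin d → ℝ → Freq n → ℝ) (R : MatField n d) : MatField n d := fun t ξ =>
  Matrix.of fun a b => if a = b then 0 else
    -(R t ξ a b * Ring.inverse ((lam a t ξ : ℂ) - (lam b t ξ : ℂ)))

theorem offDiagSolution_comm {lam : Fin d → ℝ → Freq n → ℝ} {R : MatField n d} {t : ℝ} {ξ : Freq n}
    (h : ∀ i j, i ≠ j → lam i t ξ ≠ lam j t ξ) :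
    lamDiag lam t ξ * offDiagSolution lam R t ξ - offDiagSolution lam R t ξ * lamDiag lam t ξ =
      Matrix.diagonal (R t ξ).diag - R t ξ := by
  ext a b
  simp only [lamDiag, Matrix.sub_apply, Matrix.diagonal_mul, Matrix.mul_diagonal, offDiagSolution,
    Matrix.of_apply]
  by_cases hab : a = b
  · subst hab; simp
  · have hne : (lam a t ξ : ℂ) - (lam b t ξ : ℂ) ≠ 0 := by
      rw [sub_ne_zero]; exact_mod_cast h a b hab
    rw [if_neg hab, Matrix.diagonal_apply_ne _ hab, Ring.inverse_eq_inv']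
    field_simp
    ring

theorem offDiagSolution_symb {N : ℝ} (hN : 0 < N) {lam : Fin d → ℝ → Freq n → ℝ}
    (hlam : ZSymb N 1 0 (fun p => lamDiag lam p.1 p.2)) {δ : ℝ} (hδ : 0 < δ)
    (hgap : ∀ t : ℝ, 0 ≤ t → ∀ ξ : Freq n, ξ ≠ 0 → ∀ i j : Fin d, i ≠ j →
      δ * ‖ξ‖ ≤ |lam i t ξ - lam j t ξ|) {R : MatField n d} {m₁ m₂ : ℝ}
    (hR : ZSymb N m₁ m₂ (fun p => R p.1 p.2)) :
    ZSymb N (m₁ - 1) m₂ (fun p => offDiagSolution lam R p.1 p.2) := by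
  have hS := hypZone_symDomain (n := n) hN
  refine ZSymb.of_entries hN fun a b => ?_
  simp only [offDiagSolution, Matrix.of_apply]
  by_cases hab : a = b
  · simp only [hab, if_true]; exact ZSymb.const_zero
  · simp only [hab, if_false]
    have h1 : ∀ a, ZSymb N 1 0 (fun p : ℝ × Freq n => (lam a p.1 p.2 : ℂ)) := fun a =>
      (hlam.entry hN a a).congr fun p _ => by simp [lamDiag]
    have h2 := (h1 a).sub hN (h1 b)
    have hlow : ∀ p ∈ hypZone n N, δ * ‖p.2‖ ≤ ‖(lam a p.1 p.2 : ℂ) - (lam b p.1 p.2 : ℂ)‖ := by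
      intro p hp
      rw [← Complex.ofReal_sub, Complex.norm_real]
      exact hgap p.1 hp.1 p.2 (hS.freq p hp) a b hab
    have h3 := h2.ringInverse hN (C := 1 / δ) (fun p hp => ?_) (by positivity) (fun p hp => ?_)
    · exact ((hR.entry hN a b).mul hN h3).neg hN |>.cast (by ring) (by ring)
    · have := hlow p hp
      have h0 : 0 < ‖p.2‖ := norm_pos_iff.2 (hS.freq p hp)
      refine (norm_pos_iff.1 (lt_of_lt_of_le (by positivity) this)).isUnit
    · have h4 := hlow p hp
      have h0 : 0 < ‖p.2‖ := norm_pos_iff.2 (hS.freq p hp)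
      rw [Ring.inverse_eq_inv', norm_inv]
      simp only [symWeight, neg_zero, Real.rpow_zero, mul_one, Real.rpow_neg_one]
      rw [one_div, ← mul_inv]
      exact inv_anti₀ (by positivity) h4

theorem norm_inverse_one_add_le {𝔸 : Type*} [NormedRing 𝔸] [CompleteSpace 𝔸] {x : 𝔸}
    (hx : ‖x‖ ≤ 1 / 2) : IsUnit (1 + x) ∧ ‖Ring.inverse (1 + x)‖ ≤ 2 * ‖(1 : 𝔸)‖ := by
  have hu : IsUnit (1 + x) := by
    have := isUnit_one_sub_of_norm_lt_one (x := -x) (by rw [norm_neg]; linarith)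
    rwa [sub_neg_eq_add] at this
  refine ⟨hu, ?_⟩
  have h1 := Ring.inverse_mul_cancel _ hu
  have h2 : Ring.inverse (1 + x) = 1 - Ring.inverse (1 + x) * x := by
    rw [mul_add, mul_one] at h1; exact eq_sub_of_add_eq h1
  have h3 : ‖Ring.inverse (1 + x)‖ ≤ ‖(1 : 𝔸)‖ + ‖Ring.inverse (1 + x)‖ * (1 / 2) := by
    conv_lhs => rw [h2]
    refine (norm_sub_le _ _).trans (add_le_add le_rfl ((norm_mul_le _ _).trans ?_))
    exact mul_le_mul_of_nonneg_left hx (norm_nonneg _)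
  linarith

theorem DiagState.exists_step {N : ℝ} (hN : 0 < N) {lam : Fin d → ℝ → Freq n → ℝ}
    (hlam : ZSymb N 1 0 (fun p => lamDiag lam p.1 p.2)) {δ : ℝ} (hδ : 0 < δ)
    (hgap : ∀ t : ℝ, 0 ≤ t → ∀ ξ : Freq n, ξ ≠ 0 → ∀ i j : Fin d, i ≠ j →
      δ * ‖ξ‖ ≤ |lam i t ξ - lam j t ξ|) {R₀ : MatField n d} {j : ℕ} {σ : DiagState n d}
    (hσ : σ.IsStage N (lamDiag lam) R₀ j) :
    ∃ N' σ', N ≤ N' ∧ DiagState.IsStage N' (lamDiag lam) R₀ (j + 1) σ' ∧ σ.IsStep N' j σ' := by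
  set ν : MatField n d := offDiagSolution lam σ.R with hν
  have sν : ZSymb N (-((j : ℝ) + 1)) ((j : ℝ) + 1) (fun p => ν p.1 p.2) :=
    (offDiagSolution_symb hN hlam hδ hgap hσ.symb_R).cast (by ring) rfl
  obtain ⟨C, hC, hb⟩ := (sν 0).bound
  set N' := max N (2 * C + 1) with hN'
  have hle : N ≤ N' := le_max_left _ _
  have hN'0 : 0 < N' := hN.trans_le hle
  have hsmall : ∀ p ∈ hypZone n N', ‖ν p.1 p.2‖ ≤ 1 / 2 := by
    intro p hp
    have h1 := hb p (hypZone_subset hle hp)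
    have h2 := symWeight_le hN'0 hp 0 0 ((j : ℝ) + 1) (by positivity)
    simp only [zero_sub, zero_add, symWeight, Real.rpow_zero, mul_one] at h2 h1
    have h3 : N' ^ (-((j : ℝ) + 1)) ≤ N'⁻¹ := by
      have h4 : 1 ≤ N' := (by linarith : 1 ≤ 2 * C + 1).trans (le_max_right _ _)
      rw [← Real.rpow_neg_one]
      exact Real.rpow_le_rpow_of_exponent_le h4 (by
        have : (0 : ℝ) ≤ j := by positivity
        linarith)
    have h5 : C * N'⁻¹ ≤ 1 / 2 := by
      rw [← div_eq_mul_inv, div_le_iff₀ hN'0]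
      have := le_max_right N (2 * C + 1)
      rw [← hN'] at this
      linarith
    exact h1.trans ((mul_le_mul_of_nonneg_left (h2.trans h3) hC).trans h5)
  have sν' := sν.mono hN hle
  have hσ' := hσ.mono hN hle
  have hlam' := hlam.mono hN hle
  have s1 : ZSymb N' 0 0 (fun p => 1 + ν p.1 p.2) :=
    (ZSymb.const hN'0 1).add hN'0 (sν'.lower hN'0 (l := (j : ℝ) + 1) (by positivity) (by ring)
      (by ring))
  have hu := fun p hp => norm_inverse_one_add_le (hsmall p hp)
  have s1i : ZSymb N' 0 0 (fun p => (1 + ν p.1 p.2)⁻¹) := by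
    simp only [Matrix.nonsing_inv_eq_ringInverse]
    refine (s1.ringInverse hN'0 (fun p hp => (hu p hp).1)
      (C := 2 * ‖(1 : Matrix (Fin d) (Fin d) ℂ)‖) (by positivity) fun p hp => ?_).cast
      neg_zero neg_zero
    simpa [symWeight] using (hu p hp).2
  let G' : ℝ → Freq n → Fin d → ℂ := fun t ξ => σ.G t ξ + (σ.R t ξ).diag
  let B : MatField n d := fun t ξ => Dt N' ν t ξ -
    (Matrix.diagonal (σ.G t ξ) + σ.R t ξ) * ν t ξ + ν t ξ * Matrix.diagonal (G' t ξ)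
  have sR1 : ZSymb N' 0 1 (fun p => σ.R p.1 p.2) :=
    hσ'.symb_R.lower hN'0 (l := (j : ℝ)) (by positivity) (by ring) (by ring)
  have sG' : ZSymb N' 0 1 (fun p => G' p.1 p.2) := hσ'.symb_G.add hN'0 (sR1.diag hN'0)
  have sB : ZSymb N' (-((j : ℝ) + 1)) ((j : ℝ) + 2) (fun p => B p.1 p.2) := by
    have e1 := (sν'.Dt hN'0).cast rfl (show (j : ℝ) + 1 + 1 = (j : ℝ) + 2 by ring)
    have e2 := (((hσ'.symb_G.diagonal hN'0).add hN'0 sR1).mul hN'0 sν').cast (zero_add _)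
      (show 1 + ((j : ℝ) + 1) = (j : ℝ) + 2 by ring)
    have e3 := (sν'.mul hN'0 (sG'.diagonal hN'0)).cast (add_zero _)
      (show (j : ℝ) + 1 + 1 = (j : ℝ) + 2 by ring)
    exact (e1.sub hN'0 e2).add hN'0 e3
  refine ⟨N', ⟨fun t ξ => σ.T t ξ * (1 + ν t ξ), G', fun t ξ => -((1 + ν t ξ)⁻¹ * B t ξ)⟩, hle,
    ⟨fun p hp => (hσ'.unit p hp).mul (hu p hp).1, ?_, ?_, sG', ?_, fun p hp => ?_⟩,
    ⟨?_, fun p hp => rfl⟩⟩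
  · exact (hσ'.symb.mul hN'0 s1).cast (zero_add _) (zero_add _)
  · simp only [Matrix.mul_inv_rev]
    exact (s1i.mul hN'0 hσ'.symb_inv).cast (zero_add _) (zero_add _)
  · refine ((s1i.mul hN'0 sB).neg hN'0).cast ?_ ?_ <;> push_cast <;> ring
  · have hp' := hypZone_subset hle hp
    have hdet : IsUnit (1 + ν p.1 p.2).det := (Matrix.isUnit_iff_isUnit_det _).1 (hu p hp).1
    have hcomm := offDiagSolution_comm (lam := lam) (R := σ.R) (t := p.1) (ξ := p.2)
      (fun a b hab heq => by
        have h1 := hgap p.1 hp.1 p.2 (hypZone_freq_ne hN'0 hp) a b hab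
        have h0 : 0 < ‖p.2‖ := norm_pos_iff.2 (hypZone_freq_ne hN'0 hp)
        rw [heq, sub_self, abs_zero] at h1
        have : 0 < δ * ‖p.2‖ := by positivity
        linarith)
    rw [← hν] at hcomm
    have hDt1 : Dt N' (fun t ξ => 1 + ν t ξ) p.1 p.2 = Dt N' ν p.1 p.2 := by
      rw [ZSymb.Dt_eq s1.contDiffOn hN'0 hp, ZSymb.Dt_eq sν'.contDiffOn hN'0 hp]
      congr 1
      refine (coordDeriv_eq (hypZone_symDomain hN'0) hp
        ((sν'.contDiffOn.hasFDerivWithinAt_infty hp).const_add 1) none)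
    simp only
    rw [ZSymb.Dt_mul hN'0 hσ'.symb.contDiffOn s1.contDiffOn hp, hDt1]
    have hi := hσ'.intertwine p hp
    have hinv : (1 + ν p.1 p.2) * -((1 + ν p.1 p.2)⁻¹ * B p.1 p.2) = -B p.1 p.2 := by
      rw [mul_neg, ← mul_assoc, Matrix.mul_nonsing_inv _ hdet, one_mul]
    have hG' : Matrix.diagonal (G' p.1 p.2) =
        Matrix.diagonal (σ.G p.1 p.2) + Matrix.diagonal (σ.R p.1 p.2).diag := by
      simp only [G', Matrix.diagonal_add]; rfl
    have hB : B p.1 p.2 = Dt N' ν p.1 p.2 - (Matrix.diagonal (σ.G p.1 p.2) + σ.R p.1 p.2) *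
        ν p.1 p.2 + ν p.1 p.2 * Matrix.diagonal (G' p.1 p.2) := rfl
    generalize Dt N' σ.T p.1 p.2 = X1 at *
    generalize Dt N' ν p.1 p.2 = X2 at *
    generalize σ.T p.1 p.2 = T at *
    generalize ν p.1 p.2 = w at *
    generalize lamDiag lam p.1 p.2 = L at *
    generalize R₀ p.1 p.2 = Q at *
    generalize Matrix.diagonal (G' p.1 p.2) = g' at *
    generalize Matrix.diagonal (σ.R p.1 p.2).diag = rd at *
    generalize Matrix.diagonal (σ.G p.1 p.2) = g at *
    generalize σ.R p.1 p.2 = R at *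
    generalize hYY : (-((1 + w)⁻¹ * B p.1 p.2)) = Y at *
    generalize B p.1 p.2 = b at *
    have hX1 : X1 = (L + Q) * T - T * (L + g + R) := by
      rw [sub_eq_iff_eq_add] at hi; rw [hi]; abel
    have e1 : T * (1 + w) * (L + g' + Y) = T * ((1 + w) * L + (1 + w) * g' - b) := by
      rw [mul_assoc, mul_add (1 + w) (L + g') Y, hinv, mul_add (1 + w) L g', sub_eq_add_neg]
    have hc' : L * w = w * L + rd - R := by
      rw [sub_eq_iff_eq_add] at hcomm; rw [hcomm]; abel
    rw [e1, hB, hX1, hG']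
    have e2 : T * (L * w) = T * (w * L + rd - R) := by rw [hc']
    have e3 : ((L + Q) * T - T * (L + g + R)) * (1 + w) + T * X2 - (L + Q) * (T * (1 + w)) =
      -T * L - T * g - T * R - T * (L * w) - T * g * w - T * R * w + T * X2 := by noncomm_ring
    rw [e3, e2]
    noncomm_ring
  · refine ((hσ'.symb.mul hN'0 sν').cast (zero_add _) (zero_add _)).congr fun p hp => ?_
    simp only [mul_add, mul_one, add_sub_cancel_left]

end Diagonalisation
end

noncomputable section

section Existence

open Set

variable {n d : ℕ} {A Ahom M : MatField n d} {lam : Fin d → ℝ → Freq n → ℝ}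
  {F₀ : ℝ → Freq n → Fin d → ℂ} {N κp κm : ℝ}

theorem SubprincipalBounds.zSymb_lamDiag (hN : 0 < N)
    (h1 : UniformlyStrictlyHyperbolic N A Ahom lam)
    (h2 : SubprincipalBounds N A Ahom lam M F₀ κp κm) :
    ZSymb N 1 0 (fun p => lamDiag lam p.1 p.2) := by
  have hM := (isSymbolOn_iff_zSymb hN).1 h2.symb
  have hMi := (isSymbolOn_iff_zSymb hN).1 h2.symb_inv
  have hA := (isSymbolOn_iff_zSymb hN).1 h1.symb
  exact (((hMi.mul hN hA).mul hN hM).cast (by ring) (by ring)).congr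
    fun p hp => (h2.diagonalises p.1 p.2 hp).symm

theorem SubprincipalBounds.zSymb_remainderZero (hN : 0 < N)
    (h1 : UniformlyStrictlyHyperbolic N A Ahom lam)
    (h2 : SubprincipalBounds N A Ahom lam M F₀ κp κm) :
    ZSymb N 0 1 (fun p => remainderZero N A Ahom M p.1 p.2) := by
  have hM := (isSymbolOn_iff_zSymb hN).1 h2.symb
  have hMi := (isSymbolOn_iff_zSymb hN).1 h2.symb_inv
  have hA := (isSymbolOn_iff_zSymb hN).1 h1.symb_sub
  exact (((hMi.mul hN hA).mul hN hM).cast (by ring) (by ring)).add hN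
    (((hMi.Dt hN).mul hN hM).cast (by ring) (by ring))

theorem exists_isDiagonalisation (hN : 0 < N) (h1 : UniformlyStrictlyHyperbolic N A Ahom lam)
    (h2 : SubprincipalBounds N A Ahom lam M F₀ κp κm) {k : ℕ} (hk : 1 ≤ k) :
    ∃ N', N ≤ N' ∧ ∃ (Nd : ℕ → MatField n d) (F : ℕ → ℝ → Freq n → Fin d → ℂ)
      (R : ℕ → MatField n d),
      IsDiagonalisation N' (lamDiag lam) (remainderZero N A Ahom M) k Nd F R := by
  obtain ⟨δ, hδ, hgap⟩ := h1.gap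
  have sD := h2.zSymb_lamDiag hN h1
  have sR := h2.zSymb_remainderZero hN h1
  set R₀ := remainderZero N A Ahom M with hR₀
  have hpos : ∀ {N'}, N ≤ N' → 0 < N' := fun h => hN.trans_le h
  obtain ⟨N', hN', σ, h0, hP, hQ⟩ := exists_chain (N₀ := N)
    (P := fun N' j σ => DiagState.IsStage (n := n) (d := d) N' (lamDiag lam) R₀ j σ)
    (Q := fun N' j σ σ' => DiagState.IsStep N' j σ σ')
    (fun _ _ _ _ h h' hσ => hσ.mono (hpos h) h')
    (fun _ _ _ _ _ h h' hσ => hσ.mono (hpos h) h')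
    (fun N' j σ h hσ => DiagState.exists_step (hpos h) (sD.mono hN h) hδ hgap hσ)
    (a₀ := ⟨fun _ _ => 1, fun _ _ => 0, R₀⟩)
    { unit := fun p _ => isUnit_one
      symb := ZSymb.const hN 1
      symb_inv := (ZSymb.const hN 1).congr fun p _ => inv_one
      symb_G := ZSymb.const_zero
      symb_R := sR.cast (by simp) (by simp)
      intertwine := fun p _ => by
        have h3 : Matrix.diagonal (0 : Fin d → ℂ) = 0 := Matrix.diagonal_zero
        simp only [ZSymb.Dt_const, mul_one, one_mul, h3, add_zero, zero_sub] } k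
  have hN'0 := hpos hN'
  refine ⟨N', hN', fun j => (σ j).T, fun j => (σ (j + 1)).G, fun j => (σ j).R, ?_⟩
  refine ⟨fun t ξ _ => by simp only [h0], ?_, fun j hj t ξ hp => (hP j hj).unit (t, ξ) hp,
    fun j hj => (isSymbolOn_iff_zSymb hN'0).2 (hP j hj).symb,
    fun j hj => (isSymbolOn_iff_zSymb hN'0).2 (hP j hj).symb_inv,
    fun j hj => (isSymbolOn_iff_zSymb hN'0).2 (hQ j hj).symb_sub,
    fun j hj => (isSymbolOn_iff_zSymb hN'0).2 (hP (j + 1) hj).symb_G,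
    fun j hj => (isSymbolOn_iff_zSymb hN'0).2 ?_,
    fun j hj => (isSymbolOn_iff_zSymb hN'0).2 ?_, fun j hj t ξ hp => ?_⟩
  · intro t ξ hp
    have h3 := (hQ 0 hk).diag (t, ξ) hp
    simpa only [h0, zero_add] using! h3
  · refine (((hP (j + 1) hj.le).symb_R.diag hN'0).cast ?_ ?_).congr fun p hp => ?_
    · push_cast; ring
    · push_cast; ring
    · simp only [(hQ (j + 1) hj).diag p hp, add_sub_cancel_left]
  · exact (hP (j + 1) hj).symb_R.cast (by push_cast; ring) (by push_cast; ring)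
  · exact (hP (j + 1) hj).intertwine (t, ξ) hp

end Existence
end

noncomputable section

section Representation

open Set

variable {n d : ℕ}

theorem eq_of_hasDerivWithinAt_zero {F : Type*} [NormedAddCommGroup F] [NormedSpace ℝ F]
    {y : ℝ → F} {a : ℝ} (hy : ∀ t ∈ Ici a, HasDerivWithinAt y 0 (Ici a) t) {s t : ℝ}
    (hs : s ∈ Ici a) (ht : t ∈ Ici a) : y s = y t := by
  refine (convex_Ici a).is_const_of_fderivWithin_eq_zero (𝕜 := ℝ)
    (fun x hx => (hy x hx).differentiableWithinAt) (fun x hx => ?_) hs ht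
  have := (hy x hx).hasFDerivWithinAt.fderivWithin (uniqueDiffOn_Ici a x hx)
  rw [this]; ext; simp

theorem hasDerivWithinAt_integral_Ici {F : Type*} [NormedAddCommGroup F] [NormedSpace ℝ F]
    [CompleteSpace F] {g : ℝ → F} {a : ℝ} (hg : ContinuousOn g (Ici a)) {t : ℝ} (ht : t ∈ Ici a) :
    HasDerivWithinAt (fun τ => ∫ u in a..τ, g u) (g t) (Ici a) t := by
  have hc : Continuous (fun u => g (max a u)) :=
    hg.comp_continuous (continuous_const.max continuous_id) fun u => mem_Ici.2 (le_max_left a u)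
  have h1 := (hc.integral_hasStrictDerivAt a t).hasDerivAt.hasDerivWithinAt (s := Ici a)
  have key : ∀ τ ∈ Ici a, (∫ u in a..τ, g u) = ∫ u in a..τ, g (max a u) := fun τ hτ => by
    refine intervalIntegral.integral_congr fun u hu => ?_
    rw [uIcc_of_le hτ] at hu
    simp only [max_eq_right hu.1]
  simp only [max_eq_right (mem_Ici.1 ht)] at h1
  exact h1.congr key (key t ht)

/-- A fundamental solution on a half line together with its left inverse. -/
theorem exists_fundamental_pair {𝔸 : Type*} [NormedRing 𝔸] [NormedAlgebra ℝ 𝔸] [CompleteSpace 𝔸]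
    {B : ℝ → 𝔸} {a : ℝ} (hB : ContinuousOn B (Ici a)) : ∃ Y : (ℝ → 𝔸) × (ℝ → 𝔸),
      Y.1 a = 1 ∧ Y.2 a = 1 ∧
      (∀ t ∈ Ici a, HasDerivWithinAt Y.1 (B t * Y.1 t) (Ici a) t) ∧
      (∀ t ∈ Ici a, HasDerivWithinAt Y.2 (-(Y.2 t * B t)) (Ici a) t) ∧
      ∀ t ∈ Ici a, Y.2 t * Y.1 t = 1 := by
  obtain ⟨y, hy0, hy⟩ := exists_linearODE (a := a)
    (L := fun t => ContinuousLinearMap.mul ℝ 𝔸 (B t)) (f := fun _ => 0)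
    ((ContinuousLinearMap.mul ℝ 𝔸).continuous.comp_continuousOn hB) continuousOn_const 1
  obtain ⟨z, hz0, hz⟩ := exists_linearODE (a := a)
    (L := fun t => (ContinuousLinearMap.mul ℝ 𝔸).flip (-B t)) (f := fun _ => 0)
    ((ContinuousLinearMap.mul ℝ 𝔸).flip.continuous.comp_continuousOn hB.neg) continuousOn_const 1
  simp only [ContinuousLinearMap.mul_apply', ContinuousLinearMap.flip_apply, add_zero, mul_neg]
    at hy hz
  refine ⟨(y, z), hy0, hz0, hy, hz, fun t ht => ?_⟩
  have h2 : ∀ t ∈ Ici a, HasDerivWithinAt (fun t => z t * y t) 0 (Ici a) t := fun t ht => by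
    refine ((hz t ht).mul (hy t ht)).congr_deriv ?_
    noncomm_ring
  have := eq_of_hasDerivWithinAt_zero h2 ht (mem_Ici.2 le_rfl)
  simpa [hy0, hz0] using! this

theorem eq_of_linearODE {B y y' : ℝ → Matrix (Fin d) (Fin d) ℂ} {a : ℝ}
    (hB : ContinuousOn B (Ici a)) (hy : ∀ t ∈ Ici a, HasDerivWithinAt y (B t * y t) (Ici a) t)
    (hy' : ∀ t ∈ Ici a, HasDerivWithinAt y' (B t * y' t) (Ici a) t) (h : y a = y' a) {t : ℝ}
    (ht : t ∈ Ici a) : y t = y' t := by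
  obtain ⟨⟨Φ, Ψ⟩, -, -, -, hΨ, hinv⟩ := exists_fundamental_pair hB
  have key : ∀ {x : ℝ → Matrix (Fin d) (Fin d) ℂ},
      (∀ t ∈ Ici a, HasDerivWithinAt x (B t * x t) (Ici a) t) → Ψ t * x t = Ψ a * x a := by
    intro x hx
    refine eq_of_hasDerivWithinAt_zero (y := fun t => Ψ t * x t) (fun t ht => ?_) ht
      (mem_Ici.2 le_rfl)
    refine ((hΨ t ht).mul (hx t ht)).congr_deriv ?_
    rw [neg_mul, mul_assoc, neg_add_cancel]
  have h2 : Ψ t * y t = Ψ t * y' t := by rw [key hy, key hy', h]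
  have h3 := congrArg (fun x => Φ t * x) h2
  simpa only [← mul_assoc, mul_eq_one_comm.1 (hinv t ht), one_mul] using! h3

/-- The diagonal phase `∫_s^t (λ_j + F_j)`. -/
def phase (lam : Fin d → ℝ → Freq n → ℝ) (F : ℝ → Freq n → Fin d → ℂ) (t s : ℝ) (ξ : Freq n)
    (j : Fin d) : ℂ := ∫ τ in s..t, ((lam j τ ξ : ℂ) + F τ ξ j)

/-- The remainder conjugated by the diagonal propagator. -/
def conjRemainder (lam : Fin d → ℝ → Freq n → ℝ) (F : ℝ → Freq n → Fin d → ℂ) (R : MatField n d)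
    (t s : ℝ) (ξ : Freq n) : Matrix (Fin d) (Fin d) ℂ := Matrix.of fun a b =>
  R t ξ a b * Complex.exp (Complex.I * (phase lam F t s ξ b - phase lam F t s ξ a))

variable {lam : Fin d → ℝ → Freq n → ℝ} {F : ℝ → Freq n → Fin d → ℂ} {R : MatField n d}

theorem diagExp_mul_conjRemainder (t s : ℝ) (ξ : Freq n) :
    diagExp lam F t s ξ * conjRemainder lam F R t s ξ = R t ξ * diagExp lam F t s ξ := by
  ext a b
  simp only [diagExp, Matrix.diagonal_mul, Matrix.mul_diagonal, conjRemainder, Matrix.of_apply]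
  change Complex.exp (Complex.I * phase lam F t s ξ a) * _ =
    _ * Complex.exp (Complex.I * phase lam F t s ξ b)
  rw [mul_left_comm, ← Complex.exp_add]
  congr 2; ring

theorem diagExp_self (s : ℝ) (ξ : Freq n) : diagExp lam F s s ξ = 1 := by
  simp [diagExp]

theorem norm_matrix_le_sum (B : Matrix (Fin d) (Fin d) ℂ) : ‖B‖ ≤ ∑ a, ∑ b, ‖B a b‖ := by
  rw [Matrix.linfty_opNorm_def]
  have : (Finset.univ.sup fun i : Fin d => ∑ j, ‖B i j‖₊) ≤ ∑ a, ∑ b, ‖B a b‖₊ :=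
    Finset.sup_le fun i hi => Finset.single_le_sum (f := fun i => ∑ j, ‖B i j‖₊)
      (fun _ _ => zero_le) hi
  simpa only [NNReal.coe_sum, coe_nnnorm] using NNReal.coe_le_coe.2 this

theorem norm_entry_le (B : Matrix (Fin d) (Fin d) ℂ) (a b : Fin d) : ‖B a b‖ ≤ ‖B‖ := by
  rw [Matrix.linfty_opNorm_def]
  have : ‖B a b‖₊ ≤ Finset.univ.sup fun i : Fin d => ∑ j, ‖B i j‖₊ :=
    (Finset.single_le_sum (f := fun j => ‖B a j‖₊) (fun _ _ => zero_le) (Finset.mem_univ b)).trans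
      (Finset.le_sup (f := fun i : Fin d => ∑ j, ‖B i j‖₊) (Finset.mem_univ a))
  exact_mod_cast this

variable {N : ℝ}

theorem continuousOn_phase_integrand
    (hlam : ZSymb N 1 0 (fun p => lamDiag lam p.1 p.2)) (hN : 0 < N)
    (hF : ZSymb N 0 1 (fun p => F p.1 p.2)) {ξ : Freq n} (hξ : ξ ≠ 0) (j : Fin d) :
    ContinuousOn (fun τ => (lam j τ ξ : ℂ) + F τ ξ j) (Ici (tBdry N ξ)) := by
  have h1 : ContinuousOn (fun p : ℝ × Freq n => (lam j p.1 p.2 : ℂ) + F p.1 p.2 j)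
      (hypZone n N) := by
    refine ContinuousOn.add ?_ ?_
    · refine (hlam.entry hN j j).contDiffOn.continuousOn.congr fun p _ => ?_
      simp [lamDiag]
    · exact (continuous_apply j).comp_continuousOn hF.contDiffOn.continuousOn
  refine h1.comp (f := fun τ => (τ, ξ)) (by fun_prop) fun τ hτ => ?_
  exact (mem_hypZone_iff hξ).2 hτ

theorem hasDerivWithinAt_phase
    (hlam : ZSymb N 1 0 (fun p => lamDiag lam p.1 p.2)) (hN : 0 < N)
    (hF : ZSymb N 0 1 (fun p => F p.1 p.2)) {ξ : Freq n} (hξ : ξ ≠ 0) {s t : ℝ}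
    (hs : tBdry N ξ ≤ s) (ht : s ≤ t) (j : Fin d) :
    HasDerivWithinAt (fun τ => phase lam F τ s ξ j) ((lam j t ξ : ℂ) + F t ξ j) (Ici s) t :=
  hasDerivWithinAt_integral_Ici
    ((continuousOn_phase_integrand hlam hN hF hξ j).mono (Ici_subset_Ici.2 hs)) ht

theorem hasDerivWithinAt_diagExp
    (hlam : ZSymb N 1 0 (fun p => lamDiag lam p.1 p.2)) (hN : 0 < N)
    (hF : ZSymb N 0 1 (fun p => F p.1 p.2)) {ξ : Freq n} (hξ : ξ ≠ 0) {s t : ℝ}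
    (hs : tBdry N ξ ≤ s) (ht : s ≤ t) :
    HasDerivWithinAt (fun τ => diagExp lam F τ s ξ)
      (Complex.I • ((lamDiag lam t ξ + Matrix.diagonal (F t ξ)) * diagExp lam F t s ξ))
      (Ici s) t := by
  have h1 : HasDerivWithinAt (fun τ => fun j => Complex.exp (Complex.I * phase lam F τ s ξ j))
      (fun j => Complex.exp (Complex.I * phase lam F t s ξ j) *
        (Complex.I * ((lam j t ξ : ℂ) + F t ξ j))) (Ici s) t :=
    hasDerivWithinAt_pi.2 fun j =>
      ((hasDerivWithinAt_phase hlam hN hF hξ hs ht j).const_mul Complex.I).cexp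
  have h2 := (ZSymb.diagonalCLM d).hasFDerivAt.comp_hasDerivWithinAt t h1
  refine h2.congr_deriv ?_
  change Matrix.diagonal _ = _
  rw [lamDiag, Matrix.diagonal_add, diagExp, Matrix.diagonal_mul_diagonal, ← Matrix.diagonal_smul]
  congr 1
  funext j
  simp only [phase, Pi.smul_apply, smul_eq_mul]
  ring

theorem continuousOn_conjRemainder
    (hlam : ZSymb N 1 0 (fun p => lamDiag lam p.1 p.2)) (hN : 0 < N)
    (hF : ZSymb N 0 1 (fun p => F p.1 p.2)) {m₁ m₂ : ℝ}
    (hR : ZSymb N m₁ m₂ (fun p => R p.1 p.2)) {ξ : Freq n} (hξ : ξ ≠ 0) {s : ℝ}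
    (hs : tBdry N ξ ≤ s) :
    ContinuousOn (fun t => conjRemainder lam F R t s ξ) (Ici s) := by
  refine continuousOn_pi.2 fun a => continuousOn_pi.2 fun b => ?_
  have h0 : ∀ j, ContinuousOn (fun t => phase lam F t s ξ j) (Ici s) := fun j t ht =>
    (hasDerivWithinAt_phase hlam hN hF hξ hs ht j).continuousWithinAt
  have h1 : ContinuousOn (fun t => R t ξ a b) (Ici s) :=
    (hR.entry hN a b).contDiffOn.continuousOn.comp (f := fun τ => (τ, ξ)) (by fun_prop)
      fun τ hτ => (mem_hypZone_iff hξ).2 (hs.trans hτ)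
  exact h1.mul (Complex.continuous_exp.comp_continuousOn
    (continuousOn_const.mul ((h0 b).sub (h0 a))))

end Representation
end

noncomputable section

section Bounds

open Set

variable {n d : ℕ}

theorem hasDerivAt_inv_sub_inv {t : ℝ} (ht : 0 ≤ t) (s c : ℝ) :
    HasDerivAt (fun t : ℝ => c * ((1 + s)⁻¹ - (1 + t)⁻¹)) (c * (1 / (1 + t) ^ 2)) t := by
  have h0 : (1 + t) ≠ 0 := by positivity
  have h1 : HasDerivAt (fun t : ℝ => 1 + t) 1 t := (hasDerivAt_id t).const_add 1
  refine (((h1.inv h0).const_sub (1 + s)⁻¹).const_mul c).congr_deriv ?_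
  field_simp

/-- Grönwall's inequality for coefficients decaying like `(1 + t)⁻²`. -/
theorem norm_le_of_deriv_decay {F : Type*} [NormedAddCommGroup F] [NormedSpace ℝ F]
    {y y' : ℝ → F} {s t c e : ℝ} (hs : 0 ≤ s) (hst : s ≤ t) (hc : 0 ≤ c) (he : 0 ≤ e)
    (hy : ∀ τ ∈ Ici s, HasDerivWithinAt y (y' τ) (Ici s) τ)
    (hb : ∀ τ ∈ Ici s, ‖y' τ‖ ≤ c * (1 / (1 + τ) ^ 2) * ‖y τ‖ + e * (1 / (1 + τ) ^ 2)) :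
    ‖y t‖ ≤ (‖y s‖ + e * (1 + s)⁻¹) * Real.exp (c * (1 + s)⁻¹) := by
  have hpos : ∀ τ ∈ Icc s t, 0 ≤ τ := fun τ h => hs.trans h.1
  have hd : ∀ c, ∀ τ ∈ Icc s t, HasDerivWithinAt (fun t : ℝ => c * ((1 + s)⁻¹ - (1 + t)⁻¹))
    (c * (1 / (1 + τ) ^ 2)) (Ici s) τ := fun c τ hτ =>
      (hasDerivAt_inv_sub_inv (hpos τ hτ) s c).hasDerivWithinAt
  have h1 := norm_le_of_norm_deriv_le_mul_add hst (fun τ h => hy τ h.1) (fun τ h => hb τ h.1)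
    (hd c) (hd e) (by simp) (by simp) (fun τ hτ => ?_) (fun τ hτ => ?_)
  · have ht : 0 ≤ t := hs.trans hst
    have h2 : ∀ c : ℝ, 0 ≤ c → c * ((1 + s)⁻¹ - (1 + t)⁻¹) ≤ c * (1 + s)⁻¹ := fun c hc => by
      refine mul_le_mul_of_nonneg_left ?_ hc
      have : 0 ≤ (1 + t)⁻¹ := by positivity
      linarith
    refine h1.trans (mul_le_mul (add_le_add le_rfl (h2 e he)) (Real.exp_le_exp.2 (h2 c hc))
      (Real.exp_pos _).le (by positivity))
  · refine mul_nonneg hc (sub_nonneg.2 (inv_anti₀ (by positivity) (by linarith [hτ.1])))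
  · positivity

theorem norm_integral_le_of_decay {F : Type*} [NormedAddCommGroup F] [NormedSpace ℝ F]
    [CompleteSpace F] {g : ℝ → F} {s t c : ℝ} (hs : 0 ≤ s) (hst : s ≤ t) (hc : 0 ≤ c)
    (hg : ContinuousOn g (Ici s)) (hb : ∀ τ ∈ Ici s, ‖g τ‖ ≤ c * (1 / (1 + τ) ^ 2)) :
    ‖∫ τ in s..t, g τ‖ ≤ c * (1 + s)⁻¹ := by
  have := norm_le_of_deriv_decay hs hst le_rfl hc
    (fun τ hτ => hasDerivWithinAt_integral_Ici hg hτ)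
    (fun τ hτ => by simpa using! hb τ hτ)
  simpa using! this

variable {lam : Fin d → ℝ → Freq n → ℝ} {F : ℝ → Freq n → Fin d → ℂ} {R : MatField n d} {N : ℝ}

theorem IsDiagonalisation.zSymb_sub_zero (hN : 0 < N) {D R₀ : MatField n d} {k : ℕ}
    {Nd : ℕ → MatField n d} {F : ℕ → ℝ → Freq n → Fin d → ℂ} {R : ℕ → MatField n d}
    (h : IsDiagonalisation N D R₀ k Nd F R) {j : ℕ} (hj : j < k) :
    ZSymb N (-1) 2 (fun p => F j p.1 p.2 - F 0 p.1 p.2) := by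
  induction j with
  | zero => simp only [sub_self]; exact ZSymb.const_zero
  | succ j ih =>
    have h1 := ((isSymbolOn_iff_zSymb hN).1 (h.F_sub j hj)).lower hN (l := (j : ℝ))
      (k₁ := -1) (k₂ := 2) (by positivity) (by ring) (by ring)
    exact ((ih (by omega)).add hN h1).congr fun p _ => by abel

/-- Two-sided logarithmic bounds for the imaginary part of the phase. -/
def PhaseBounds (N : ℝ) (lam : Fin d → ℝ → Freq n → ℝ) (F : ℝ → Freq n → Fin d → ℂ)
    (κp κm C : ℝ) : Prop :=
  ∀ ξ : Freq n, ξ ≠ 0 → ∀ s t : ℝ, tBdry N ξ ≤ s → s ≤ t → ∀ j : Fin d,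
    κp * Real.log ((1 + t) / (1 + s)) - C ≤ (phase lam F t s ξ j).im ∧
    (phase lam F t s ξ j).im ≤ κm * Real.log ((1 + t) / (1 + s)) + C

theorem one_add_mul_norm_ge {ξ : Freq n} (hξ : ξ ≠ 0) {s : ℝ}
    (hs : tBdry N ξ ≤ s) : N ≤ (1 + s) * ‖ξ‖ := ((mem_hypZone_iff hξ).2 hs).2

theorem exists_phaseBounds {A Ahom M : MatField n d} {F₀ : ℝ → Freq n → Fin d → ℂ}
    {N₀ κp κm : ℝ} (hN₀ : 0 < N₀) (hNN : N₀ ≤ N)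
    (hlam : ZSymb N 1 0 (fun p => lamDiag lam p.1 p.2))
    (h2 : SubprincipalBounds N₀ A Ahom lam M F₀ κp κm)
    (hF : ZSymb N 0 1 (fun p => F p.1 p.2))
    (hsub : ZSymb N (-1) 2 (fun p => F p.1 p.2 - F₀ p.1 p.2)) :
    ∃ C, 0 ≤ C ∧ PhaseBounds N lam F κp κm C := by
  have hN : 0 < N := hN₀.trans_le hNN
  obtain ⟨Cp, Cm, hb⟩ := h2.bounds
  obtain ⟨C, hC, hCb⟩ := (hsub 0).bound
  refine ⟨|Cp| + |Cm| + C / N, by positivity, fun ξ hξ s t hs hst j => ?_⟩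
  have hξ0 : 0 < ‖ξ‖ := norm_pos_iff.2 hξ
  have hs0 : 0 ≤ s := tBdry_nonneg.trans hs
  have hslice : ∀ {V : Type} [NormedAddCommGroup V] [NormedSpace ℝ V] {g : ℝ × Freq n → V},
      ContDiffOn ℝ ∞ g (hypZone n N) → ContinuousOn (fun τ => g (τ, ξ)) (Ici s) := fun hg =>
    hg.continuousOn.comp (f := fun τ => (τ, ξ)) (by fun_prop)
      fun τ hτ => (mem_hypZone_iff hξ).2 (hs.trans hτ)
  have c1 : ContinuousOn (fun τ => F τ ξ j) (Ici s) :=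
    (continuous_apply j).comp_continuousOn (hslice hF.contDiffOn)
  have c2 : ContinuousOn (fun τ => F τ ξ j - F₀ τ ξ j) (Ici s) :=
    (continuous_apply j).comp_continuousOn (hslice hsub.contDiffOn)
  have c0 : ContinuousOn (fun τ => F₀ τ ξ j) (Ici s) := (c1.sub c2).congr fun τ _ => by
    simp
  have c3 : ContinuousOn (fun τ => (lam j τ ξ : ℂ)) (Ici s) :=
    (hslice (hlam.entry hN j j).contDiffOn).congr fun τ _ => by simp [lamDiag]
  have ii : ∀ {g : ℝ → ℂ}, ContinuousOn g (Ici s) →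
      IntervalIntegrable g MeasureTheory.volume s t := fun hg =>
    (hg.mono (by rw [uIcc_of_le hst]; exact Icc_subset_Ici_self)).intervalIntegrable
  have e1 : phase lam F t s ξ j = (∫ τ in s..t, (lam j τ ξ : ℂ)) +
      ((∫ τ in s..t, F₀ τ ξ j) + ∫ τ in s..t, (F τ ξ j - F₀ τ ξ j)) := by
    have c4 : ContinuousOn (fun τ => F₀ τ ξ j + (F τ ξ j - F₀ τ ξ j)) (Ici s) := c0.add c2
    rw [← intervalIntegral.integral_add (ii c0) (ii c2),
      ← intervalIntegral.integral_add (ii c3) (ii c4)]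
    refine intervalIntegral.integral_congr fun τ _ => ?_
    simp
  have e2 : (∫ τ in s..t, (lam j τ ξ : ℂ)).im = 0 := by
    rw [intervalIntegral.integral_ofReal, Complex.ofReal_im]
  have e3 : ‖∫ τ in s..t, (F τ ξ j - F₀ τ ξ j)‖ ≤ C / N := by
    have h3 := norm_integral_le_of_decay (c := C * ‖ξ‖⁻¹) hs0 hst (by positivity) c2
      fun τ hτ => by
        have h4 := hCb (τ, ξ) ((mem_hypZone_iff hξ).2 (hs.trans hτ))
        have h5 : (F τ ξ j - F₀ τ ξ j) = (F τ ξ - F₀ τ ξ) j := rfl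
        rw [h5]
        refine (norm_le_pi_norm _ j).trans (h4.trans (le_of_eq ?_))
        simp only [symWeight, Real.rpow_neg_one]
        have : (1 / (1 + τ)) ^ (2 : ℝ) = 1 / (1 + τ) ^ 2 := by
          rw [show (2 : ℝ) = ((2 : ℕ) : ℝ) by norm_num, Real.rpow_natCast, one_div_pow]
        rw [this, mul_assoc]
    refine h3.trans ?_
    rw [mul_assoc, ← mul_inv, div_eq_mul_inv]
    refine mul_le_mul_of_nonneg_left (inv_anti₀ hN ?_) hC
    rw [mul_comm]
    exact one_add_mul_norm_ge hξ hs
  have e4 := (Complex.abs_im_le_norm _).trans e3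
  obtain ⟨b1, b2⟩ := hb ξ hξ s t ((tBdry_mono hNN ξ).trans hs) hst j
  rw [e1, Complex.add_im, Complex.add_im, e2]
  have := abs_le.1 e4
  have := neg_abs_le Cp
  have := le_abs_self Cm
  have := abs_nonneg Cp
  have := abs_nonneg Cm
  constructor <;> linarith

theorem SubprincipalBounds.le {A Ahom M : MatField n d} {F₀ : ℝ → Freq n → Fin d → ℂ}
    {κp κm : ℝ} (hn : 1 ≤ n) (hd : 1 ≤ d)
    (h2 : SubprincipalBounds N A Ahom lam M F₀ κp κm) : κp ≤ κm := by
  obtain ⟨Cp, Cm, hb⟩ := h2.bounds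
  by_contra! hlt
  set ξ : Freq n := EuclideanSpace.single ⟨0, hn⟩ 1
  have hξ : ξ ≠ 0 := by
    rw [← norm_ne_zero_iff]; simp [ξ]
  set s := tBdry N ξ
  have hs : 0 ≤ s := tBdry_nonneg
  set l := max ((Cm - Cp) / (κp - κm) + 1) 0
  have hl : 1 ≤ Real.exp l := Real.one_le_exp (le_max_right _ _)
  obtain ⟨b1, b2⟩ := hb ξ hξ s ((1 + s) * Real.exp l - 1) le_rfl (by nlinarith) ⟨0, hd⟩
  have e : (1 + ((1 + s) * Real.exp l - 1)) / (1 + s) = Real.exp l := by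
    field_simp; ring
  rw [e, Real.log_exp] at b1 b2
  have h3 : (Cm - Cp) / (κp - κm) < l := (lt_add_one _).trans_le (le_max_left _ _)
  rw [div_lt_iff₀ (by linarith)] at h3
  linarith

section

variable {κp κm C : ℝ}

theorem exp_mul_log_sub {c x κ : ℝ} (hx : 0 < x) :
    Real.exp (κ * Real.log x + c) = Real.exp c * x ^ κ := by
  rw [Real.exp_add, Real.rpow_def_of_pos hx, mul_comm, mul_comm κ]

theorem ratio_pos {s t : ℝ} (hs : 0 ≤ s) (hst : s ≤ t) : 0 < (1 + t) / (1 + s) := by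
  have : 0 ≤ t := hs.trans hst
  positivity

theorem PhaseBounds.norm_diagExp_le (h : PhaseBounds N lam F κp κm C) {ξ : Freq n} (hξ : ξ ≠ 0)
    {s t : ℝ} (hs : tBdry N ξ ≤ s) (hst : s ≤ t) :
    ‖diagExp lam F t s ξ‖ ≤ Real.exp C * ((1 + t) / (1 + s)) ^ (-κp) := by
  have hr := ratio_pos (tBdry_nonneg.trans hs) hst
  rw [diagExp, Matrix.linfty_opNorm_diagonal]
  refine (pi_norm_le_iff_of_nonneg (by positivity)).2 fun j => ?_
  change ‖Complex.exp (Complex.I * phase lam F t s ξ j)‖ ≤ _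
  rw [Complex.norm_exp, ← exp_mul_log_sub hr]
  refine Real.exp_le_exp.2 ?_
  have := (h ξ hξ s t hs hst j).1
  simp only [Complex.mul_re, Complex.I_re, Complex.I_im]
  linarith

theorem PhaseBounds.norm_exp_sub_le (h : PhaseBounds N lam F κp κm C) {ξ : Freq n} (hξ : ξ ≠ 0)
    {s t : ℝ} (hs : tBdry N ξ ≤ s) (hst : s ≤ t) (a b : Fin d) :
    ‖Complex.exp (Complex.I * (phase lam F t s ξ b - phase lam F t s ξ a))‖ ≤
      Real.exp (2 * C) * ((1 + t) / (1 + s)) ^ (κm - κp) := by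
  have hr := ratio_pos (tBdry_nonneg.trans hs) hst
  rw [Complex.norm_exp, ← exp_mul_log_sub hr]
  refine Real.exp_le_exp.2 ?_
  have := (h ξ hξ s t hs hst b).1
  have := (h ξ hξ s t hs hst a).2
  simp only [Complex.mul_re, Complex.I_re, Complex.I_im, Complex.sub_im, Complex.sub_re]
  linarith

/-- Decay of the conjugated remainder. -/
theorem PhaseBounds.norm_conjRemainder_le (hN : 0 < N) (h : PhaseBounds N lam F κp κm C) {k : ℕ}
    (hk : κm - κp + 1 < k)
    (hR : ZSymb N (-(k : ℝ)) ((k : ℝ) + 1) (fun p => R p.1 p.2)) :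
    ∃ c, 0 ≤ c ∧ ∀ ξ : Freq n, ξ ≠ 0 → ∀ s t : ℝ, tBdry N ξ ≤ s → s ≤ t →
      ‖conjRemainder lam F R t s ξ‖ ≤ c * (1 + s) * (1 / (1 + t) ^ 2) := by
  obtain ⟨c, hc, hb⟩ := (hR 0).bound
  refine ⟨d * d * (c * Real.exp (2 * C) * N ^ (-(k : ℝ))), by positivity,
    fun ξ hξ s t hs hst => ?_⟩
  have hs0 : 0 ≤ s := tBdry_nonneg.trans hs
  have ht0 : 0 ≤ t := hs0.trans hst
  have hξ0 : 0 < ‖ξ‖ := norm_pos_iff.2 hξ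
  have hr := ratio_pos hs0 hst
  have hr1 : 1 ≤ (1 + t) / (1 + s) := by rw [one_le_div (by positivity)]; linarith
  have hent : ∀ a b, ‖conjRemainder lam F R t s ξ a b‖ ≤
      c * Real.exp (2 * C) * N ^ (-(k : ℝ)) * (1 + s) * (1 / (1 + t) ^ 2) := fun a b => by
    have h1 := hb (t, ξ) ((mem_hypZone_iff hξ).2 (hs.trans hst))
    have h2 := h.norm_exp_sub_le hξ hs hst a b
    simp only [conjRemainder, Matrix.of_apply, norm_mul]
    have h3 : symWeight n (-(k : ℝ)) ((k : ℝ) + 1) (t, ξ) * ((1 + t) / (1 + s)) ^ (κm - κp) ≤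
        N ^ (-(k : ℝ)) * ((1 + s) * (1 / (1 + t) ^ 2)) := by
      have h4 : ((1 + t) / (1 + s)) ^ (κm - κp) ≤ ((1 + t) / (1 + s)) ^ ((k : ℝ) - 1) :=
        Real.rpow_le_rpow_of_exponent_le hr1 (by linarith)
      have h5 : ((1 + s) * ‖ξ‖) ^ (-(k : ℝ)) ≤ N ^ (-(k : ℝ)) := by
        rw [Real.rpow_neg (by positivity), Real.rpow_neg hN.le]
        exact inv_anti₀ (by positivity) (Real.rpow_le_rpow hN.le (one_add_mul_norm_ge hξ hs)
          (by positivity))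
      refine (mul_le_mul_of_nonneg_left h4 (by unfold symWeight; positivity)).trans
        (le_trans (le_of_eq ?_) (mul_le_mul_of_nonneg_right h5 (by positivity)))
      simp only [symWeight]
      have hS : (0 : ℝ) < 1 + s := by positivity
      have hT : (0 : ℝ) < 1 + t := by positivity
      rw [Real.div_rpow hT.le hS.le, Real.div_rpow zero_le_one hT.le, Real.one_rpow,
        Real.mul_rpow hS.le hξ0.le, Real.rpow_sub_one hT.ne', Real.rpow_sub_one hS.ne',
        Real.rpow_add_one hT.ne', Real.rpow_neg hS.le]
      have h6 : (0 : ℝ) < (1 + t) ^ (k : ℝ) := by positivity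
      have h7 : (0 : ℝ) < (1 + s) ^ (k : ℝ) := by positivity
      field_simp
    calc _ ≤ (c * symWeight n (-(k : ℝ)) ((k : ℝ) + 1) (t, ξ)) *
          (Real.exp (2 * C) * ((1 + t) / (1 + s)) ^ (κm - κp)) :=
          mul_le_mul ((norm_entry_le _ a b).trans h1) h2 (norm_nonneg _)
            ((norm_nonneg _).trans h1)
      _ = c * Real.exp (2 * C) * (symWeight n (-(k : ℝ)) ((k : ℝ) + 1) (t, ξ) *
          ((1 + t) / (1 + s)) ^ (κm - κp)) := by ring
      _ ≤ c * Real.exp (2 * C) * (N ^ (-(k : ℝ)) * ((1 + s) * (1 / (1 + t) ^ 2))) :=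
          mul_le_mul_of_nonneg_left h3 (by positivity)
      _ = _ := by ring
  refine (norm_matrix_le_sum _).trans ((Finset.sum_le_sum fun a _ => Finset.sum_le_sum
    fun b _ => hent a b).trans (le_of_eq ?_))
  simp only [Finset.sum_const, Finset.card_univ, Fintype.card_fin, nsmul_eq_mul]
  ring

end

end Bounds
end

noncomputable section

section Fundamental

open Set

variable {n d : ℕ} {A Ahom M T : MatField n d} {lam : Fin d → ℝ → Freq n → ℝ}
  {F : ℝ → Freq n → Fin d → ℂ} {R : MatField n d} {F₀ : ℝ → Freq n → Fin d → ℂ}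
  {N₀ N κp κm : ℝ}

theorem Dt_inv_eq (hN : 0 < N) (hM : ZSymb N 0 0 (fun p => M p.1 p.2))
    (hMi : ZSymb N 0 0 (fun p => (M p.1 p.2)⁻¹)) (hu : ∀ p ∈ hypZone n N, IsUnit (M p.1 p.2))
    {p : ℝ × Freq n} (hp : p ∈ hypZone n N) :
    M p.1 p.2 * Dt N (fun t ξ => (M t ξ)⁻¹) p.1 p.2 * M p.1 p.2 = -Dt N M p.1 p.2 := by
  have hinv : ∀ p ∈ hypZone n N, M p.1 p.2 * (M p.1 p.2)⁻¹ = 1 := fun p hp =>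
    Matrix.mul_nonsing_inv _ ((Matrix.isUnit_iff_isUnit_det _).1 (hu p hp))
  have h1 := ZSymb.Dt_mul (T' := fun t ξ => (M t ξ)⁻¹) hN hM.contDiffOn hMi.contDiffOn hp
  have h2 : Dt N (fun t ξ => M t ξ * (M t ξ)⁻¹) p.1 p.2 = 0 := by
    rw [ZSymb.Dt_eq (hM.mul hN hMi).contDiffOn hN hp,
      coordDeriv_congr (h := fun _ => (1 : Matrix (Fin d) (Fin d) ℂ)) (fun q hq => hinv q hq) none hp,
      coordDeriv_eq (hypZone_symDomain hN) hp
        ((hasFDerivAt_const (1 : Matrix (Fin d) (Fin d) ℂ) p).hasFDerivWithinAt) none]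
    exact smul_zero _
  rw [h2] at h1
  have h3 : M p.1 p.2 * Dt N (fun t ξ => (M t ξ)⁻¹) p.1 p.2 =
      -(Dt N M p.1 p.2 * (M p.1 p.2)⁻¹) := (neg_eq_of_add_eq_zero_right h1.symm).symm
  rw [h3, neg_mul, mul_assoc,
    Matrix.nonsing_inv_mul _ ((Matrix.isUnit_iff_isUnit_det _).1 (hu p hp)), mul_one]

/-- `(D_t - A) (M T) = M T (D_t - D - diag F - R)`. -/
theorem SubprincipalBounds.intertwine_mul (hN₀ : 0 < N₀) (hNN : N₀ ≤ N)
    (h2 : SubprincipalBounds N₀ A Ahom lam M F₀ κp κm) (hT : ZSymb N 0 0 (fun p => T p.1 p.2))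
    (hI : ∀ t ξ, (t, ξ) ∈ hypZone n N →
      Dt N T t ξ - (lamDiag lam t ξ + remainderZero N₀ A Ahom M t ξ) * T t ξ =
        -(T t ξ * (lamDiag lam t ξ + Matrix.diagonal (F t ξ) + R t ξ)))
    {p : ℝ × Freq n} (hp : p ∈ hypZone n N) :
    Dt N (fun t ξ => M t ξ * T t ξ) p.1 p.2 - A p.1 p.2 * (M p.1 p.2 * T p.1 p.2) =
      -(M p.1 p.2 * T p.1 p.2 *
        (lamDiag lam p.1 p.2 + Matrix.diagonal (F p.1 p.2) + R p.1 p.2)) := by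
  have hN : 0 < N := hN₀.trans_le hNN
  have hM := (isSymbolOn_iff_zSymb hN₀).1 h2.symb
  have hMi := (isSymbolOn_iff_zSymb hN₀).1 h2.symb_inv
  have hp₀ := hypZone_subset hNN hp
  have hu : ∀ p ∈ hypZone n N, IsUnit (M p.1 p.2) := fun p hp =>
    h2.unit p.1 p.2 (hypZone_subset hNN hp)
  have hdet := (Matrix.isUnit_iff_isUnit_det _).1 (hu p hp)
  have hMM := Matrix.mul_nonsing_inv _ hdet
  have e1 := Dt_inv_eq hN (hM.mono hN₀ hNN) (hMi.mono hN₀ hNN) hu hp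
  have e2 := ZSymb.Dt_mono (T := fun t ξ => (M t ξ)⁻¹) hN₀ hNN hMi.contDiffOn hp
  have e3 := h2.diagonalises p.1 p.2 hp₀
  have e4 := hI p.1 p.2 hp
  rw [ZSymb.Dt_mul hN (hM.mono hN₀ hNN).contDiffOn hT.contDiffOn hp]
  simp only [remainderZero] at e4
  rw [e2] at e1
  generalize Dt N T p.1 p.2 = T' at *
  generalize Dt N M p.1 p.2 = M' at *
  generalize Dt N₀ (fun τ η => (M τ η)⁻¹) p.1 p.2 = W at *
  generalize M p.1 p.2 = m at *
  generalize T p.1 p.2 = τ at *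
  generalize A p.1 p.2 = a at *
  generalize Ahom p.1 p.2 = ah at *
  generalize lamDiag lam p.1 p.2 = L at *
  generalize L + Matrix.diagonal (F p.1 p.2) + R p.1 p.2 = Y at *
  have e5 : T' = (L + (m⁻¹ * (a - ah) * m + W * m)) * τ - τ * Y := by
    rw [sub_eq_iff_eq_add] at e4; rw [e4]; abel
  have e6 : m * L = ah * m := by
    rw [← e3, ← mul_assoc, ← mul_assoc, hMM, one_mul]
  have e7 : m * (m⁻¹ * (a - ah) * m) = (a - ah) * m := by
    rw [← mul_assoc, ← mul_assoc, hMM, one_mul]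
  have e8 : m * T' = (m * L + (m * (m⁻¹ * (a - ah) * m) + m * W * m)) * τ - m * (τ * Y) := by
    rw [e5]; simp only [mul_sub, mul_add, add_mul, mul_assoc]
  rw [e8, e6, e7, e1]
  noncomm_ring

theorem continuousOn_coefficient (hN₀ : 0 < N₀) (hNN : N₀ ≤ N)
    (h1 : UniformlyStrictlyHyperbolic N₀ A Ahom lam) {ξ : Freq n} (hξ : ξ ≠ 0) :
    ContinuousOn (fun t => A t ξ) (Ici (tBdry N ξ)) := by
  have hA := (isSymbolOn_iff_zSymb hN₀).1 h1.symb
  have hA' := (isSymbolOn_iff_zSymb hN₀).1 h1.symb_sub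
  have h3 : ContinuousOn (fun p : ℝ × Freq n => A p.1 p.2) (hypZone n N₀) :=
    (hA'.contDiffOn.continuousOn.add hA.contDiffOn.continuousOn).congr fun p _ => by
      simp
  exact h3.comp (f := fun τ => (τ, ξ)) (by fun_prop)
    fun τ hτ => (mem_hypZone_iff hξ).2 ((tBdry_mono hNN ξ).trans hτ)

theorem exists_isFundamentalSolution (hA : ∀ ξ : Freq n, ξ ≠ 0 →
    ContinuousOn (fun t => A t ξ) (Ici (tBdry N ξ))) :
    ∃ E, IsFundamentalSolution N A E := by
  have h : ∀ ξ : Freq n, ∃ Y : (ℝ → Matrix (Fin d) (Fin d) ℂ) × (ℝ → Matrix (Fin d) (Fin d) ℂ),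
      ξ ≠ 0 → (∀ t ∈ Ici (tBdry N ξ), HasDerivWithinAt Y.1 (Complex.I • A t ξ * Y.1 t)
        (Ici (tBdry N ξ)) t) ∧ ∀ t ∈ Ici (tBdry N ξ), Y.2 t * Y.1 t = 1 := by
    intro ξ
    by_cases hξ : ξ = 0
    · exact ⟨0, fun h => absurd hξ h⟩
    · obtain ⟨Y, -, -, h1, -, h2⟩ := exists_fundamental_pair
        (B := fun t => Complex.I • A t ξ) ((hA ξ hξ).const_smul Complex.I)
      exact ⟨Y, fun _ => ⟨h1, h2⟩⟩
  choose Y hY using h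
  refine ⟨fun t s ξ => (Y ξ).1 t * (Y ξ).2 s, fun ξ hξ s hs => ?_, fun ξ hξ s t hs ht => ?_⟩
  · exact mul_eq_one_comm.1 ((hY ξ hξ).2 s hs)
  · refine (((hY ξ hξ).1 t ht).mul_const ((Y ξ).2 s)).congr_deriv ?_
    rw [smul_mul_assoc, smul_mul_assoc, mul_assoc]

/-- The flow `Q` of `D_t Q = conjRemainder Q`, together with its inverse `Z`. -/
structure IsConjFlow (N : ℝ) (lam : Fin d → ℝ → Freq n → ℝ) (F : ℝ → Freq n → Fin d → ℂ)
    (R : MatField n d) (Q Z : ℝ → ℝ → Freq n → Matrix (Fin d) (Fin d) ℂ) : Prop where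
  init : ∀ ξ : Freq n, ξ ≠ 0 → ∀ s, tBdry N ξ ≤ s → Q s s ξ = 1
  init_inv : ∀ ξ : Freq n, ξ ≠ 0 → ∀ s, tBdry N ξ ≤ s → Z s s ξ = 1
  deriv : ∀ ξ : Freq n, ξ ≠ 0 → ∀ s, tBdry N ξ ≤ s → ∀ t ∈ Ici s,
    HasDerivWithinAt (fun τ => Q τ s ξ)
      (Complex.I • conjRemainder lam F R t s ξ * Q t s ξ) (Ici s) t
  deriv_inv : ∀ ξ : Freq n, ξ ≠ 0 → ∀ s, tBdry N ξ ≤ s → ∀ t ∈ Ici s,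
    HasDerivWithinAt (fun τ => Z τ s ξ)
      (-(Z t s ξ * (Complex.I • conjRemainder lam F R t s ξ))) (Ici s) t
  inv : ∀ ξ : Freq n, ξ ≠ 0 → ∀ s, tBdry N ξ ≤ s → ∀ t ∈ Ici s, Z t s ξ * Q t s ξ = 1

theorem exists_isConjFlow (hB : ∀ ξ : Freq n, ξ ≠ 0 → ∀ s, tBdry N ξ ≤ s →
    ContinuousOn (fun t => conjRemainder lam F R t s ξ) (Ici s)) :
    ∃ Q Z, IsConjFlow N lam F R Q Z := by
  have h : ∀ (ξ : Freq n) (s : ℝ), ∃ Y : (ℝ → Matrix (Fin d) (Fin d) ℂ) ×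
      (ℝ → Matrix (Fin d) (Fin d) ℂ), ξ ≠ 0 → tBdry N ξ ≤ s → Y.1 s = 1 ∧ Y.2 s = 1 ∧
      (∀ t ∈ Ici s, HasDerivWithinAt Y.1
        (Complex.I • conjRemainder lam F R t s ξ * Y.1 t) (Ici s) t) ∧
      (∀ t ∈ Ici s, HasDerivWithinAt Y.2
        (-(Y.2 t * (Complex.I • conjRemainder lam F R t s ξ))) (Ici s) t) ∧
      ∀ t ∈ Ici s, Y.2 t * Y.1 t = 1 := by
    intro ξ s
    by_cases hξ : ξ ≠ 0 ∧ tBdry N ξ ≤ s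
    · obtain ⟨Y, hY⟩ := exists_fundamental_pair
        (B := fun t => Complex.I • conjRemainder lam F R t s ξ)
        ((hB ξ hξ.1 s hξ.2).const_smul Complex.I)
      exact ⟨Y, fun _ _ => hY⟩
    · exact ⟨0, fun h h' => absurd ⟨h, h'⟩ hξ⟩
  choose Y hY using h
  exact ⟨fun t s ξ => (Y ξ s).1 t, fun t s ξ => (Y ξ s).2 t,
    fun ξ hξ s hs => (hY ξ s hξ hs).1, fun ξ hξ s hs => (hY ξ s hξ hs).2.1,
    fun ξ hξ s hs => (hY ξ s hξ hs).2.2.1, fun ξ hξ s hs => (hY ξ s hξ hs).2.2.2.1,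
    fun ξ hξ s hs => (hY ξ s hξ hs).2.2.2.2⟩

variable {Q Z : ℝ → ℝ → Freq n → Matrix (Fin d) (Fin d) ℂ}

theorem IsConjFlow.exists_bound (hQ : IsConjFlow N lam F R Q Z) {c : ℝ} (hc : 0 ≤ c)
    (hb : ∀ ξ : Freq n, ξ ≠ 0 → ∀ s t : ℝ, tBdry N ξ ≤ s → s ≤ t →
      ‖conjRemainder lam F R t s ξ‖ ≤ c * (1 + s) * (1 / (1 + t) ^ 2)) :
    ∃ C : ℝ, ∀ ξ : Freq n, ξ ≠ 0 → ∀ s t : ℝ, tBdry N ξ ≤ s → s ≤ t →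
      ‖Q t s ξ‖ ≤ C ∧ IsUnit (Q t s ξ) ∧ ‖(Q t s ξ)⁻¹‖ ≤ C := by
  refine ⟨‖(1 : Matrix (Fin d) (Fin d) ℂ)‖ * Real.exp c, fun ξ hξ s t hs hst => ?_⟩
  have hs0 : 0 ≤ s := tBdry_nonneg.trans hs
  have hcs : c * (1 + s) * (1 + s)⁻¹ = c := by field_simp
  have h1 := norm_le_of_deriv_decay (c := c * (1 + s)) (e := 0) hs0 hst (by positivity) le_rfl
    (hQ.deriv ξ hξ s hs) fun τ hτ => by
      rw [zero_mul, add_zero]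
      refine (norm_mul_le _ _).trans (mul_le_mul_of_nonneg_right ?_ (norm_nonneg _))
      rw [norm_smul, Complex.norm_I, one_mul]
      exact hb ξ hξ s τ hs hτ
  have h2 := norm_le_of_deriv_decay (c := c * (1 + s)) (e := 0) hs0 hst (by positivity) le_rfl
    (hQ.deriv_inv ξ hξ s hs) fun τ hτ => by
      rw [zero_mul, add_zero, norm_neg, mul_comm]
      refine (norm_mul_le _ _).trans (mul_le_mul_of_nonneg_left ?_ (norm_nonneg _))
      rw [norm_smul, Complex.norm_I, one_mul]
      exact hb ξ hξ s τ hs hτ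
  have h3 := hQ.inv ξ hξ s hs t hst
  rw [hQ.init ξ hξ s hs, zero_mul, add_zero, hcs] at h1
  rw [hQ.init_inv ξ hξ s hs, zero_mul, add_zero, hcs] at h2
  refine ⟨h1, IsUnit.of_mul_eq_one _ (mul_eq_one_comm.1 h3), ?_⟩
  rwa [Matrix.inv_eq_left_inv h3]

theorem IsFundamentalSolution.eq_mul {E : ℝ → ℝ → Freq n → Matrix (Fin d) (Fin d) ℂ}
    (hE : IsFundamentalSolution N A E) (hN : 0 < N)
    (hA : ∀ ξ : Freq n, ξ ≠ 0 → ContinuousOn (fun t => A t ξ) (Ici (tBdry N ξ)))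
    {P : MatField n d} (hP : ContDiffOn ℝ ∞ (fun p : ℝ × Freq n => P p.1 p.2) (hypZone n N))
    (hu : ∀ p ∈ hypZone n N, IsUnit (P p.1 p.2))
    (hI : ∀ p ∈ hypZone n N, Dt N P p.1 p.2 - A p.1 p.2 * P p.1 p.2 =
      -(P p.1 p.2 * (lamDiag lam p.1 p.2 + Matrix.diagonal (F p.1 p.2) + R p.1 p.2)))
    (hlam : ZSymb N 1 0 (fun p => lamDiag lam p.1 p.2)) (hF : ZSymb N 0 1 (fun p => F p.1 p.2))
    (hQ : IsConjFlow N lam F R Q Z) {ξ : Freq n} (hξ : ξ ≠ 0) {s t : ℝ} (hs : tBdry N ξ ≤ s)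
    (hst : s ≤ t) :
    E t s ξ = P t ξ * diagExp lam F t s ξ * Q t s ξ * (P s ξ)⁻¹ := by
  have hmem : ∀ τ ∈ Ici s, (τ, ξ) ∈ hypZone n N := fun τ hτ =>
    (mem_hypZone_iff hξ).2 (hs.trans hτ)
  refine eq_of_linearODE (B := fun t => Complex.I • A t ξ) (y := fun t => E t s ξ)
    (y' := fun t => P t ξ * diagExp lam F t s ξ * Q t s ξ * (P s ξ)⁻¹)
    (((hA ξ hξ).mono (Ici_subset_Ici.2 hs)).const_smul Complex.I) (fun τ hτ => ?_)
    (fun τ hτ => ?_) ?_ (mem_Ici.2 hst)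
  · refine ((hE.deriv ξ hξ s τ hs (hs.trans hτ)).mono (Ici_subset_Ici.2 hs)).congr_deriv ?_
    rw [smul_mul_assoc]
  · have hp := hmem τ hτ
    have hP' := (ZSymb.hasDerivWithinAt_of_contDiffOn hP hξ (hs.trans hτ)).mono
      (Ici_subset_Ici.2 hs)
    have hD := ZSymb.Dt_eq hP hN hp
    have h1 := hI (τ, ξ) hp
    refine (((hP'.mul (hasDerivWithinAt_diagExp hlam hN hF hξ hs hτ)).mul
      (hQ.deriv ξ hξ s hs τ hτ)).mul_const ((P s ξ)⁻¹)).congr_deriv ?_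
    have hc : coordDeriv (hypZone n N) none (fun p : ℝ × Freq n => P p.1 p.2) (τ, ξ) =
        Complex.I • Dt N P τ ξ := by
      rw [hD, smul_smul]; simp
    have hX := diagExp_mul_conjRemainder (lam := lam) (F := F) (R := R) τ s ξ
    simp only [] at h1
    rw [sub_eq_iff_eq_add] at h1
    rw [hc, h1, Pi.mul_apply]
    generalize conjRemainder lam F R τ s ξ = X at *
    generalize diagExp lam F τ s ξ = W at *
    generalize Q τ s ξ = q at *
    generalize P τ ξ = m at *
    have h3 : m * W * (X * q) = m * (R τ ξ * W) * q := by rw [← hX]; simp only [mul_assoc]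
    simp only [smul_mul_assoc, mul_smul_comm, h3, ← smul_add]
    congr 1
    noncomm_ring
  · have hdet := (Matrix.isUnit_iff_isUnit_det _).1 (hu (s, ξ) (hmem s (mem_Ici.2 le_rfl)))
    simp only [hE.init ξ hξ s hs, diagExp_self, hQ.init ξ hξ s hs, mul_one]
    exact (Matrix.mul_nonsing_inv _ hdet).symm

end Fundamental
end

noncomputable section

section FrequencyEstimates

open Set

variable {n d : ℕ}

theorem SymOrd.smul {S : Set (ℝ × Freq n)} {V : Type*} [NormedAddCommGroup V] [NormedSpace ℝ V]
    {r : ℕ} {w₁ w₂ : ℝ × Freq n → ℝ} {a : ℝ × Freq n → ℝ} {g : ℝ × Freq n → V} (hS : SymDomain S)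
    (ha : SymOrd S r w₁ a) (hg : SymOrd S r w₂ g) :
    SymOrd S r (fun p => w₁ p * w₂ p) (fun p => a p • g p) :=
  SymOrd.bilin hS (ContinuousLinearMap.lsmul ℝ ℝ) ha hg

theorem SymOrd.of_entries {S : Set (ℝ × Freq n)} (hS : SymDomain S) {r : ℕ} {w : ℝ × Freq n → ℝ}
    {B : ℝ × Freq n → Matrix (Fin d) (Fin d) ℂ}
    (hB : ∀ a b, SymOrd S r w (fun p => B p a b)) : SymOrd S r w B := by
  refine (SymOrd.sum hS Finset.univ fun a _ => SymOrd.sum hS Finset.univ fun b _ =>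
    (hB a b).clm hS (ZSymb.singleCLM d a b)).congr fun p _ => ?_
  exact Matrix.matrix_eq_sum_single (B p)

/-- An open set of frequencies on which `1 + t_ξ` is a symbol. -/
structure IsChart (N : ℝ) (U : Set (Freq n)) : Prop where
  isOpen : IsOpen U
  ne_zero : ∀ ξ ∈ U, ξ ≠ 0
  symb : ∀ {S : Set (ℝ × Freq n)}, SymDomain S → S ⊆ univ ×ˢ U → ∀ r,
    SymOrd S r (fun p => 1 + tBdry N p.2) (fun p => 1 + tBdry N p.2)

theorem isChart_high {N : ℝ} (hN : 0 < N) : IsChart N {ξ : Freq n | N < ‖ξ‖} where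
  isOpen := isOpen_lt continuous_const continuous_norm
  ne_zero := fun ξ hξ => norm_pos_iff.1 (hN.trans hξ)
  symb := fun {S} hS hSU r => by
    have h : ∀ p ∈ S, 1 + tBdry N p.2 = 1 := fun p hp => by
      have h1 : N < ‖p.2‖ := (hSU hp).2
      rw [tBdry, max_eq_right, add_zero]
      rw [sub_nonpos, div_le_one (hN.trans h1)]
      exact h1.le
    exact ((SymOrd.const (1 : ℝ)).congr fun p hp => h p hp).weight_congr hS
      fun p hp => (h p hp).symm

theorem isChart_low {N : ℝ} (hN : 0 < N) : IsChart N {ξ : Freq n | ξ ≠ 0 ∧ ‖ξ‖ < N} where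
  isOpen := isOpen_ne.inter (isOpen_lt continuous_norm continuous_const)
  ne_zero := fun ξ hξ => hξ.1
  symb := fun {S} hS hSU r => by
    have h : ∀ p ∈ S, 1 + tBdry N p.2 = N • (1 / ‖p.2‖) := fun p hp => by
      have h1 := (hSU hp).2
      have h0 : 0 < ‖p.2‖ := norm_pos_iff.2 h1.1
      rw [tBdry, max_eq_left, smul_eq_mul]
      · ring
      · rw [sub_nonneg, one_le_div h0]; exact h1.2.le
    refine (((symOrd_norm_freq hS r).2.clm hS (N • ContinuousLinearMap.id ℝ ℝ)).congr
      fun p hp => h p hp).mono_weight hS (c := 1 / N) (by positivity) fun p hp => ?_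
    rw [h p hp, smul_eq_mul]
    field_simp
    exact le_rfl

variable {N : ℝ} {U : Set (Freq n)}

theorem one_add_tBdry_pos (ξ : Freq n) : 0 < 1 + tBdry N ξ := by
  have : 0 ≤ tBdry N ξ := tBdry_nonneg
  positivity

/-- `1 + t` in terms of the rescaled time `θ`, `1 + t = (1 + θ)(1 + t_ξ)`. -/
def stretch (N : ℝ) (p : ℝ × Freq n) : ℝ := (1 + p.1) * (1 + tBdry N p.2)

/-- `1 + θ` in terms of the time `t`. -/
def shrink (N : ℝ) (p : ℝ × Freq n) : ℝ := (1 + p.1) * (1 / (1 + tBdry N p.2))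

theorem IsChart.symOrd_stretch (hU : IsChart N U) (r : ℕ) :
    SymOrd (Ici 0 ×ˢ U) r (stretch N) (stretch N) := by
  have hS := cylinder_symDomain hU.isOpen hU.ne_zero
  exact (symOrd_one_add_time hS r).mul hS
    (hU.symb hS (fun p hp => ⟨mem_univ _, hp.2⟩) r)

theorem IsChart.symOrd_shrink (hU : IsChart N U) {S : Set (ℝ × Freq n)} (hS : SymDomain S)
    (hSU : S ⊆ univ ×ˢ U) (r : ℕ) : SymOrd S r (shrink N) (shrink N) := by
  have h1 := (hU.symb hS hSU r).ringInverse hS (fun p _ => one_add_tBdry_pos p.2)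
    (fun p _ => (one_add_tBdry_pos p.2).ne'.isUnit) (C := 1) zero_le_one
    (fun p _ => by
      rw [Ring.inverse_eq_inv', norm_inv, Real.norm_of_nonneg (one_add_tBdry_pos p.2).le, one_div])
  refine (symOrd_one_add_time hS r).mul hS (h1.congr fun p _ => ?_)
  rw [Ring.inverse_eq_inv', one_div]

theorem stretch_ge (θ : ℝ) (hθ : 0 ≤ θ) (ξ : Freq n) : tBdry N ξ ≤ stretch N (θ, ξ) - 1 := by
  have := one_add_tBdry_pos (N := N) ξ
  simp only [stretch]
  nlinarith

theorem timeChange_stretch_mem {p : ℝ × Freq n} (hp : 0 ≤ p.1) (hp2 : p.2 ≠ 0) :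
    timeChange (stretch N) p ∈ hypZone n N :=
  (mem_hypZone_iff hp2).2 (stretch_ge p.1 hp p.2)

theorem IsChart.mapsTo_stretch (hU : IsChart N U) :
    MapsTo (timeChange (stretch N)) (Ici 0 ×ˢ U) (hypZone n N) := fun _ hp =>
  timeChange_stretch_mem hp.1 (hU.ne_zero _ hp.2)

theorem stretch_shrink {t : ℝ} {ξ : Freq n} :
    stretch N (timeChange (shrink N) (t, ξ)) = 1 + t := by
  have := one_add_tBdry_pos (N := N) ξ
  simp only [stretch, timeChange, shrink]
  field_simp
  ring

theorem hasDerivAt_stretch (θ : ℝ) (ξ : Freq n) :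
    HasDerivAt (fun τ => stretch N (τ, ξ) - 1) (1 + tBdry N ξ) θ := by
  have h1 : HasDerivAt (fun t : ℝ => 1 + t) 1 θ := (hasDerivAt_id θ).const_add 1
  simpa [stretch] using! (h1.mul_const (1 + tBdry N ξ)).sub_const 1

theorem hasDerivWithinAt_comp_stretch {V : Type*} [NormedAddCommGroup V] [NormedSpace ℝ V]
    {y : ℝ → V} {y' : V} {θ : ℝ} {ξ : Freq n}
    (hy : HasDerivWithinAt y y' (Ici (tBdry N ξ)) (stretch N (θ, ξ) - 1)) :
    HasDerivWithinAt (fun τ => y (stretch N (τ, ξ) - 1)) ((1 + tBdry N ξ) • y') (Ici 0) θ :=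
  HasDerivWithinAt.scomp θ hy (hasDerivAt_stretch θ ξ).hasDerivWithinAt
    fun τ hτ => stretch_ge τ hτ ξ

variable {lam : Fin d → ℝ → Freq n → ℝ} {F : ℝ → Freq n → Fin d → ℂ} {R : MatField n d}
  {κp κm : ℝ}

theorem IsChart.symOrd_phase (hU : IsChart N U) (hN : 0 < N)
    (hlam : ZSymb N 1 0 (fun p => lamDiag lam p.1 p.2)) (hF : ZSymb N 0 1 (fun p => F p.1 p.2))
    (r : ℕ) (j : Fin d) :
    SymOrd (Ici 0 ×ˢ U) r (fun p => ‖p.2‖ * (1 + tBdry N p.2) * (1 + p.1))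
      (fun p => phase lam F (stretch N p - 1) (tBdry N p.2) p.2 j) := by
  have hS := cylinder_symDomain hU.isOpen hU.ne_zero
  have hg : ZSymb N 1 0 (fun p : ℝ × Freq n => (lam j p.1 p.2 : ℂ) + F p.1 p.2 j) :=
    ((hlam.entry hN j j).congr fun p _ => by simp [lamDiag]).add hN
      ((hF.lower hN (l := 1) zero_le_one (by ring) (by ring)).clm hN
        (ContinuousLinearMap.proj (R := ℝ) (φ := fun _ : Fin d => ℂ) j))
  have hf := SymOrd.smul hS (hU.symb hS (fun p hp => ⟨mem_univ _, hp.2⟩) r)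
    (SymOrd.comp_timeChange (hypZone_symDomain hN) hS (hU.symOrd_stretch r) hU.mapsTo_stretch
      (hg r))
  refine IsAlgebraFlow.symOrd_primitive hU.isOpen hU.ne_zero
    (v := fun p => ‖p.2‖ * (1 + tBdry N p.2)) (fun _ _ _ => rfl)
    (fun ξ _ => mul_nonneg (norm_nonneg _) (one_add_tBdry_pos ξ).le)
    (hf.weight_congr hS fun p hp => ?_) ⟨fun ξ hξ => ?_, fun ξ hξ θ hθ => ?_⟩
  · simp [symWeight, timeChange, mul_comm]
  · simp [phase, stretch]
  · have hξ0 := hU.ne_zero ξ hξ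
    have h1 := hasDerivWithinAt_comp_stretch
      (hasDerivWithinAt_phase hlam hN hF hξ0 le_rfl (stretch_ge θ hθ ξ) j)
    refine h1.congr_deriv ?_
    simp [timeChange]

theorem IsChart.symOrd_conjRemainder (hU : IsChart N U) (hN : 0 < N)
    (hlam : ZSymb N 1 0 (fun p => lamDiag lam p.1 p.2)) (hF : ZSymb N 0 1 (fun p => F p.1 p.2))
    {C : ℝ} (hφ : PhaseBounds N lam F κp κm C) {k : ℕ}
    (hR : ZSymb N (-(k : ℝ)) ((k : ℝ) + 1) (fun p => R p.1 p.2)) {r : ℕ}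
    (hκ : κp ≤ κm) (hr : (r : ℝ) ≤ k - 1 + κp - κm) :
    SymOrd (Ici 0 ×ˢ U) r (fun p => 1 / (1 + p.1) ^ 2) (fun p => (1 + tBdry N p.2) •
      Complex.I • conjRemainder lam F R (stretch N p - 1) (tBdry N p.2) p.2) := by
  have hS := cylinder_symDomain hU.isOpen hU.ne_zero
  refine SymOrd.of_entries hS fun a b => ?_
  have hΦ := (hU.symOrd_phase hN hlam hF r b).sub hS (hU.symOrd_phase hN hlam hF r a)
  have hg := SymOrd.smul hS (hU.symb hS (fun p hp => ⟨mem_univ _, hp.2⟩) r)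
    (SymOrd.comp_timeChange (hypZone_symDomain hN) hS (hU.symOrd_stretch r) hU.mapsTo_stretch
      (((hR.entry hN a b).clm hN (ContinuousLinearMap.mul ℝ ℂ Complex.I)) r))
  have hX : ∀ p ∈ Ici (0 : ℝ) ×ˢ U, N ≤ ‖p.2‖ * (1 + tBdry N p.2) := fun p hp => by
    rw [mul_comm]; exact one_add_mul_norm_ge (hU.ne_zero _ hp.2) le_rfl
  have h := SymOrd.mul_cexp hS hΦ hN (fun p hp => ?_) (Real.exp_pos (2 * C)).le
    (ψ := fun p => (1 + p.1) ^ (κm - κp)) (fun p hp => ?_) (fun p hp => ?_) hg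
  · refine (h.congr fun p hp => ?_).mono_weight hS (c := N ^ ((r : ℝ) - k)) (by positivity)
      fun p hp => ?_
    · simp only [Matrix.smul_apply, conjRemainder, Matrix.of_apply, timeChange,
        ContinuousLinearMap.mul_apply', smul_eq_mul, Complex.real_smul]
      ring
    · have hθ : (0 : ℝ) ≤ p.1 := hp.1
      have hY : (0 : ℝ) < 1 + p.1 := by positivity
      have hW := one_add_tBdry_pos (N := N) p.2
      have hξ : 0 < ‖p.2‖ := norm_pos_iff.2 (hU.ne_zero _ hp.2)
      have hXp : 0 < ‖p.2‖ * (1 + tBdry N p.2) := by positivity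
      have e : (1 + tBdry N p.2) * symWeight n (-(k : ℝ)) ((k : ℝ) + 1)
            (timeChange (stretch N) p) * (1 + p.1) ^ (κm - κp) *
            (‖p.2‖ * (1 + tBdry N p.2) * (1 + p.1)) ^ r =
          (‖p.2‖ * (1 + tBdry N p.2)) ^ ((r : ℝ) - k) *
            (1 + p.1) ^ ((κm - κp) + r - (k + 1)) := by
        simp only [symWeight, timeChange, stretch, add_sub_cancel]
        generalize κm - κp = κ
        rw [← Real.rpow_natCast _ r, Real.mul_rpow hXp.le hY.le, Real.rpow_sub hXp,
          Real.rpow_sub hY, Real.rpow_add hY, one_div, Real.inv_rpow (by positivity),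
          Real.mul_rpow hY.le hW.le, Real.rpow_neg hξ.le, Real.rpow_add_one hW.ne',
          Real.mul_rpow hξ.le hW.le (z := (k : ℝ))]
        field_simp
      have hk : (r : ℝ) - k ≤ 0 := by linarith
      refine (le_of_eq e).trans (mul_le_mul (Real.rpow_le_rpow_of_nonpos hN (hX p hp) hk) ?_
        (by positivity) (by positivity))
      have : 1 / (1 + p.1) ^ 2 = (1 + p.1) ^ (-2 : ℝ) := by
        rw [Real.rpow_neg hY.le, one_div]
        norm_num
      rw [this]
      exact Real.rpow_le_rpow_of_exponent_le (by linarith) (by linarith)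
  · have hθ : (0 : ℝ) ≤ p.1 := hp.1
    have := hX p hp
    nlinarith
  · have hθ : (0 : ℝ) ≤ p.1 := hp.1
    have h1 := hφ.norm_exp_sub_le (hU.ne_zero _ hp.2) le_rfl (stretch_ge (N := N) p.1 hθ p.2) a b
    have h2 : (1 + (stretch N (p.1, p.2) - 1)) / (1 + tBdry N p.2) = 1 + p.1 := by
      have := one_add_tBdry_pos (N := N) p.2
      simp only [stretch]
      field_simp
      ring
    rwa [h2] at h1
  · have hq := hU.mapsTo_stretch hp
    exact mul_nonneg (one_add_tBdry_pos p.2).le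
      (symWeight_pos (hypZone_symDomain hN) hq _ _).le

variable {Q Z : ℝ → ℝ → Freq n → Matrix (Fin d) (Fin d) ℂ}

theorem IsConjFlow.isAlgebraFlow (hQ : IsConjFlow N lam F R Q Z) (hU : IsChart N U) :
    IsAlgebraFlow U (fun p => (1 + tBdry N p.2) • Complex.I •
      conjRemainder lam F R (stretch N p - 1) (tBdry N p.2) p.2) (fun _ => 0) 1
      (fun p => Q (stretch N p - 1) (tBdry N p.2) p.2) where
  init := fun ξ hξ => by
    simpa [stretch] using! hQ.init ξ (hU.ne_zero ξ hξ) _ le_rfl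
  deriv := fun ξ hξ θ hθ => by
    refine (hasDerivWithinAt_comp_stretch
      (hQ.deriv ξ (hU.ne_zero ξ hξ) _ le_rfl _ (stretch_ge θ hθ ξ))).congr_deriv ?_
    simp only [ContinuousLinearMap.mul_apply', smul_mul_assoc, add_zero]

theorem IsConjFlow.symOrd (hQ : IsConjFlow N lam F R Q Z) (hU : IsChart N U) (hN : 0 < N)
    (hlam : ZSymb N 1 0 (fun p => lamDiag lam p.1 p.2)) (hF : ZSymb N 0 1 (fun p => F p.1 p.2))
    {C : ℝ} (hφ : PhaseBounds N lam F κp κm C) {k : ℕ}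
    (hR : ZSymb N (-(k : ℝ)) ((k : ℝ) + 1) (fun p => R p.1 p.2)) {r : ℕ}
    (hκ : κp ≤ κm) (hr : (r : ℝ) ≤ k - 1 + κp - κm) :
    SymOrd (hypZone n N ∩ univ ×ˢ U) r (fun _ => 1) (fun p => Q p.1 (tBdry N p.2) p.2) := by
  have hS := cylinder_symDomain hU.isOpen hU.ne_zero
  have hT := restrict_symDomain (hypZone_symDomain hN) hU.isOpen
  have h1 : SymOrd (Ici 0 ×ˢ U) r (fun _ => 1)
      (fun p => Q (stretch N p - 1) (tBdry N p.2) p.2) :=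
    IsAlgebraFlow.symOrd hU.isOpen hU.ne_zero (fun _ _ _ => rfl) (fun _ _ => zero_le_one)
      (hU.symOrd_conjRemainder hN hlam hF hφ hR hκ hr) SymOrd.const_zero
      (C := ‖(1 : Matrix (Fin d) (Fin d) ℂ)‖) (norm_nonneg _) (fun _ _ => (mul_one _).ge)
      (hQ.isAlgebraFlow hU)
  have hmap : MapsTo (timeChange (shrink N)) (hypZone n N ∩ univ ×ˢ U) (Ici 0 ×ˢ U) := by
    refine fun p hp => ⟨?_, hp.2.2⟩
    have h3 := (mem_hypZone_iff (hU.ne_zero _ hp.2.2)).1 hp.1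
    have := one_add_tBdry_pos (N := N) p.2
    simp only [timeChange, shrink, mem_Ici, mul_one_div]
    rw [sub_nonneg, one_le_div this]
    linarith
  refine (SymOrd.comp_timeChange hS hT (hU.symOrd_shrink hT inter_subset_right r) hmap h1).congr
    fun p hp => ?_
  have h3 : stretch N (timeChange (shrink N) p) = 1 + p.1 := stretch_shrink
  simp only [h3, add_sub_cancel_left]
  rfl

theorem uniqueDiffOn_zone_slice (hN : 0 < N) (t : ℝ) :
    UniqueDiffOn ℝ {η : Freq n | (t, η) ∈ hypZone n N} := by
  refine (uniqueDiffOn_of_convex_pieces fun ξ hξ => ?_).1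
  have hξ0 : 0 < ‖ξ‖ := norm_pos_iff.2 (hypZone_freq_ne hN hξ)
  refine ⟨{η | ‖ξ‖ ^ 2 ≤ inner ℝ ξ η}, fun η hη => ⟨hξ.1, hξ.2.trans ?_⟩, convex_le_inner _ _,
    by simp, ⟨(2 : ℝ) • ξ, ?_⟩⟩
  · have := hξ.1
    exact mul_le_mul_of_nonneg_left (le_norm_of_le_inner hη) (by positivity)
  · have ho : IsOpen {η : Freq n | ‖ξ‖ ^ 2 < inner ℝ ξ η} :=
      isOpen_lt continuous_const (by fun_prop)
    refine interior_maximal (fun η h => ?_) ho ?_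
    · simp only [mem_ofPred_eq] at h ⊢
      exact h.le
    · simp only [mem_ofPred_eq, inner_smul_right, real_inner_self_eq_norm_sq]
      nlinarith

theorem IsConjFlow.exists_freq_bound_chart (hQ : IsConjFlow N lam F R Q Z) (hU : IsChart N U)
    (hN : 0 < N) (hlam : ZSymb N 1 0 (fun p => lamDiag lam p.1 p.2))
    (hF : ZSymb N 0 1 (fun p => F p.1 p.2)) {C : ℝ} (hφ : PhaseBounds N lam F κp κm C) {k : ℕ}
    (hR : ZSymb N (-(k : ℝ)) ((k : ℝ) + 1) (fun p => R p.1 p.2)) (r : ℕ)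
    (hκ : κp ≤ κm) (hr : (r : ℝ) ≤ k - 1 + κp - κm) :
    ∃ C : ℝ, 0 ≤ C ∧ ∀ ξ ∈ U, ∀ t : ℝ, tBdry N ξ ≤ t →
      ContDiffWithinAt ℝ r (fun η => Q t (tBdry N η) η) {η | (t, η) ∈ hypZone n N} ξ ∧
      ∀ α : Fin r → Fin n,
        ‖iteratedFDerivWithin ℝ r (fun η => Q t (tBdry N η) η) {η | (t, η) ∈ hypZone n N} ξ
          (fun i => EuclideanSpace.single (α i) (1 : ℝ))‖ ≤ C * ‖ξ‖ ^ (-(r : ℝ)) := by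
  have hs := hQ.symOrd hU hN hlam hF hφ hR hκ hr
  have hslice : ∀ t : ℝ, {η : Freq n | (t, η) ∈ hypZone n N ∩ univ ×ˢ U} =
      {η | (t, η) ∈ hypZone n N} ∩ U := fun t => by ext η; simp
  have hb := fun α => hs.norm_iteratedFDerivWithin_slice (fun t => by
    rw [hslice t]; exact (uniqueDiffOn_zone_slice hN t).inter hU.isOpen) α
  choose c hc hb using hb
  refine ⟨∑ α, c α, Finset.sum_nonneg fun α _ => hc α, fun ξ hξ t ht => ⟨?_, fun α => ?_⟩⟩
  · have h1 : ContDiffOn ℝ ∞ (fun η => Q t (tBdry N η) η)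
        ({η | (t, η) ∈ hypZone n N} ∩ U) := by
      rw [← hslice t]
      exact hs.contDiffOn.comp (f := fun η : Freq n => (t, η))
        (contDiffOn_const.prodMk contDiffOn_id) fun η hη => hη
    have hξ0 := hU.ne_zero ξ hξ
    exact (contDiffWithinAt_inter (hU.isOpen.mem_nhds hξ)).1
      ((h1 ξ ⟨(mem_hypZone_iff hξ0).2 ht, hξ⟩).of_le (by exact_mod_cast le_top))
  · have hξ0 := hU.ne_zero ξ hξ
    have h1 := hb α t ξ ⟨(mem_hypZone_iff hξ0).2 ht, mem_univ _, hξ⟩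
    rw [hslice t, iteratedFDerivWithin_inter_open hU.isOpen hξ] at h1
    have h2 : (1 : ℝ) / ‖ξ‖ ^ r = ‖ξ‖ ^ (-(r : ℝ)) := by
      rw [Real.rpow_neg (norm_nonneg _), Real.rpow_natCast, one_div]
    rw [h2] at h1
    exact h1.trans (mul_le_mul_of_nonneg_right
      (Finset.single_le_sum (fun α _ => hc α) (Finset.mem_univ α)) (by positivity))

theorem IsConjFlow.exists_freq_bound (hQ : IsConjFlow N lam F R Q Z)
    (hN : 0 < N) (hlam : ZSymb N 1 0 (fun p => lamDiag lam p.1 p.2))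
    (hF : ZSymb N 0 1 (fun p => F p.1 p.2)) {C : ℝ} (hφ : PhaseBounds N lam F κp κm C) {k : ℕ}
    (hR : ZSymb N (-(k : ℝ)) ((k : ℝ) + 1) (fun p => R p.1 p.2)) (hκ : κp ≤ κm) :
    ∃ C : ℝ, ∀ m : ℕ, (m : ℝ) ≤ k - 1 + κp - κm →
      ∀ ξ : Freq n, ξ ≠ 0 → ‖ξ‖ ≠ N → ∀ t : ℝ, tBdry N ξ ≤ t →
        ContDiffWithinAt ℝ m (fun η => Q t (tBdry N η) η) {η | (t, η) ∈ hypZone n N} ξ ∧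
        ∀ α : Fin m → Fin n,
          ‖iteratedFDerivWithin ℝ m (fun η => Q t (tBdry N η) η) {η | (t, η) ∈ hypZone n N} ξ
            (fun i => EuclideanSpace.single (α i) (1 : ℝ))‖ ≤ C * ‖ξ‖ ^ (-(m : ℝ)) := by
  have h : ∀ m : ℕ, ∃ C : ℝ, 0 ≤ C ∧ ((m : ℝ) ≤ k - 1 + κp - κm →
      ∀ ξ : Freq n, ξ ≠ 0 → ‖ξ‖ ≠ N → ∀ t : ℝ, tBdry N ξ ≤ t →
        ContDiffWithinAt ℝ m (fun η => Q t (tBdry N η) η) {η | (t, η) ∈ hypZone n N} ξ ∧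
        ∀ α : Fin m → Fin n,
          ‖iteratedFDerivWithin ℝ m (fun η => Q t (tBdry N η) η) {η | (t, η) ∈ hypZone n N} ξ
            (fun i => EuclideanSpace.single (α i) (1 : ℝ))‖ ≤ C * ‖ξ‖ ^ (-(m : ℝ))) := by
    intro m
    by_cases hm : (m : ℝ) ≤ k - 1 + κp - κm
    · obtain ⟨C₁, h1, hb1⟩ :=
        hQ.exists_freq_bound_chart (isChart_high hN) hN hlam hF hφ hR m hκ hm
      obtain ⟨C₂, h2, hb2⟩ :=
        hQ.exists_freq_bound_chart (isChart_low hN) hN hlam hF hφ hR m hκ hm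
      refine ⟨C₁ + C₂, by positivity, fun _ ξ hξ hξN t ht => ?_⟩
      have hpos : 0 ≤ ‖ξ‖ ^ (-(m : ℝ)) := by positivity
      rcases lt_or_gt_of_ne hξN with hlt | hgt
      · have h3 := hb2 ξ ⟨hξ, hlt⟩ t ht
        exact ⟨h3.1, fun α => (h3.2 α).trans (mul_le_mul_of_nonneg_right (by linarith) hpos)⟩
      · have h3 := hb1 ξ hgt t ht
        exact ⟨h3.1, fun α => (h3.2 α).trans (mul_le_mul_of_nonneg_right (by linarith) hpos)⟩
    · exact ⟨0, le_rfl, fun h => absurd h hm⟩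
  choose c hc hb using h
  refine ⟨∑ m ∈ Finset.range (k + 1), c m, fun m hm ξ hξ hξN t ht => ?_⟩
  have hmk : m ∈ Finset.range (k + 1) := by
    have : (m : ℝ) ≤ k := by linarith
    rw [Finset.mem_range, Nat.lt_succ_iff]
    exact_mod_cast this
  have h3 := hb m hm ξ hξ hξN t ht
  exact ⟨h3.1, fun α => (h3.2 α).trans (mul_le_mul_of_nonneg_right
    (Finset.single_le_sum (fun m _ => hc m) hmk) (by positivity))⟩

end FrequencyEstimates
end

theorem mainTheorem4 (n d : ℕ) (hn : 1 ≤ n) (hd : 1 ≤ d)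
    (A Ahom : MatField n d) (lam : Fin d → ℝ → Freq n → ℝ)
    (M : MatField n d) (F₀ : ℝ → Freq n → Fin d → ℂ)
    (N₀ : ℝ) (hN₀ : 0 < N₀) (κp κm : ℝ)
    (hA1 : UniformlyStrictlyHyperbolic N₀ A Ahom lam)
    (hA2 : SubprincipalBounds N₀ A Ahom lam M F₀ κp κm)
    (k : ℕ) (hk : κm - κp + 1 < k) :
    ∃ N : ℝ, N₀ ≤ N ∧
    ∃ (Nd : ℕ → MatField n d) (F : ℕ → ℝ → Freq n → Fin d → ℂ) (R : ℕ → MatField n d)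
      (Q : ℝ → ℝ → Freq n → Matrix (Fin d) (Fin d) ℂ),
      IsDiagonalisation N (lamDiag lam) (remainderZero N₀ A Ahom M) k Nd F R ∧
      (∃ E, IsFundamentalSolution N A E) ∧
      (∀ E, IsFundamentalSolution N A E →
        ∀ ξ : Freq n, ξ ≠ 0 → ∀ s t : ℝ, tBdry N ξ ≤ s → s ≤ t →
          E t s ξ = M t ξ * Nd k t ξ * diagExp lam (F (k - 1)) t s ξ * Q t s ξ *
            (Nd k s ξ)⁻¹ * (M s ξ)⁻¹) ∧
      (∃ C : ℝ, ∀ ξ : Freq n, ξ ≠ 0 → ∀ t : ℝ, tBdry N ξ ≤ t →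
        ‖diagExp lam (F (k - 1)) t (tBdry N ξ) ξ‖ ≤ C * ((1 + t) / (1 + tBdry N ξ)) ^ (-κp)) ∧
      (∃ C : ℝ, ∀ ξ : Freq n, ξ ≠ 0 → ∀ s t : ℝ, tBdry N ξ ≤ s → s ≤ t →
        ‖Q t s ξ‖ ≤ C ∧ IsUnit (Q t s ξ) ∧ ‖(Q t s ξ)⁻¹‖ ≤ C) ∧
      (∃ C : ℝ, ∀ m : ℕ, (m : ℝ) ≤ k - 1 + κp - κm →
        ∀ ξ : Freq n, ξ ≠ 0 → ‖ξ‖ ≠ N → ∀ t : ℝ, tBdry N ξ ≤ t →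
          ContDiffWithinAt ℝ m (fun η => Q t (tBdry N η) η) {η | (t, η) ∈ hypZone n N} ξ ∧
          ∀ α : Fin m → Fin n,
            ‖iteratedFDerivWithin ℝ m (fun η => Q t (tBdry N η) η) {η | (t, η) ∈ hypZone n N} ξ
              (fun i => EuclideanSpace.single (α i) (1 : ℝ))‖ ≤ C * ‖ξ‖ ^ (-(m : ℝ))) := by
  have hκ := hA2.le hn hd
  obtain ⟨k, rfl⟩ : ∃ j, k = j + 1 := Nat.exists_eq_succ_of_ne_zero fun h => by
    rw [h, Nat.cast_zero] at hk; linarith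
  obtain ⟨N, hNN, Nd, F, R, hdiag⟩ := exists_isDiagonalisation hN₀ hA1 hA2 (Nat.le_add_left 1 k)
  have hN : 0 < N := hN₀.trans_le hNN
  have hlam := (hA2.zSymb_lamDiag hN₀ hA1).mono hN₀ hNN
  have hF := (isSymbolOn_iff_zSymb hN).1 (hdiag.F_symb k k.lt_succ_self)
  have hR : ZSymb N (-((k + 1 : ℕ) : ℝ)) (((k + 1 : ℕ) : ℝ) + 1) (fun p => R (k + 1) p.1 p.2) :=
    ((isSymbolOn_iff_zSymb hN).1 (hdiag.R_symb k k.lt_succ_self)).cast (by push_cast; ring)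
      (by push_cast; ring)
  have hsub : ZSymb N (-1) 2 (fun p => F k p.1 p.2 - F₀ p.1 p.2) :=
    ((hdiag.zSymb_sub_zero hN k.lt_succ_self).sub hN
      (((isSymbolOn_iff_zSymb hN₀).1 hA2.subprincipal).mono hN₀ hNN)).congr fun p hp => by
        rw [hdiag.F_zero p.1 p.2 hp]; abel
  obtain ⟨C, -, hφ⟩ := exists_phaseBounds hN₀ hNN hlam hA2 hF hsub
  obtain ⟨Q, Z, hQ⟩ := exists_isConjFlow fun ξ hξ s hs =>
    continuousOn_conjRemainder hlam hN hF hR hξ hs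
  obtain ⟨c, hc, hcb⟩ := hφ.norm_conjRemainder_le hN hk hR
  have hA : ∀ ξ : Freq n, ξ ≠ 0 → ContinuousOn (fun t => A t ξ) (Set.Ici (tBdry N ξ)) :=
    fun ξ hξ => continuousOn_coefficient hN₀ hNN hA1 hξ
  have hT := (isSymbolOn_iff_zSymb hN).1 (hdiag.Nd_symb (k + 1) le_rfl)
  have hM := ((isSymbolOn_iff_zSymb hN₀).1 hA2.symb).mono hN₀ hNN
  refine ⟨N, hNN, Nd, F, R, Q, hdiag, exists_isFundamentalSolution hA, fun E hE ξ hξ s t hs hst => ?_,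
    ⟨Real.exp C, fun ξ hξ t ht => hφ.norm_diagExp_le hξ le_rfl ht⟩, hQ.exists_bound hc hcb,
    hQ.exists_freq_bound hN hlam hF hφ hR hκ⟩
  rw [hE.eq_mul (P := fun t ξ => M t ξ * Nd (k + 1) t ξ) hN hA (hM.mul hN hT).contDiffOn
    (fun p hp => (hA2.unit p.1 p.2 (hypZone_subset hNN hp)).mul
      (hdiag.Nd_unit (k + 1) le_rfl p.1 p.2 hp))
    (fun p hp => hA2.intertwine_mul hN₀ hNN hT (hdiag.intertwine k k.lt_succ_self) hp)
    hlam hF hQ hξ hs hst]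
  simp only [Matrix.mul_inv_rev, mul_assoc]
  rfl
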